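/- **Theorem 3 (amortized cost).** Consider the following concurrent set of keys (from a linearly ordered type), used by a finite set $P$ of asynchronous processes with shared memory. It is an external binary search tree (keys in the leaves; a removed leaf leaves an empty node), initially empty, below a fictive root. Every node has a FIFO queue of operation descriptors, and every inner node has an immutable router key and initial size $\mathtt{Init\_Sz}$ (number of keys in its subtree at its creation), and a pointer to an immutable state record: subtree size, number $\mathtt{Mod\_Cnt}$ of modifications (key insertions and removals) of its subtree since its creation, timestamp of the last operation that modified the record. A process starts an operation $\mathtt{insert}(k)$, $\mathtt{remove}(k)$, $\mathtt{contains}(k)$ or $\mathtt{count}(a,b)$ by appending its descriptor to the queue of the fictive root (read the tail timestamp, then CAS, repeated until successful), which gives it the next timestamp. Then it visits the nodes in the descriptor's $\mathtt{Traverse}$ queue one after the other, and at each of them executes, from the head of the node's queue, all operations with timestamps up to its own, thereby helping other processes. Executing an operation in a node $v$ means: for each child in which it has to continue (for an update or $\mathtt{contains}$ the child on the side of the key, for $\mathtt{count}$ the children whose key range meets $[a,b]$ but does not lie in it), append the child to $\mathtt{Traverse}$, update the child's state by CAS and push the descriptor to the child's queue, each unless the operation was already applied there; for $\mathtt{count}$,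 add the sizes of children whose range lies in $[a,b]$; if the child is a leaf or empty, finish there, if needed replacing it by CAS; then record the partial answer and pop the descriptor from $v$'s queue. If the child is an inner node with $\mathtt{Mod\_Cnt}>0$ whose $\mathtt{Mod\_Cnt}$ would exceed $K\cdot\mathtt{Init\_Sz}$ after the operation, its subtree is rebuilt first: execute all operations waiting in it, collect its keys, build a perfectly balanced tree of them with all $\mathtt{Mod\_Cnt}=0$, and swing $v$'s child pointer to it by CAS. The cost is the number of steps: an access to a shared object (register, CAS, operation on a queue or map) costs $1$; building a new subtree costs in addition its number of nodes, and summing up the partial answers of an operation costs in addition their number. Let $0<K<1$ be fixed. Then the amortized cost of $\mathtt{insert}$, $\mathtt{remove}$, $\mathtt{contains}$ and $\mathtt{count}$ is $O((\log N+|P|)\cdot|P|)$, where $N$ is the size of the tree when the operation starts: there is a constant $C$, depending only on $K$, such that in every finite execution, if $N_1,\dots,N_m$ are the numbers of keys in the tree (the content resulting from all operations that have been given a timestamp) at the starts of the $m$ operations started so far (with $\log 0$ read as $0$), the total cost $T$ of all steps of all processes satisfies $$T\le\sum_{i=1}^m C\,(\log N_i+|P|)\,|P| .$$ Moreover, the amortized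 number of nodes that an operation traverses is $O(\log N+|P|)$, and each of them costs $O(|P|)$ amortized, helping and rebuilding included: if $V$ is the number of pairs (operation, node) such that the descriptor of the operation has been inserted into the queue of the node, then $$V\le\sum_{i=1}^m C\,(\log N_i+|P|)\qquad\text{and}\qquad T\le C\,|P|\,(m+V).$$ -/

import Mathlib

universe u v

namespace WaitFreeBST

/-- Operations on a set of keys.  `count a b` asks for the number of keys in `[a, b]`. -/
inductive Op (α : Type u) where
  | insert (k : α)
  | remove (k : α)
  | contains (k : α)
  | count (a b : α)

/-- Ends of the key ranges of subtrees: keys, together with `-∞` and `+∞`. -/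
abbrev Bound (α : Type u) := WithBot (WithTop α)

/-- A key as a bound. -/
def bd {α : Type u} (k : α) : Bound α := ((k : WithTop α) : WithBot (WithTop α))

/-- The two child registers of a node. -/
inductive Dir where
  | left
  | right

/-- What an operation does with a child: continue its execution there, or only add the stored
subtree size of the child to its answer (the key range of the child lies inside the queried one). -/
inductive Act where
  | visit
  | add

/-- The immutable state record a node points to: number of keys in the subtree, number of
modifications of the subtree since the node was created, and timestamp of the last operation that
modified the record.  Successive records of a node have increasing `tsMod`, so that a CAS on the
pointer to the record is the same as a CAS on the record. -/
structure NodeState where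
  size : ℕ
  modCnt : ℕ
  tsMod : ℕ
deriving DecidableEq

/-- The immutable part of a node of an external search tree.  In an inner node, keys `< router` are
in the left and keys `≥ router` in the right subtree; `initSz` is the number of keys in the subtree
at the creation of the node. -/
inductive Body (α : Type u) where
  | empty
  | leaf (k : α)
  | inner (router : Bound α) (initSz : ℕ)

/-- The keys stored in a node itself. -/
def Body.keys {α : Type u} : Body α → List α
  | .leaf k => [k]
  | _ => []

/-- An operation descriptor (immutable part).  `ts` is the timestamp.  `eff` tells whether the
operation changes the set of keys, i.e. whether it is an insertion of an absent key or a removal of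
a present one, at its place in the linearization order. -/
structure Desc (α : Type u) where
  op : Op α
  eff : Bool
  ts : ℕ

/-- The mutable part of an operation descriptor: `traverse` is the queue of nodes that the initiator
still has to visit, `processed` the map from node addresses to partial answers, `result` the final
answer. -/
structure Progress where
  traverse : List ℕ
  processed : List (ℕ × ℕ)
  result : Option ℕ

/-- A node.  All keys of its subtree lie in `[lo, hi)` (immutable).  The registers `left`, `right`
hold addresses of nodes.  `queue` holds the descriptors waiting at the node, head first; `lastTs` is
the timestamp of the queue cell at the tail (it is kept when the queue runs empty). -/
structure Node (α : Type u) where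
  body : Body α
  lo : Bound α
  hi : Bound α
  left : ℕ
  right : ℕ
  st : NodeState
  queue : List (Desc α)
  lastTs : ℕ

/-- Content of a child register. -/
def Node.child {α : Type u} (n : Node α) : Dir → ℕ
  | .left => n.left
  | .right => n.right

/-- Write a child register. -/
def Node.setChild {α : Type u} (n : Node α) (d : Dir) (c : ℕ) : Node α :=
  match d with
  | .left => { n with left := c }
  | .right => { n with right := c }

/-- The key range assigned to a child of a node. -/
def Node.childRange {α : Type u} (n : Node α) (d : Dir) : Bound α × Bound α :=
  match n.body, d with
  | .inner r _, .left => (n.lo, r)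
  | .inner r _, .right => (r, n.hi)
  | _, _ => (n.lo, n.hi)

section Operations

variable {α : Type u} [LinearOrder α]

/-- Sequential effect of an operation on a set of keys. -/
def Op.apply : Op α → Finset α → Finset α
  | .insert k, S => Insert.insert k S
  | .remove k, S => S.erase k
  | _, S => S

/-- Effect of an operation on the sorted list of keys of a leaf or of an empty node. -/
def Op.applyList : Op α → List α → List α
  | .insert k, l => l.orderedInsert (· ≤ ·) k
  | .remove k, l => l.erase k
  | _, l => l

/-- Number of keys in the list `l` of keys of a leaf or empty node that a query asks for. -/
def Op.answer : Op α → List α → ℕ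
  | .contains k, l => l.count k
  | .count a b, l => (l.filter (fun k => a ≤ k ∧ k ≤ b)).length
  | _, _ => 0

/-- The return value of an operation, from the list of its partial answers: for an update, `1` if it
changes the set of keys and `0` if not; for `contains`, `1` or `0`; for `count`, the number. -/
def Desc.result (D : Desc α) (l : List ℕ) : ℕ :=
  (if D.eff then 1 else 0) + l.sum

/-- The state of a child after the operation with descriptor `D`. -/
def Desc.newState (D : Desc α) (s : NodeState) : NodeState :=
  match D.eff, D.op with
  | true, .insert _ => ⟨s.size + 1, s.modCnt + 1, D.ts⟩
  | true, .remove _ => ⟨s.size - 1, s.modCnt + 1, D.ts⟩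
  | _, _ => ⟨s.size, s.modCnt, D.ts⟩

/-- What `count a b` does with a child with key range `[lo, hi)`. -/
def rangeTask (a b : α) (d : Dir) (lo hi : Bound α) : List (Dir × Act) :=
  if hi ≤ bd a ∨ bd b < lo then []
  else if bd a ≤ lo ∧ hi ≤ bd b then [(d, .add)]
  else [(d, .visit)]

/-- What an operation has to do with the child of an inner node in direction of the key `k`. -/
def keyTask (k : α) (router : Bound α) : List (Dir × Act) :=
  if bd k < router then [(.left, .visit)] else [(.right, .visit)]

/-- What an operation has to do with the children of a node. -/
def Op.tasks (op : Op α) (n : Node α) : List (Dir × Act) :=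
  match n.body with
  | .inner r _ =>
    match op with
    | .insert k => keyTask k r
    | .remove k => keyTask k r
    | .contains k => keyTask k r
    | .count a b => rangeTask a b .left n.lo r ++ rangeTask a b .right r n.hi
  | _ => []

end Operations

/-- Shapes of newly built subtrees. -/
inductive Shape (α : Type u) where
  | empty
  | leaf (k : α)
  | inner (router : α) (l r : Shape α)

/-- Number of keys. -/
def Shape.keyCount {α : Type u} : Shape α → ℕ
  | .empty => 0
  | .leaf _ => 1
  | .inner _ l r => l.keyCount + r.keyCount

/-- Number of nodes. -/
def Shape.nodeCount {α : Type u} : Shape α → ℕ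
  | .empty => 1
  | .leaf _ => 1
  | .inner _ l r => l.nodeCount + r.nodeCount + 1

/-- The perfectly balanced external tree over a sorted list of keys: the list is split in the
middle, and the router is the least key of the right half. -/
def ideal {α : Type u} : List α → Shape α
  | [] => .empty
  | [k] => .leaf k
  | a :: b :: l =>
    .inner (((a :: b :: l).drop ((l.length + 2) / 2)).headD b)
      (ideal ((a :: b :: l).take ((l.length + 2) / 2)))
      (ideal ((a :: b :: l).drop ((l.length + 2) / 2)))
termination_by l => l.length
decreasing_by
  · simp only [List.length_take, List.length_cons]; omega
  · simp only [List.length_drop, List.length_cons]; omega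

/-- The shared memory: nodes by address (addresses `≥ next` are free), and the mutable parts of the
descriptors by timestamp.  Moreover there are two auxiliary variables.  `keys` is the set obtained
by executing sequentially all operations inserted so far into the root queue, in that order (the
abstract content of the tree).  `visits` is the number of pairs (operation, node) such that the
descriptor of the operation has been inserted into the queue of the node. -/
structure Shared (α : Type u) where
  node : ℕ → Node α
  next : ℕ
  prog : ℕ → Progress
  keys : Finset α
  visits : ℕ

section Memory

variable {α : Type u}

/-- Modify the node with address `v`. -/
def Shared.modifyNode (sh : Shared α) (v : ℕ) (f : Node α → Node α) : Shared α :=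
  { sh with node := Function.update sh.node v (f (sh.node v)) }

/-- Modify the mutable part of the descriptor with timestamp `ts`. -/
def Shared.modifyProg (sh : Shared α) (ts : ℕ) (f : Progress → Progress) : Shared α :=
  { sh with prog := Function.update sh.prog ts (f (sh.prog ts)) }

/-- Put a new node into a fresh cell, and return its address. -/
def Shared.new (sh : Shared α) (n : Node α) : Shared α × ℕ :=
  ({ sh with node := Function.update sh.node sh.next n, next := sh.next + 1 }, sh.next)

/-- Allocate a subtree of the given shape for the key range `[lo, hi)`, and return the address of
its root.  All nodes get `modCnt = 0`, `tsMod = ts` and an empty queue that accepts only timestamps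
greater than `ts`. -/
def Shared.alloc (ts : ℕ) : Shape α → Bound α → Bound α → Shared α → Shared α × ℕ
  | .empty, lo, hi, sh => sh.new ⟨.empty, lo, hi, 0, 0, ⟨0, 0, ts⟩, [], ts⟩
  | .leaf k, lo, hi, sh => sh.new ⟨.leaf k, lo, hi, 0, 0, ⟨1, 0, ts⟩, [], ts⟩
  | .inner k l r, lo, hi, sh =>
    let x := Shared.alloc ts l lo (bd k) sh
    let y := Shared.alloc ts r (bd k) hi x.1
    y.1.new ⟨.inner (bd k) (l.keyCount + r.keyCount), lo, hi, x.2, y.2,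
      ⟨l.keyCount + r.keyCount, 0, ts⟩, [], ts⟩

/-- Address of the fictive root.  Its router is `+∞`, so that every operation continues in its left
child, the real root; its right child is not used. -/
def root : ℕ := 0

/-- The initial memory: the fictive root, whose child is an empty node. -/
def Shared.init : Shared α where
  node := fun v =>
    if v = root then ⟨.inner ⊤ 0, ⊥, ⊤, 1, 1, ⟨0, 0, 0⟩, [], 0⟩
    else ⟨.empty, ⊥, ⊤, 0, 0, ⟨0, 0, 0⟩, [], 0⟩
  next := 2
  prog := fun _ => ⟨[], [], none⟩
  keys := ∅
  visits := 0

/-- Insert the descriptor `D` at the tail of the queue of `v`, and count the visit. -/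
def Shared.push (sh : Shared α) (v : ℕ) (D : Desc α) : Shared α :=
  { sh.modifyNode v (fun n => { n with queue := n.queue ++ [D], lastTs := D.ts }) with
    visits := sh.visits + 1 }

/-- `push_if`: insert the descriptor `D` at the tail of the queue of `v` unless it has been inserted
before, which is seen from the timestamp at the tail. -/
def Shared.pushIf (sh : Shared α) (v : ℕ) (D : Desc α) : Shared α :=
  if (sh.node v).lastTs < D.ts then sh.push v D else sh

/-- `pop_if`: remove the descriptor `D` from the head of the queue of `v` if it is still there. -/
def Shared.popIf (sh : Shared α) (v : ℕ) (D : Desc α) : Shared α :=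
  match (sh.node v).queue with
  | [] => sh
  | E :: q => if E.ts = D.ts then sh.modifyNode v (fun n => { n with queue := q }) else sh

/-- Add the partial answer `x` of node `v` to the map of processed nodes, unless `v` is there. -/
def Shared.tryInsert (sh : Shared α) (ts v x : ℕ) : Shared α :=
  sh.modifyProg ts (fun p =>
    if v ∈ p.processed.map Prod.fst then p else { p with processed := (v, x) :: p.processed })

/-- Successful insertion of an operation into the root queue, with timestamp `ts`.  Whether the
operation changes the set of keys is determined by its place in the linearization order. -/
def Shared.enqueue [LinearOrder α] (sh : Shared α) (op : Op α) (ts : ℕ) : Shared α × Desc α :=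
  let D : Desc α := ⟨op, decide (op.apply sh.keys ≠ sh.keys), ts⟩
  ({ (sh.push root D).modifyProg ts (fun _ => ⟨[root], [], none⟩) with
      keys := op.apply sh.keys }, D)

end Memory

/-- A place in a tree: a node, or the child register of a node. -/
inductive Place where
  | node (u : ℕ)
  | edge (u : ℕ) (d : Dir)

/-- Where a process is inside a procedure, with its local variables (in `exec` to `casState`, `D` is
the operation being executed, by its initiator or by a helper).  The control state of a process
is the stack of its pending frames, top first; the empty stack means that it has no operation. -/
inductive Frame (α : Type u) where
  /-- read the timestamp at the tail of the root queue -/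
  | enqRead (op : Op α)
  /-- try to append the new descriptor after the tail with timestamp `t` -/
  | enqCas (op : Op α) (t : ℕ)
  /-- take the next node from the head of `D.Traverse` -/
  | traverse (D : Desc α)
  /-- pop the head of `D.Traverse` -/
  | traversePop (D : Desc α)
  /-- execute all operations in the queue of `v` with timestamp at most `D.ts` -/
  | execUntil (D : Desc α) (v : ℕ)
  /-- execute `D` in `v`: tasks that remain, and sum of the partial answers so far -/
  | exec (D : Desc α) (v : ℕ) (todo : List (Dir × Act)) (acc : ℕ)
  /-- first task of the execution of `D` in `v`, after `c` was read from the child register `d` -/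
  | look (D : Desc α) (v : ℕ) (d : Dir) (a : Act) (todo : List (Dir × Act)) (acc : ℕ) (c : ℕ)
  /-- push `c` to `D.Traverse` -/
  | pushTraverse (D : Desc α) (c : ℕ)
  /-- replace the state `s` of `c` by the state after `D` -/
  | casState (D : Desc α) (c : ℕ) (s : NodeState)
  /-- `push_if` on the queue of `c` -/
  | pushIf (D : Desc α) (c : ℕ)
  /-- `pop_if` on the queue of `v` -/
  | popIf (D : Desc α) (v : ℕ)
  /-- rebuilding of the child `c` of `v`: execute all operations waiting in its subtree -/
  | drain (D : Desc α) (v : ℕ) (d : Dir) (c : ℕ) (todo : List Place)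
  /-- rebuilding of the child `c` of `v`: collect all keys of its subtree -/
  | collect (D : Desc α) (v : ℕ) (d : Dir) (c : ℕ) (todo : List Place) (keys : List α)
  /-- create the ideal tree over `keys`, with `tsMod` equal to `ts` -/
  | build (D : Desc α) (v : ℕ) (d : Dir) (c : ℕ) (ts : ℕ) (keys : List α)
  /-- CAS on the child register `d` of `v` from `c` to `nv` -/
  | swing (v : ℕ) (d : Dir) (c nv : ℕ)

section Semantics

variable {α : Type u} [LinearOrder α]

/-- Look at the child `c` (read from register `d` of `v`) in order to continue there the execution
of `D`.  If `c` is a leaf or empty, `D` is finished here, replacing `c` by a new subtree if needed.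
If `c` is an inner node whose number of modifications would exceed `K * initSz`, its subtree is
rebuilt first (a subtree not modified since its creation is still perfectly balanced and is not
rebuilt), and then the task starts again from the register.  Otherwise `D` is handed on to `c`. -/
noncomputable def visitChild (K : ℝ) (sh : Shared α) (D : Desc α) (v : ℕ) (d : Dir)
    (todo : List (Dir × Act)) (acc c : ℕ) : List (Frame α) :=
  let n := sh.node c
  match n.body with
  | .inner _ initSz =>
    if n.st.tsMod < D.ts ∧ 0 < n.st.modCnt ∧
        K * (initSz : ℝ) < (((D.newState n.st).modCnt : ℕ) : ℝ) then
      [.drain D v d c [.node c], .exec D v ((d, .visit) :: todo) acc]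
    else
      [.pushTraverse D c, .casState D c n.st, .pushIf D c, .exec D v todo acc]
  | b =>
    if D.eff = true ∧ n.st.tsMod < D.ts then
      [.build D v d c D.ts (D.op.applyList b.keys), .exec D v todo (acc + D.op.answer b.keys)]
    else
      [.exec D v todo (acc + D.op.answer b.keys)]

/-- One step of a process whose top frame is given: the new shared memory, the frames that replace
the top frame, and the cost of the step.  A step makes one access to one shared object, at cost `1`;
building a private subtree costs one more for each of its nodes, and adding up the partial answers
at the end of an operation costs one more for each of them. -/
noncomputable def step (K : ℝ) (sh : Shared α) : Frame α → Shared α × List (Frame α) × ℕ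
  | .enqRead op => (sh, [.enqCas op (sh.node root).lastTs], 1)
  | .enqCas op t =>
    if (sh.node root).lastTs = t then
      ((sh.enqueue op (t + 1)).1, [.traverse (sh.enqueue op (t + 1)).2], 1)
    else (sh, [.enqRead op], 1)
  | .traverse D =>
    match (sh.prog D.ts).traverse with
    | [] =>
      (sh.modifyProg D.ts (fun p =>
          { p with result := some (D.result (p.processed.map Prod.snd)) }), [],
        1 + (sh.prog D.ts).processed.length)
    | v :: _ => (sh, [.execUntil D v, .traversePop D], 1)
  | .traversePop D =>
    (sh.modifyProg D.ts (fun p => { p with traverse := p.traverse.tail }), [.traverse D], 1)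
  | .execUntil D v =>
    match (sh.node v).queue with
    | [] => (sh, [], 1)
    | E :: _ =>
      if D.ts < E.ts then (sh, [], 1)
      else (sh, [.exec E v (E.op.tasks (sh.node v)) 0, .execUntil D v], 1)
  | .exec D v [] acc => (sh.tryInsert D.ts v acc, [.popIf D v], 1)
  | .exec D v ((d, a) :: todo) acc => (sh, [.look D v d a todo acc ((sh.node v).child d)], 1)
  | .look D v _ .add todo acc c => (sh, [.exec D v todo (acc + (sh.node c).st.size)], 1)
  | .look D v d .visit todo acc c => (sh, visitChild K sh D v d todo acc c, 1)
  | .pushTraverse D c =>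
    (sh.modifyProg D.ts (fun p => { p with traverse := p.traverse ++ [c] }), [], 1)
  | .casState D c s =>
    if s.tsMod < D.ts ∧ (sh.node c).st = s then
      (sh.modifyNode c (fun n => { n with st := D.newState s }), [], 1)
    else (sh, [], 1)
  | .pushIf D c => (sh.pushIf c D, [], 1)
  | .popIf D v => (sh.popIf v D, [], 1)
  | .drain D v d c [] => (sh, [.collect D v d c [.node c] []], 1)
  | .drain D v d c (.edge u e :: todo) =>
    (sh, [.drain D v d c (.node ((sh.node u).child e) :: todo)], 1)
  | .drain D v d c (.node u :: todo) =>
    match (sh.node u).body with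
    | .inner _ _ =>
      match (sh.node u).queue with
      | [] => (sh, [.drain D v d c (.edge u .left :: .edge u .right :: todo)], 1)
      | E :: _ => (sh, [.exec E u (E.op.tasks (sh.node u)) 0, .drain D v d c (.node u :: todo)], 1)
    | _ => (sh, [.drain D v d c todo], 1)
  | .collect D v d c [] keys => (sh, [.build D v d c (D.ts - 1) keys], 1)
  | .collect D v d c (.edge u e :: todo) keys =>
    (sh, [.collect D v d c (.node ((sh.node u).child e) :: todo) keys], 1)
  | .collect D v d c (.node u :: todo) keys =>
    match (sh.node u).body with
    | .inner _ _ => (sh, [.collect D v d c (.edge u .left :: .edge u .right :: todo) keys], 1)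
    | b => (sh, [.collect D v d c todo (keys ++ b.keys)], 1)
  | .build _ v d c ts keys =>
    let x := Shared.alloc ts (ideal keys) ((sh.node v).childRange d).1
      ((sh.node v).childRange d).2 sh
    (x.1, [.swing v d c x.2], 1 + (ideal keys).nodeCount)
  | .swing v d c nv =>
    if (sh.node v).child d = c then (sh.modifyNode v (fun n => n.setChild d nv), [], 1)
    else (sh, [], 1)

/-- A configuration: shared memory, control states of the processes, total cost of all steps so far,
and, for every operation started so far, the number of keys in the tree when it was started. -/
structure Config (α : Type u) (P : Type v) where
  sh : Shared α
  proc : P → List (Frame α)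
  cost : ℕ
  startSizes : List ℕ

/-- The configurations reachable from the empty tree by asynchronous executions with set of
processes `P` and rebuilding constant `K`: at any time any process without an operation may start an
arbitrary operation, and any process with an operation may make its next step. -/
inductive Reachable {P : Type v} [DecidableEq P] (K : ℝ) : Config α P → Prop
  | init : Reachable K ⟨Shared.init, fun _ => [], 0, []⟩
  | start (w : Config α P) (p : P) (op : Op α) (hw : Reachable K w) (hp : w.proc p = []) :
      Reachable K ⟨w.sh, Function.update w.proc p [.enqRead op], w.cost,
        w.sh.keys.card :: w.startSizes⟩
  | step (w : Config α P) (p : P) (f : Frame α) (fs : List (Frame α)) (hw : Reachable K w)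
      (hp : w.proc p = f :: fs) :
      Reachable K ⟨(step K w.sh f).1, Function.update w.proc p ((step K w.sh f).2.1 ++ fs),
        w.cost + (step K w.sh f).2.2, w.startSizes⟩

end Semantics

end WaitFreeBST

/-! The execution is described through its history `H`, which assigns to each timestamp its
operation. It fixes the key set `contents H t` after each timestamp, whether an operation is
effective, and which nodes it concerns: those whose key range it `Visits`. The invariants `MemOK`
say that the memory agrees with the history. The queue of a node consists of the pending operations
concerning its range, its state record is correct for its own timestamp, and it had perfect halves
at its creation. They refer to immutable ghost attributes of nodes: parent, direction, depth and
birth.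

Interference is treated by rely-guarantee. `Rely` bounds what one step may change; every step
satisfies it, and the local assertions `Seg` and `StackOK` about a process are stable under it. What
makes this work is that each node has at most one active operation, the head of its queue.
Registers, records and queues below a node change only for that operation, and a late helper of a
finished operation has no effect. Child registers only move to larger addresses, which excludes ABA
problems.

Cost. Each process executes a pair (operation, node) at most once, because afterwards the operation
has left the head of that queue for ever, and it rebuilds a node at most once, because afterwards
the register has moved on. A potential on control stacks and descriptors therefore gives cost at
most `20` per executed pair, `10` times the weight of each rebuilt node, `8|P|` per timestamp and
`2` per start. A node is rebuilt only if `K * initSz` is less than its modification count plus one,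
with a positive count. So its weight is at most `2/K + 1` times the number of operations in its
queue. Summing over nodes and processes gives `T = O(|P| (m + V))` (`ConfigOK.cost_le`).

Number of visits. An operation is pushed to at most one of the successive nodes of a register
(`Unique`), and at each depth only ranges cut by one of at most two points concern it. So it visits
at most two nodes of each depth. As rebuilding bounds the modifications of a node by `max 1 (K *
initSz)`, the weight of visited nodes shrinks by `7/8` per level. At the top it is at most `2/(1-K)`
times the current size plus one, since `K < 1`. This gives logarithmic depth in the size at the
timestamp (`card_visitSet_le`). While an operation waits for its timestamp, each insertion into the
root queue adds at most `1` to the logarithm of the size. Every timestamp pays this for the at most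
`|P| - 1` other waiting processes, whence the summand `|P|` (`ConfigOK.visits_le`). -/

namespace WaitFreeBST

/-! ### Effect of an operation on a state record -/

section NewState

variable {α : Type u}

theorem newState_of_not_eff {D : Desc α} {s : NodeState} (hD : D.eff = false) :
    D.newState s = ⟨s.size, s.modCnt, D.ts⟩ := by
  unfold Desc.newState
  rw [hD]

@[simp] theorem newState_tsMod {D : Desc α} {s : NodeState} : (D.newState s).tsMod = D.ts := by
  unfold Desc.newState
  split <;> rfl

theorem newState_modCnt_le {D : Desc α} {s : NodeState} :
    s.modCnt ≤ (D.newState s).modCnt ∧ (D.newState s).modCnt ≤ s.modCnt + 1 := by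
  unfold Desc.newState
  split <;> simp

end NewState

/-! ### Histories: contents, key ranges and modification counts -/

section History

variable {α : Type u} [LinearOrder α]

/-- The set of keys after the first `t` operations of the history `H`. -/
def contents (H : ℕ → Op α) : ℕ → Finset α
  | 0 => ∅
  | t + 1 => (H (t + 1)).apply (contents H t)

/-- The descriptor of the operation with timestamp `t` in the history `H`. -/
def descOf (H : ℕ → Op α) (t : ℕ) : Desc α :=
  ⟨H t, decide (contents H t ≠ contents H (t - 1)), t⟩

@[simp] theorem descOf_op (H : ℕ → Op α) (t : ℕ) : (descOf H t).op = H t := rfl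

@[simp] theorem descOf_ts (H : ℕ → Op α) (t : ℕ) : (descOf H t).ts = t := rfl

/-- The operation has to visit an inner node with key range `[lo, hi)`. -/
def Op.Visits : Op α → Bound α → Bound α → Prop
  | .insert k, lo, hi => lo ≤ bd k ∧ bd k < hi
  | .remove k, lo, hi => lo ≤ bd k ∧ bd k < hi
  | .contains k, lo, hi => lo ≤ bd k ∧ bd k < hi
  | .count a b, lo, hi => ¬(hi ≤ bd a ∨ bd b < lo) ∧ ¬(bd a ≤ lo ∧ hi ≤ bd b)

/-- The keys of `S` in `[lo, hi)`. -/
def keysIn (S : Finset α) (lo hi : Bound α) : Finset α :=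
  S.filter fun x => lo ≤ bd x ∧ bd x < hi

theorem mem_keysIn {S : Finset α} {lo hi : Bound α} {x : α} :
    x ∈ keysIn S lo hi ↔ x ∈ S ∧ lo ≤ bd x ∧ bd x < hi := by
  simp [keysIn]

theorem bd_lt_bd {a b : α} : bd a < bd b ↔ a < b := by
  simp [bd]

theorem bd_le_bd {a b : α} : bd a ≤ bd b ↔ a ≤ b := by
  simp [bd]

theorem bd_lt_top (a : α) : bd a < (⊤ : Bound α) := by
  rw [bd, ← WithBot.coe_top, WithBot.coe_lt_coe]
  exact WithTop.coe_lt_top a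

theorem bot_lt_bd (a : α) : (⊥ : Bound α) < bd a := WithBot.bot_lt_coe _

/-- An effective operation at time `t` that has to visit the range `[lo, hi)`. -/
def Modifies (H : ℕ → Op α) (lo hi : Bound α) (t : ℕ) : Prop :=
  (descOf H t).eff = true ∧ (H t).Visits lo hi

open scoped Classical in
/-- Number of modifications of the key range `[lo, hi)` at times in `(a, b]`. -/
noncomputable def mods (H : ℕ → Op α) (a b : ℕ) (lo hi : Bound α) : ℕ :=
  ((Finset.Ioc a b).filter (Modifies H lo hi)).card

variable {H : ℕ → Op α} {lo hi r : Bound α}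

theorem eff_cases {t : ℕ} (h : (descOf H t).eff = true) :
    1 ≤ t ∧ ((∃ k, H t = .insert k ∧ k ∉ contents H (t - 1) ∧
      contents H t = insert k (contents H (t - 1))) ∨
    (∃ k, H t = .remove k ∧ k ∈ contents H (t - 1) ∧
      contents H t = (contents H (t - 1)).erase k)) := by
  simp only [descOf, decide_eq_true_eq] at h
  cases t with
  | zero => simp at h
  | succ t =>
    refine ⟨by omega, ?_⟩
    simp only [Nat.add_sub_cancel, contents] at h ⊢
    cases hop : H (t + 1) with
    | insert k =>
      left
      rw [hop] at h
      refine ⟨k, rfl, fun hk => h ?_, rfl⟩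
      simp [Op.apply, hk]
    | remove k =>
      right
      rw [hop] at h
      refine ⟨k, rfl, ?_, rfl⟩
      by_contra hk
      exact h (by simp [Op.apply, hk])
    | contains k => rw [hop] at h; exact absurd rfl h
    | count a b => rw [hop] at h; exact absurd rfl h

theorem contents_of_not_eff {t : ℕ} (h : (descOf H t).eff = false) :
    contents H t = contents H (t - 1) := by
  simpa [descOf] using h

theorem keysIn_of_not_modifies {t : ℕ} (h : ¬ Modifies H lo hi t) :
    keysIn (contents H t) lo hi = keysIn (contents H (t - 1)) lo hi := by
  cases he : (descOf H t).eff with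
  | false => rw [contents_of_not_eff he]
  | true =>
    have hv : ¬ (H t).Visits lo hi := fun hv => h ⟨he, hv⟩
    obtain ⟨-, ⟨k, hk, -, hc⟩ | ⟨k, hk, -, hc⟩⟩ := eff_cases he
    all_goals
      rw [hk] at hv
      ext x
      simp only [mem_keysIn, hc, Finset.mem_insert, Finset.mem_erase]
      constructor
      · rintro ⟨h1, h2⟩
        first
          | exact ⟨h1.resolve_left (fun e => hv (e ▸ h2)), h2⟩
          | exact ⟨h1.2, h2⟩
      · rintro ⟨h1, h2⟩
        first
          | exact ⟨Or.inr h1, h2⟩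
          | exact ⟨⟨fun e => hv (e ▸ h2), h1⟩, h2⟩

theorem keysIn_of_modifies {t : ℕ} (h : Modifies H lo hi t) :
    1 ≤ t ∧ ((∃ k, H t = .insert k ∧ k ∉ contents H (t - 1) ∧
      keysIn (contents H t) lo hi = insert k (keysIn (contents H (t - 1)) lo hi)) ∨
    (∃ k, H t = .remove k ∧ k ∈ keysIn (contents H (t - 1)) lo hi ∧
      keysIn (contents H t) lo hi = (keysIn (contents H (t - 1)) lo hi).erase k)) := by
  obtain ⟨he, hv⟩ := h
  obtain ⟨h1, ⟨k, hk, hm, hc⟩ | ⟨k, hk, hm, hc⟩⟩ := eff_cases he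
  · refine ⟨h1, Or.inl ⟨k, hk, hm, ?_⟩⟩
    rw [hk] at hv
    ext x
    simp only [mem_keysIn, hc, Finset.mem_insert]
    constructor
    · rintro ⟨rfl | h2, h3⟩
      · exact Or.inl rfl
      · exact Or.inr ⟨h2, h3⟩
    · rintro (rfl | h2)
      · exact ⟨Or.inl rfl, hv⟩
      · exact ⟨Or.inr h2.1, h2.2⟩
  · rw [hk] at hv
    refine ⟨h1, Or.inr ⟨k, hk, mem_keysIn.2 ⟨hm, hv⟩, ?_⟩⟩
    ext x
    simp only [mem_keysIn, hc, Finset.mem_erase]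
    tauto

theorem mods_self (a : ℕ) : mods H a a lo hi = 0 := by
  simp [mods]

theorem mods_add {a b c : ℕ} (hab : a ≤ b) (hbc : b ≤ c) :
    mods H a b lo hi + mods H b c lo hi = mods H a c lo hi := by
  classical
  unfold mods
  rw [← Finset.card_union_of_disjoint, ← Finset.filter_union, Finset.Ioc_union_Ioc_eq_Ioc hab hbc]
  exact Finset.disjoint_filter_filter (Finset.disjoint_left.2 fun x hx hy => by
    simp only [Finset.mem_Ioc] at hx hy; omega)

theorem mods_mono {a b c : ℕ} (hbc : b ≤ c) : mods H a b lo hi ≤ mods H a c lo hi := by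
  classical
  exact Finset.card_le_card (Finset.filter_subset_filter _ (Finset.Ioc_subset_Ioc_right hbc))

theorem mods_succ (a : ℕ) {b : ℕ} (hab : a ≤ b) [Decidable (Modifies H lo hi (b + 1))] :
    mods H a (b + 1) lo hi = mods H a b lo hi + if Modifies H lo hi (b + 1) then 1 else 0 := by
  classical
  rw [← mods_add hab (Nat.le_succ b)]
  congr 1
  unfold mods
  rw [Nat.Ioc_succ_singleton, Finset.filter_singleton]
  split_ifs <;> rfl

theorem mods_eq_zero {a b : ℕ} (h : ∀ t, a < t → t ≤ b → ¬ Modifies H lo hi t) :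
    mods H a b lo hi = 0 := by
  classical
  unfold mods
  rw [Finset.card_eq_zero, Finset.filter_eq_empty_iff]
  intro t ht
  rw [Finset.mem_Ioc] at ht
  exact h t ht.1 ht.2

theorem keysIn_eq_of_not_modifies {a b : ℕ} (hab : a ≤ b)
    (h : ∀ t, a < t → t ≤ b → ¬ Modifies H lo hi t) :
    keysIn (contents H b) lo hi = keysIn (contents H a) lo hi := by
  induction b, hab using Nat.le_induction with
  | base => rfl
  | succ b hab ih =>
    rw [← ih fun t h1 h2 => h t h1 (by omega), keysIn_of_not_modifies (h _ (by omega) le_rfl)]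
    rfl

theorem card_keysIn_step (t : ℕ) [Decidable (Modifies H lo hi (t + 1))] :
    (keysIn (contents H (t + 1)) lo hi).card ≤
      (keysIn (contents H t) lo hi).card + (if Modifies H lo hi (t + 1) then 1 else 0) ∧
    (keysIn (contents H t) lo hi).card ≤
      (keysIn (contents H (t + 1)) lo hi).card + (if Modifies H lo hi (t + 1) then 1 else 0) := by
  split_ifs with h
  · obtain ⟨-, ⟨k, -, hm, hc⟩ | ⟨k, -, hm, hc⟩⟩ := keysIn_of_modifies h
    · rw [hc, Finset.card_insert_of_notMem (fun h => hm (mem_keysIn.1 h).1)]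
      simp only [Nat.add_sub_cancel]
      omega
    · rw [hc, Finset.card_erase_of_mem hm]
      simp only [Nat.add_sub_cancel]
      omega
  · rw [keysIn_of_not_modifies h]
    simp

/-- Each modification adds or removes one key of the range. Both directions matter: forwards to
bound present sizes of subtrees by initial ones, backwards to bound the initial size of the top node
by the present content. -/
theorem card_keysIn_le {a b : ℕ} (hab : a ≤ b) :
    (keysIn (contents H b) lo hi).card ≤
      (keysIn (contents H a) lo hi).card + mods H a b lo hi ∧
    (keysIn (contents H a) lo hi).card ≤
      (keysIn (contents H b) lo hi).card + mods H a b lo hi := by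
  classical
  induction b, hab using Nat.le_induction with
  | base => simp
  | succ b hab ih =>
    have h1 := card_keysIn_step (H := H) (lo := lo) (hi := hi) b
    rw [mods_succ a hab]
    omega

theorem keysIn_split (S : Finset α) (h1 : lo ≤ r) (h2 : r ≤ hi) :
    (keysIn S lo r).card + (keysIn S r hi).card = (keysIn S lo hi).card := by
  rw [← Finset.card_union_of_disjoint]
  · congr 1
    ext x
    simp only [Finset.mem_union, mem_keysIn]
    constructor
    · rintro (⟨h, h3, h4⟩ | ⟨h, h3, h4⟩)
      · exact ⟨h, h3, h4.trans_le h2⟩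
      · exact ⟨h, h1.trans h3, h4⟩
    · rintro ⟨h, h3, h4⟩
      rcases lt_or_ge (bd x) r with h5 | h5
      · exact Or.inl ⟨h, h3, h5⟩
      · exact Or.inr ⟨h, h5, h4⟩
  · refine Finset.disjoint_left.2 fun x hx hy => ?_
    exact absurd (mem_keysIn.1 hx).2.2 (not_lt.2 (mem_keysIn.1 hy).2.1)

/-- Consequently an operation that concerns a node concerns all its ancestors. -/
theorem Op.Visits.mono {op : Op α} {lo' hi' : Bound α} (h : op.Visits lo hi) (h1 : lo' ≤ lo)
    (h2 : hi ≤ hi') : op.Visits lo' hi' := by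
  cases op with
  | count a b =>
    obtain ⟨h3, h4⟩ := h
    refine ⟨?_, ?_⟩
    · rintro (h5 | h5)
      · exact h3 (Or.inl (h2.trans h5))
      · exact h3 (Or.inr (h5.trans_le h1))
    · rintro ⟨h5, h6⟩
      exact h4 ⟨h5.trans h1, h2.trans h6⟩
  | _ => exact ⟨h1.trans h.1, h.2.trans_le h2⟩

theorem Modifies.mono {t : ℕ} {lo' hi' : Bound α} (h : Modifies H lo hi t) (h1 : lo' ≤ lo)
    (h2 : hi ≤ hi') : Modifies H lo' hi' t := ⟨h.1, h.2.mono h1 h2⟩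

/-- Only updates are effective, and the single key of an update lies on one side of `r`. -/
theorem mods_split_le (a b : ℕ) (h1 : lo ≤ r) (h2 : r ≤ hi) :
    mods H a b lo r + mods H a b r hi ≤ mods H a b lo hi := by
  classical
  unfold mods
  rw [← Finset.card_union_of_disjoint, ← Finset.filter_or]
  · refine Finset.card_le_card (Finset.monotone_filter_right _ ?_)
    rintro t - (h | h)
    · exact h.mono le_rfl h2
    · exact h.mono h1 le_rfl
  · refine Finset.disjoint_filter.2 fun t _ h3 h4 => ?_
    obtain ⟨-, ⟨k, hk, -⟩ | ⟨k, hk, -⟩⟩ := eff_cases h3.1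
    all_goals
      have h5 := h3.2
      have h6 := h4.2
      rw [hk] at h5 h6
      exact absurd h5.2 (not_lt.2 h6.1)

theorem mods_range_mono {a b : ℕ} {lo' hi' : Bound α} (h1 : lo' ≤ lo) (h2 : hi ≤ hi') :
    mods H a b lo hi ≤ mods H a b lo' hi' := by
  classical
  exact Finset.card_le_card (Finset.monotone_filter_right _ fun t _ h => h.mono h1 h2)

theorem visits_univ (op : Op α) : op.Visits ⊥ ⊤ := by
  cases op with
  | count a b =>
    refine ⟨?_, ?_⟩
    · rintro (h | h)
      · exact absurd (bd_lt_top a) (not_lt.2 h)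
      · exact not_lt_bot h
    · rintro ⟨h, -⟩
      exact absurd (bot_lt_bd a) (not_lt.2 h)
  | _ k => exact ⟨bot_le, bd_lt_top k⟩

theorem keysIn_univ (S : Finset α) : keysIn S ⊥ ⊤ = S := by
  ext x
  simp [mem_keysIn, bd_lt_top]

/-- This is the key range of the unused right register of the fictive root. -/
theorem not_visits_empty (op : Op α) : ¬ op.Visits ⊤ ⊤ := by
  cases op with
  | count a b => exact fun h => h.1 (Or.inr (bd_lt_top b))
  | _ k => exact fun h => absurd h.2 (not_lt.2 h.1)

theorem mem_rangeTask {a b : α} {d e : Dir} {lo hi : Bound α} :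
    (e, Act.visit) ∈ rangeTask a b d lo hi ↔ e = d ∧ (Op.count a b).Visits lo hi := by
  unfold rangeTask Op.Visits
  split_ifs with h1 h2 <;> simp_all

/-- An operation with one key compares it with the router only; the outer bounds of the child range
come from `hv`. -/
theorem mem_tasks_visit {op : Op α} {n : Node α} (hn : ∃ r i, n.body = .inner r i)
    (hv : op.Visits n.lo n.hi) (d : Dir) :
    (d, Act.visit) ∈ op.tasks n ↔ op.Visits (n.childRange d).1 (n.childRange d).2 := by
  obtain ⟨r, i, hb⟩ := hn
  unfold Op.tasks Node.childRange
  rw [hb]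
  cases op with
  | count a b =>
    cases d <;> simp [mem_rangeTask]
  | _ k =>
    cases d <;> simp only [keyTask, Op.Visits] at hv ⊢ <;> split_ifs with h <;> simp_all

theorem length_tasks_le (op : Op α) (n : Node α) : (op.tasks n).length ≤ 2 := by
  unfold Op.tasks
  cases n.body with
  | inner r i =>
    cases op with
    | count a b =>
      simp only [List.length_append, rangeTask]
      split_ifs <;> simp
    | _ k => simp only [keyTask]; split_ifs <;> simp
  | _ => simp

/-- `D.newState` describes the effect of `D` on a subtree that it has to visit. -/
theorem newState_spec {t a : ℕ} {s : NodeState} (hts : s.tsMod < t) (ha : a ≤ s.tsMod)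
    (hv : (H t).Visits lo hi)
    (hno : ∀ t', s.tsMod < t' → t' < t → ¬ Modifies H lo hi t')
    (hsize : s.size = (keysIn (contents H s.tsMod) lo hi).card)
    (hmod : s.modCnt = mods H a s.tsMod lo hi) :
    ((descOf H t).newState s).size = (keysIn (contents H t) lo hi).card ∧
    ((descOf H t).newState s).modCnt = mods H a t lo hi := by
  classical
  obtain ⟨t, rfl⟩ : ∃ t', t = t' + 1 := ⟨t - 1, by omega⟩
  -- Nothing modifies the range after the record was written, so the record still describes the
  -- subtree just before the operation.
  have hk := keysIn_eq_of_not_modifies (H := H) (lo := lo) (hi := hi) (a := s.tsMod) (b := t)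
    (by omega) fun t' h1 h2 => hno t' h1 (by omega)
  have hm : mods H a t lo hi = mods H a s.tsMod lo hi := by
    rw [← mods_add ha (by omega : s.tsMod ≤ t),
      mods_eq_zero (a := s.tsMod) fun t' h1 h2 => hno t' h1 (by omega), add_zero]
  rw [mods_succ a (by omega), hm, ← hmod]
  cases he : (descOf H (t + 1)).eff with
  | false =>
    have hno' : ¬ Modifies H lo hi (t + 1) := fun h => by simp [h.1] at he
    rw [newState_of_not_eff he, keysIn_of_not_modifies hno']
    simp [hno', hk, hsize]
  | true =>
    have hM : Modifies H lo hi (t + 1) := ⟨he, hv⟩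
    unfold Desc.newState
    rw [he, if_pos hM]
    obtain ⟨-, ⟨k, hop, hm, hc⟩ | ⟨k, hop, hm, hc⟩⟩ := keysIn_of_modifies hM
    · rw [hc, Finset.card_insert_of_notMem (fun h => hm (mem_keysIn.1 h).1)]
      simp [hop, hk, hsize]
    · rw [hc, Finset.card_erase_of_mem hm]
      simp [hop, hk, hsize]

/-- The sorted list `l` has the elements of `F`. -/
def IsList (l : List α) (F : Finset α) : Prop :=
  l.Pairwise (· < ·) ∧ ∀ x, x ∈ l ↔ x ∈ F

theorem IsList.length_eq {l : List α} {F : Finset α} (h : IsList l F) : l.length = F.card := by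
  have hn : l.Nodup := h.1.imp (fun h => ne_of_lt h)
  rw [← List.toFinset_card_of_nodup hn]
  congr 1
  ext x
  simp [h.2]

/-- The effect of an effective update on the keys of a leaf. -/
theorem applyList_isList {t : ℕ} {l : List α} (hl : l.length ≤ 1) (hM : Modifies H lo hi t)
    (h : ∀ x, x ∈ l ↔ x ∈ keysIn (contents H (t - 1)) lo hi) :
    IsList ((H t).applyList l) (keysIn (contents H t) lo hi) ∧
      ((H t).applyList l).length ≤ 2 := by
  obtain ⟨-, ⟨k, hop, hm, hc⟩ | ⟨k, hop, hm, hc⟩⟩ := keysIn_of_modifies hM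
  · have hk : k ∉ l := fun hk => hm (mem_keysIn.1 ((h k).1 hk)).1
    rw [hop]
    simp only [Op.applyList]
    refine ⟨⟨?_, fun x => ?_⟩, ?_⟩
    · match l, hl, hk with
      | [], _, _ => simp
      | [a], _, hk =>
        have : k ≠ a := by simpa using hk
        simp only [List.orderedInsert]
        split_ifs with h1
        · simpa using lt_of_le_of_ne h1 this
        · simpa using h1
    · rw [List.mem_orderedInsert, hc, Finset.mem_insert, h]
    · rw [List.orderedInsert_length]; omega
  · rw [hop]
    simp only [Op.applyList]
    match l, hl, h with
    | [], _, h => exact absurd ((h k).2 hm) (by simp)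
    | [a], _, h =>
      have : k = a := by simpa using (h k).2 hm
      subst this
      refine ⟨⟨by simp, fun x => ?_⟩, by simp⟩
      rw [hc, Finset.mem_erase, ← h]
      simp

end History

/-- Immutable attributes of a node that the memory does not store: its place in the tree, and the
timestamp of its creation. -/
structure Ghost where
  par : ℕ
  dir : Dir
  depth : ℕ
  birth : ℕ

/-! ### Invariants of the memory, and the rely relation -/

section Predicates

variable {α : Type u}

/-- Inner nodes. -/
def Body.IsInner : Body α → Prop
  | .inner _ _ => True
  | _ => False

/-- Initial size of an inner node. -/
def Body.initSz : Body α → ℕ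
  | .inner _ i => i
  | _ => 0

theorem Body.isInner_iff {b : Body α} : b.IsInner ↔ ∃ r i, b = .inner r i := by
  cases b <;> simp [Body.IsInner]

theorem Body.length_keys_le (b : Body α) : b.keys.length ≤ 1 := by
  cases b <;> simp [Body.keys]

/-- All operations with timestamp up to `n.done` have been executed in the node `n`. -/
def Node.done (n : Node α) : ℕ :=
  match n.queue with
  | [] => n.lastTs
  | E :: _ => E.ts - 1

/-- The operation with descriptor `D` has been handed on to the node, or need not be. -/
def Node.Recv (n : Node α) (D : Desc α) : Prop :=
  (¬ n.body.IsInner ∧ D.eff = false) ∨ D.ts ≤ n.lastTs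

theorem childRange_congr {n n' : Node α} (hb : n'.body = n.body) (hl : n'.lo = n.lo)
    (hh : n'.hi = n.hi) : n'.childRange = n.childRange := by
  funext d
  unfold Node.childRange
  rw [hb, hl, hh]

theorem Node.done_of_nil {n : Node α} (h : n.queue = []) : n.done = n.lastTs := by
  simp [Node.done, h]

theorem Node.done_of_cons {n : Node α} {D : Desc α} {q : List (Desc α)} (h : n.queue = D :: q) :
    n.done = D.ts - 1 := by
  simp [Node.done, h]

variable [LinearOrder α]

/-- Operations after the last one handed on to the node, up to time `T`, do not concern it. -/
def Node.UpTo (H : ℕ → Op α) (n : Node α) (T : ℕ) : Prop :=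
  ∀ t, n.lastTs < t → t ≤ T → (H t).Visits n.lo n.hi → ¬ n.body.IsInner ∧ (descOf H t).eff = false

/-- Fields of an inner node created at time `b`. -/
structure InnerOK (K : ℝ) (H : ℕ → Op α) (n : Node α) (b : ℕ) : Prop where
  size : n.st.size = (keysIn (contents H n.st.tsMod) n.lo n.hi).card
  mod : n.st.modCnt = mods H b n.st.tsMod n.lo n.hi
  init : n.body.initSz = (keysIn (contents H b) n.lo n.hi).card
  -- The alternative `1` is needed because a node with `modCnt = 0` is never rebuilt, so its first
  -- modification is admitted even if it exceeds `K * initSz`.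
  bound : (n.st.modCnt : ℝ) ≤ max 1 (K * n.body.initSz)
  half : ∀ d, 1 ≤ (keysIn (contents H b) (n.childRange d).1 (n.childRange d).2).card ∧
    2 * (keysIn (contents H b) (n.childRange d).1 (n.childRange d).2).card ≤ n.body.initSz + 1

/-- Invariants of a node other than the fictive root. -/
structure NonrootOK (K : ℝ) (H : ℕ → Op α) (G : ℕ → Ghost) (nd : ℕ → Node α) (next v : ℕ) :
    Prop where
  par_lt : (G v).par < next
  par_inner : (nd (G v).par).body.IsInner
  par_root : (G v).par = root → (G v).dir = .left
  lo_eq : (nd v).lo = ((nd (G v).par).childRange (G v).dir).1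
  hi_eq : (nd v).hi = ((nd (G v).par).childRange (G v).dir).2
  depth_eq : (G v).depth = (G (G v).par).depth + 1
  birth_par : (G (G v).par).birth ≤ (G v).birth
  -- An operation enters the queue of the parent, then the record of the node, then its queue. With
  -- the next field this bounds tails of queues along every path downwards.
  tsMod_le : (nd v).st.tsMod ≤ (nd (G v).par).lastTs
  lastTs_le_tsMod : (nd v).lastTs ≤ (nd v).st.tsMod
  inner : (nd v).body.IsInner → InnerOK K H (nd v) (G v).birth
  -- A node outside its register is either new and not yet linked, with `lastTs` equal to its birth,
  -- or replaced; in the latter case the parent has finished all that the node received. This is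
  -- what `Unique` rests on.
  late : (nd (G v).par).child (G v).dir ≠ v → (G v).birth < (nd v).lastTs →
    (nd v).lastTs ≤ (nd (G v).par).done

/-- Invariants of a node. -/
structure NodeOK (K : ℝ) (H : ℕ → Op α) (G : ℕ → Ghost) (nd : ℕ → Node α) (next v : ℕ) :
    Prop where
  leaf : ¬ (nd v).body.IsInner → (nd v).queue = [] ∧ (nd v).lastTs = (G v).birth ∧
    (nd v).st.tsMod = (G v).birth ∧
    ∀ x, x ∈ (nd v).body.keys ↔ x ∈ keysIn (contents H (G v).birth) (nd v).lo (nd v).hi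
  birth_le : (G v).birth ≤ (nd v).lastTs
  lastTs_le : (nd v).lastTs ≤ (nd root).lastTs
  range : (nd v).body.IsInner → ∀ d, (nd v).lo ≤ ((nd v).childRange d).1 ∧
    ((nd v).childRange d).2 ≤ (nd v).hi
  sorted : (nd v).queue.Pairwise fun D E => D.ts < E.ts
  mem : ∀ E ∈ (nd v).queue, E = descOf H E.ts ∧ (H E.ts).Visits (nd v).lo (nd v).hi ∧
    (G v).birth < E.ts ∧ E.ts ≤ (nd v).lastTs
  -- Together with `mem` and `sorted`, the queue is determined by the history.
  complete : ∀ t, (nd v).done < t → t ≤ (nd v).lastTs → (H t).Visits (nd v).lo (nd v).hi →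
    descOf H t ∈ (nd v).queue
  nonroot : v ≠ root → NonrootOK K H G nd next v

/-- Invariants of the child register `d` of `u`. -/
structure EdgeOK (H : ℕ → Op α) (G : ℕ → Ghost) (nd : ℕ → Node α) (next u : ℕ) (d : Dir) :
    Prop where
  lt : (nd u).child d < next
  ne_root : (nd u).child d ≠ root
  par_eq : (G ((nd u).child d)).par = u
  dir_eq : (G ((nd u).child d)).dir = d
  upTo : (nd ((nd u).child d)).UpTo H (nd u).done

open scoped Classical in
/-- Number of operations inserted into the queue of a node created at time `b`. -/
noncomputable def visitCount (H : ℕ → Op α) (n : Node α) (b : ℕ) : ℕ :=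
  ((Finset.Ioc b n.lastTs).filter fun t => (H t).Visits n.lo n.hi).card

/-- Invariants of the shared memory. -/
structure MemOK (K : ℝ) (H : ℕ → Op α) (G : ℕ → Ghost) (sh : Shared α) : Prop where
  root_lt : root < sh.next
  root_body : (sh.node root).body = .inner ⊤ 0
  root_lo : (sh.node root).lo = ⊥
  root_hi : (sh.node root).hi = ⊤
  root_birth : (G root).birth = 0
  root_depth : (G root).depth = 0
  node : ∀ v < sh.next, NodeOK K H G sh.node sh.next v
  edge : ∀ u < sh.next, (sh.node u).body.IsInner → ∀ d, (u = root → d = .left) →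
    EdgeOK H G sh.node sh.next u d
  queue_nil : ∀ v, sh.next ≤ v → (sh.node v).queue = []
  keys : sh.keys = contents H (sh.node root).lastTs
  visits : sh.visits = ∑ v ∈ Finset.range sh.next, visitCount H (sh.node v) (G v).birth

/-- `D` has been inserted into the queue of `v`, and is its head or has been executed there. -/
structure Started (H : ℕ → Op α) (G : ℕ → Ghost) (sh : Shared α) (D : Desc α) (v : ℕ) : Prop where
  desc : D = descOf H D.ts
  visits : (H D.ts).Visits (sh.node v).lo (sh.node v).hi
  lt : v < sh.next
  inner : (sh.node v).body.IsInner
  birth_lt : (G v).birth < D.ts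
  le_lastTs : D.ts ≤ (sh.node v).lastTs
  le_done : D.ts ≤ (sh.node v).done + 1

/-- `D` is at the head of the queue of `v`. -/
structure Active (H : ℕ → Op α) (G : ℕ → Ghost) (sh : Shared α) (D : Desc α) (v : ℕ) : Prop
    extends Started H G sh D v where
  done_lt : (sh.node v).done < D.ts

/-- The key range of the child register `d` of `n` concerns `op`. -/
def Node.Task (n : Node α) (op : Op α) (d : Dir) : Prop :=
  op.Visits (n.childRange d).1 (n.childRange d).2

/-- The subtree of the inner node `n` has to be rebuilt before `D` is handed on to it. -/
def Needs (K : ℝ) (D : Desc α) (n : Node α) : Prop :=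
  n.st.tsMod < D.ts ∧ 0 < n.st.modCnt ∧
    K * (n.body.initSz : ℝ) < (((D.newState n.st).modCnt : ℕ) : ℝ)

/-- What one step may change in the memory. -/
structure Rely (K : ℝ) (H : ℕ → Op α) (G : ℕ → Ghost) (sh sh' : Shared α) : Prop where
  next_le : sh.next ≤ sh'.next
  body : ∀ v < sh.next, (sh'.node v).body = (sh.node v).body
  lo : ∀ v < sh.next, (sh'.node v).lo = (sh.node v).lo
  hi : ∀ v < sh.next, (sh'.node v).hi = (sh.node v).hi
  done_le : ∀ v < sh.next, (sh.node v).done ≤ (sh'.node v).done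
  lastTs_le : ∀ v < sh.next, (sh.node v).lastTs ≤ (sh'.node v).lastTs
  -- New nodes have larger addresses than all old ones, so a register never returns to an earlier
  -- value.
  child_le : ∀ v < sh.next, ∀ d, (sh.node v).child d ≤ (sh'.node v).child d
  -- Only two swings occur, both for the active operation: from a leaf to a tree that already
  -- contains its effect, or from an inner node due for rebuilding that has received all earlier
  -- operations.
  swing : ∀ v < sh.next, ∀ d, (sh'.node v).child d ≠ (sh.node v).child d →
    ∃ D, Active H G sh D v ∧ (sh'.node v).done = (sh.node v).done ∧
      ((¬ (sh.node ((sh.node v).child d)).body.IsInner ∧ D.eff = true ∧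
        (sh.node ((sh.node v).child d)).lastTs < D.ts ∧
        D.ts ≤ (sh'.node ((sh'.node v).child d)).lastTs) ∨
      ((sh.node ((sh.node v).child d)).body.IsInner ∧ Needs K D (sh.node ((sh.node v).child d)) ∧
        (sh.node ((sh.node v).child d)).UpTo H (D.ts - 1)))
  -- A node finishes `t` only after the children that `t` concerns have received it.
  pop : ∀ v < sh.next, ∀ t, (sh.node v).done < t → t ≤ (sh'.node v).done → ∀ d,
    (sh'.node v).child d = (sh.node v).child d ∧
    ((sh.node v).Task (H t) d → (sh.node ((sh.node v).child d)).Recv (descOf H t))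
  cas : ∀ c < sh.next, (sh'.node c).st ≠ (sh.node c).st → c ≠ root ∧
    ∃ D, Active H G sh D (G c).par ∧ (sh.node (G c).par).child (G c).dir = c ∧
      ¬ Needs K D (sh.node c) ∧ (sh'.node c).st.tsMod = D.ts
  push : ∀ c < sh.next, (sh'.node c).lastTs ≠ (sh.node c).lastTs → c ≠ root →
    (sh.node c).body.IsInner ∧
    ∃ D, Active H G sh D (G c).par ∧ (sh.node (G c).par).child (G c).dir = c ∧
      D.ts ≤ (sh.node c).st.tsMod
  -- An empty queue is refilled only by a push, which moves its tail; this keeps drained subtrees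
  -- drained.
  queue : ∀ v < sh.next, (sh'.node v).lastTs = (sh.node v).lastTs → (sh.node v).queue = [] →
    (sh'.node v).queue = []
  new : ∀ v, sh.next ≤ v → v < sh'.next → (sh'.node v).lastTs = (G v).birth

end Predicates

/-! ### Active operations, and changes of a single node -/

section Basic

variable {α : Type u} [LinearOrder α] {K : ℝ} {H : ℕ → Op α} {G : ℕ → Ghost} {sh sh' : Shared α}

theorem NodeOK.inner_of_queue {v : ℕ} {nd : ℕ → Node α} {next : ℕ} (h : NodeOK K H G nd next v)
    (hq : (nd v).queue ≠ []) : (nd v).body.IsInner := by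
  by_contra hb
  exact hq (h.leaf hb).1

theorem MemOK.active_of_head (h : MemOK K H G sh) {D : Desc α} {v : ℕ} {q : List (Desc α)}
    (hq : (sh.node v).queue = D :: q) : Active H G sh D v := by
  have hv : v < sh.next := by
    by_contra hv
    rw [h.queue_nil v (by omega)] at hq
    cases hq
  have hn := h.node v hv
  obtain ⟨h1, h2, h3, h4⟩ := hn.mem D (by simp [hq])
  have := Node.done_of_cons hq
  exact { desc := h1, visits := h2, lt := hv, inner := hn.inner_of_queue (by simp [hq]),
          birth_lt := h3, le_lastTs := h4, le_done := by omega, done_lt := by omega }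

/-- Completeness puts `D` into the queue. The head has timestamp `done + 1`, which is also that of
`D`, and the queue is strictly sorted. -/
theorem MemOK.head_of_active (h : MemOK K H G sh) {D : Desc α} {v : ℕ} (hD : Active H G sh D v) :
    ∃ q, (sh.node v).queue = D :: q := by
  have hn := h.node v hD.lt
  have hmem := hn.complete D.ts hD.done_lt hD.le_lastTs hD.visits
  rw [← hD.desc] at hmem
  cases hq : (sh.node v).queue with
  | nil => simp [hq] at hmem
  | cons E q =>
    have hE := hn.mem E (by simp [hq])
    have hs := hn.sorted
    rw [hq] at hmem hs
    have h1 := hD.done_lt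
    have h2 := hD.le_done
    rw [Node.done_of_cons hq] at h1 h2
    rcases List.mem_cons.1 hmem with h3 | h3
    · exact ⟨q, by rw [h3]⟩
    · have := (List.pairwise_cons.1 hs).1 D h3
      omega

/-- The basis of all stability proofs: whoever changes something below `v` does it for the same
operation as every other effective helper there. -/
theorem MemOK.active_unique (h : MemOK K H G sh) {D E : Desc α} {v : ℕ} (hD : Active H G sh D v)
    (hE : Active H G sh E v) : D = E := by
  obtain ⟨q, hq⟩ := h.head_of_active hD
  obtain ⟨q', hq'⟩ := h.head_of_active hE
  rw [hq] at hq'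
  exact (List.cons.inj hq').1

/-- An operation that was started and is not older than the active one. -/
theorem Started.le_of_active {D E : Desc α} {v : ℕ} (hD : Started H G sh D v)
    (hE : Active H G sh E v) : D.ts ≤ E.ts := by
  have := hE.done_lt
  have := hD.le_done
  omega

theorem MemOK.queue_ne_of_active (h : MemOK K H G sh) {D : Desc α} {v : ℕ}
    (hD : Active H G sh D v) : (sh.node v).queue ≠ [] := by
  obtain ⟨q, hq⟩ := h.head_of_active hD
  simp [hq]

theorem MemOK.root_inner (h : MemOK K H G sh) : (sh.node root).body.IsInner := by
  rw [h.root_body]; trivial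

theorem MemOK.par_ne (h : MemOK K H G sh) {v : ℕ} (hv : v < sh.next) (hr : v ≠ root) :
    (G v).par ≠ v := by
  intro he
  have := ((h.node v hv).nonroot hr).depth_eq
  rw [he] at this
  omega

/-- Hence the edge invariant, which excludes the right register of the fictive root, is available
for every task. -/
theorem MemOK.task_left (h : MemOK K H G sh) {v : ℕ} {op : Op α} {d : Dir}
    (ht : (sh.node v).Task op d) : v = root → d = .left := by
  rintro rfl
  cases d with
  | left => rfl
  | right =>
    unfold Node.Task Node.childRange at ht
    rw [h.root_body, h.root_hi] at ht
    exact absurd ht (not_visits_empty op)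

theorem MemOK.range_of_par (h : MemOK K H G sh) {v : ℕ} (hv : v < sh.next) (hr : v ≠ root) :
    (sh.node (G v).par).lo ≤ (sh.node v).lo ∧ (sh.node v).hi ≤ (sh.node (G v).par).hi := by
  have hn := (h.node v hv).nonroot hr
  have := (h.node _ hn.par_lt).range hn.par_inner (G v).dir
  rw [hn.lo_eq, hn.hi_eq]
  exact this

theorem MemOK.task_iff (h : MemOK K H G sh) {v : ℕ} (hv : v < sh.next) (hr : v ≠ root)
    (op : Op α) : (sh.node (G v).par).Task op (G v).dir ↔
      op.Visits (sh.node v).lo (sh.node v).hi := by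
  have hn := (h.node v hv).nonroot hr
  rw [hn.lo_eq, hn.hi_eq]
  rfl

/-- Changing one node. -/
theorem MemOK.update (h : MemOK K H G sh) {v : ℕ} {n' : Node α} (hv : v < sh.next)
    (hnode : sh'.node = Function.update sh.node v n') (hnext : sh'.next = sh.next)
    (hbody : n'.body = (sh.node v).body) (hlo : n'.lo = (sh.node v).lo)
    (hhi : n'.hi = (sh.node v).hi)
    (hlast : (sh.node v).lastTs ≤ n'.lastTs) (hdone : (sh.node v).done ≤ n'.done)
    (hN : NodeOK K H G sh'.node sh'.next v)
    (hE : (sh.node v).body.IsInner → ∀ d, (v = root → d = .left) →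
      EdgeOK H G sh'.node sh'.next v d)
    (hlate : ∀ x < sh.next, x ≠ root → (G x).par = v → (sh.node v).child (G x).dir = x →
      n'.child (G x).dir ≠ x → (sh.node x).lastTs ≤ n'.done)
    (hkeys : sh'.keys = contents H (sh'.node root).lastTs)
    (hvisits : sh'.visits + visitCount H (sh.node v) (G v).birth =
      sh.visits + visitCount H n' (G v).birth) : MemOK K H G sh' := by
  have hself : sh'.node v = n' := by rw [hnode, Function.update_self]
  have hne : ∀ x, x ≠ v → sh'.node x = sh.node x := fun x hx => by
    rw [hnode, Function.update_of_ne hx]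
  have hb : ∀ x, (sh'.node x).body = (sh.node x).body := fun x => by
    rcases eq_or_ne x v with rfl | hx
    · rw [hself, hbody]
    · rw [hne x hx]
  have hl : ∀ x, (sh'.node x).lo = (sh.node x).lo := fun x => by
    rcases eq_or_ne x v with rfl | hx
    · rw [hself, hlo]
    · rw [hne x hx]
  have hh : ∀ x, (sh'.node x).hi = (sh.node x).hi := fun x => by
    rcases eq_or_ne x v with rfl | hx
    · rw [hself, hhi]
    · rw [hne x hx]
  have hcr : ∀ x, (sh'.node x).childRange = (sh.node x).childRange := fun x =>
    childRange_congr (hb x) (hl x) (hh x)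
  have hlt : ∀ x, (sh.node x).lastTs ≤ (sh'.node x).lastTs := fun x => by
    rcases eq_or_ne x v with rfl | hx
    · rw [hself]; exact hlast
    · rw [hne x hx]
  have hdn : ∀ x, (sh.node x).done ≤ (sh'.node x).done := fun x => by
    rcases eq_or_ne x v with rfl | hx
    · rw [hself]; exact hdone
    · rw [hne x hx]
  refine { root_lt := by rw [hnext]; exact h.root_lt, root_body := by rw [hb]; exact h.root_body,
           root_lo := by rw [hl]; exact h.root_lo, root_hi := by rw [hh]; exact h.root_hi,
           root_birth := h.root_birth, root_depth := h.root_depth,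
           node := ?_, edge := ?_, queue_nil := ?_, keys := hkeys, visits := ?_ }
  · intro x hx
    rw [hnext] at hx
    rcases eq_or_ne x v with rfl | hxv
    · exact hN
    have hn := h.node x hx
    have hx' := hne x hxv
    refine { leaf := ?_, birth_le := ?_, lastTs_le := ?_, range := ?_, sorted := ?_, mem := ?_,
             complete := ?_, nonroot := ?_ }
    · rw [hx']; exact hn.leaf
    · rw [hx']; exact hn.birth_le
    · rw [hx']; exact hn.lastTs_le.trans (hlt _)
    · rw [hx']; exact hn.range
    · rw [hx']; exact hn.sorted
    · rw [hx']; exact hn.mem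
    · rw [hx']; exact hn.complete
    · intro hr
      have hm := hn.nonroot hr
      refine { par_lt := ?_, par_inner := ?_, par_root := hm.par_root, lo_eq := ?_, hi_eq := ?_,
               depth_eq := hm.depth_eq, birth_par := hm.birth_par, tsMod_le := ?_,
               lastTs_le_tsMod := ?_, inner := ?_, late := ?_ }
      · rw [hnext]; exact hm.par_lt
      · rw [hb]; exact hm.par_inner
      · rw [hl, hcr]; exact hm.lo_eq
      · rw [hh, hcr]; exact hm.hi_eq
      · rw [hx']; exact hm.tsMod_le.trans (hlt _)
      · rw [hx']; exact hm.lastTs_le_tsMod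
      · rw [hx']; exact hm.inner
      · intro h1 h2
        rw [hx'] at h2 ⊢
        rcases eq_or_ne ((sh.node (G x).par).child (G x).dir) x with h3 | h3
        · rcases eq_or_ne (G x).par v with h4 | h4
          · rw [h4, hself] at h1 ⊢
            rw [h4] at h3
            exact hlate x hx hr h4 h3 h1
          · rw [hne _ h4] at h1
            exact absurd h3 h1
        · exact (hm.late h3 h2).trans (hdn _)
  · intro x hx hi d hd
    rw [hnext] at hx
    rw [hb] at hi
    rcases eq_or_ne x v with rfl | hxv
    · exact hE hi d hd
    have he := h.edge x hx hi d hd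
    have hx' := hne x hxv
    refine { lt := ?_, ne_root := ?_, par_eq := ?_, dir_eq := ?_, upTo := ?_ }
    · rw [hx', hnext]; exact he.lt
    · rw [hx']; exact he.ne_root
    · rw [hx']; exact he.par_eq
    · rw [hx']; exact he.dir_eq
    · rw [hx']
      intro t h1 h2 h3
      rw [hl, hh] at h3
      rw [hb]
      exact he.upTo t ((hlt _).trans_lt h1) h2 h3
  · intro x hx
    rw [hnext] at hx
    rw [hne x (by omega)]
    exact h.queue_nil x hx
  · have hmem : v ∈ Finset.range sh.next := Finset.mem_range.2 hv
    rw [hnext, ← Finset.add_sum_erase _ _ hmem, hself]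
    have hs := h.visits
    rw [← Finset.add_sum_erase _ _ hmem] at hs
    rw [Finset.sum_congr rfl fun x hx => by rw [hne x (Finset.ne_of_mem_erase hx)]]
    omega

end Basic

/-! ### Steps that change the memory preserve the invariants and satisfy the rely relation -/

section Basic

variable {α : Type u}

theorem Node.child_setChild_self (n : Node α) (d : Dir) (c : ℕ) : (n.setChild d c).child d = c := by
  cases d <;> rfl

theorem Node.child_setChild_of_ne (n : Node α) {d e : Dir} (h : e ≠ d) (c : ℕ) :
    (n.setChild d c).child e = n.child e := by
  cases d <;> cases e <;> first | rfl | exact absurd rfl h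

@[simp] theorem Node.setChild_body (n : Node α) (d : Dir) (c : ℕ) :
    (n.setChild d c).body = n.body := by
  cases d <;> rfl

@[simp] theorem Node.setChild_lo (n : Node α) (d : Dir) (c : ℕ) :
    (n.setChild d c).lo = n.lo := by
  cases d <;> rfl

@[simp] theorem Node.setChild_hi (n : Node α) (d : Dir) (c : ℕ) :
    (n.setChild d c).hi = n.hi := by
  cases d <;> rfl

@[simp] theorem Node.setChild_st (n : Node α) (d : Dir) (c : ℕ) :
    (n.setChild d c).st = n.st := by
  cases d <;> rfl

@[simp] theorem Node.setChild_queue (n : Node α) (d : Dir) (c : ℕ) :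
    (n.setChild d c).queue = n.queue := by
  cases d <;> rfl

@[simp] theorem Node.setChild_lastTs (n : Node α) (d : Dir) (c : ℕ) :
    (n.setChild d c).lastTs = n.lastTs := by
  cases d <;> rfl

@[simp] theorem Node.setChild_done (n : Node α) (d : Dir) (c : ℕ) :
    (n.setChild d c).done = n.done := by
  cases d <;> rfl

variable [LinearOrder α] {K : ℝ} {H : ℕ → Op α} {G : ℕ → Ghost} {sh sh' : Shared α}

theorem Rely.of_new (hnext : sh.next ≤ sh'.next) (h : ∀ v < sh.next, sh'.node v = sh.node v)
    (hnew : ∀ v, sh.next ≤ v → v < sh'.next → (sh'.node v).lastTs = (G v).birth) :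
    Rely K H G sh sh' where
  next_le := hnext
  body v hv := by rw [h v hv]
  lo v hv := by rw [h v hv]
  hi v hv := by rw [h v hv]
  done_le v hv := by rw [h v hv]
  lastTs_le v hv := by rw [h v hv]
  child_le v hv d := by rw [h v hv]
  swing v hv d hd := absurd (by rw [h v hv]) hd
  pop v hv t h1 h2 := by rw [h v hv] at h2; omega
  cas v hv hd := absurd (by rw [h v hv]) hd
  push v hv hd := absurd (by rw [h v hv]) hd
  queue v hv _ hq := by rw [h v hv]; exact hq
  new := hnew

theorem Rely.of_eq (hnext : sh'.next = sh.next) (h : ∀ v < sh.next, sh'.node v = sh.node v) :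
    Rely K H G sh sh' :=
  .of_new hnext.ge h fun v h1 h2 => absurd h1 (by omega)

theorem Rely.update {v : ℕ} {n' : Node α}
    (hnode : sh'.node = Function.update sh.node v n') (hnext : sh'.next = sh.next)
    (hbody : n'.body = (sh.node v).body) (hlo : n'.lo = (sh.node v).lo)
    (hhi : n'.hi = (sh.node v).hi)
    (hlast : (sh.node v).lastTs ≤ n'.lastTs) (hdone : (sh.node v).done ≤ n'.done)
    (hchild : ∀ d, (sh.node v).child d ≤ n'.child d)
    (hswing : ∀ d, n'.child d ≠ (sh.node v).child d →
      ∃ D, Active H G sh D v ∧ n'.done = (sh.node v).done ∧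
      ((¬ (sh.node ((sh.node v).child d)).body.IsInner ∧ D.eff = true ∧
        (sh.node ((sh.node v).child d)).lastTs < D.ts ∧
        D.ts ≤ (sh'.node (n'.child d)).lastTs) ∨
      ((sh.node ((sh.node v).child d)).body.IsInner ∧ Needs K D (sh.node ((sh.node v).child d)) ∧
        (sh.node ((sh.node v).child d)).UpTo H (D.ts - 1))))
    (hpop : ∀ t, (sh.node v).done < t → t ≤ n'.done → ∀ d,
      n'.child d = (sh.node v).child d ∧
      ((sh.node v).Task (H t) d → (sh.node ((sh.node v).child d)).Recv (descOf H t)))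
    (hcas : n'.st ≠ (sh.node v).st → v ≠ root ∧
      ∃ D, Active H G sh D (G v).par ∧ (sh.node (G v).par).child (G v).dir = v ∧
      ¬ Needs K D (sh.node v) ∧ n'.st.tsMod = D.ts)
    (hpush : n'.lastTs ≠ (sh.node v).lastTs → v ≠ root →
      (sh.node v).body.IsInner ∧
      ∃ D, Active H G sh D (G v).par ∧ (sh.node (G v).par).child (G v).dir = v ∧
      D.ts ≤ (sh.node v).st.tsMod)
    (hqueue : n'.lastTs = (sh.node v).lastTs → (sh.node v).queue = [] → n'.queue = []) :
    Rely K H G sh sh' := by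
  have hself : sh'.node v = n' := by rw [hnode, Function.update_self]
  have hne : ∀ x, x ≠ v → sh'.node x = sh.node x := fun x hx => by
    rw [hnode, Function.update_of_ne hx]
  refine { next_le := hnext.ge, body := ?_, lo := ?_, hi := ?_, done_le := ?_, lastTs_le := ?_,
           child_le := ?_, swing := ?_, pop := ?_, cas := ?_, push := ?_, queue := ?_,
           new := fun x h1 h2 => absurd h1 (by omega) }
  all_goals
    intro x hx
    rcases eq_or_ne x v with rfl | hxv
  · rw [hself, hbody]
  · rw [hne x hxv]
  · rw [hself, hlo]
  · rw [hne x hxv]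
  · rw [hself, hhi]
  · rw [hne x hxv]
  · rw [hself]; exact hdone
  · rw [hne x hxv]
  · rw [hself]; exact hlast
  · rw [hne x hxv]
  · rw [hself]; exact hchild
  · rw [hne x hxv]; exact fun _ => le_rfl
  · rw [hself]; exact hswing
  · rw [hne x hxv]; exact fun d hd => absurd rfl hd
  · rw [hself]; exact hpop
  · rw [hne x hxv]; intro t h1 h2; omega
  · rw [hself]; exact hcas
  · rw [hne x hxv]; exact fun hd => absurd rfl hd
  · rw [hself]; exact hpush
  · rw [hne x hxv]; exact fun hd => absurd rfl hd
  · rw [hself]; exact hqueue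
  · rw [hne x hxv]; exact fun _ h => h

/-- The child registers of an inner node do not point to the node itself. -/
theorem MemOK.child_ne (h : MemOK K H G sh) {v : ℕ} {d : Dir}
    (he : EdgeOK H G sh.node sh.next v d) : (sh.node v).child d ≠ v := by
  intro hx
  have h1 := h.par_ne he.lt he.ne_root
  rw [he.par_eq] at h1
  exact h1 hx.symm

/-- Inserting a descriptor into a queue. -/
theorem MemOK.insert (h : MemOK K H G sh) {v : ℕ} {D : Desc α} (hv : v < sh.next)
    (hi : (sh.node v).body.IsInner)
    (hnode : sh'.node = Function.update sh.node v
      { sh.node v with queue := (sh.node v).queue ++ [D], lastTs := D.ts })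
    (hnext : sh'.next = sh.next) (hvisits : sh'.visits = sh.visits + 1)
    (hdesc : D = descOf H D.ts) (hlt : (sh.node v).lastTs < D.ts)
    (hvis : (H D.ts).Visits (sh.node v).lo (sh.node v).hi)
    (hno : ∀ t, (sh.node v).lastTs < t → t < D.ts →
      ¬ (H t).Visits (sh.node v).lo (sh.node v).hi)
    (hpar : v ≠ root → D.ts ≤ (sh.node v).st.tsMod ∧ Active H G sh D (G v).par ∧
      (sh.node (G v).par).child (G v).dir = v)
    (hkeys : sh'.keys = contents H (sh'.node root).lastTs) :
    MemOK K H G sh' ∧ Rely K H G sh sh' := by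
  have hself : sh'.node v = { sh.node v with queue := (sh.node v).queue ++ [D], lastTs := D.ts } := by
    rw [hnode, Function.update_self]
  have hne : ∀ x, x ≠ v → sh'.node x = sh.node x := fun x hx => by
    rw [hnode, Function.update_of_ne hx]
  have hn := h.node v hv
  have hdone : ({ sh.node v with queue := (sh.node v).queue ++ [D], lastTs := D.ts } : Node α).done =
      if (sh.node v).queue = [] then D.ts - 1 else (sh.node v).done := by
    unfold Node.done
    cases (sh.node v).queue <;> simp
  have hdone_le : (sh.node v).done ≤
      ({ sh.node v with queue := (sh.node v).queue ++ [D], lastTs := D.ts } : Node α).done := by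
    rw [hdone]
    split_ifs with hq
    · rw [Node.done_of_nil hq]; omega
    · exact le_rfl
  -- Insertion into an empty queue moves `done` up to `D.ts - 1`; by `hno` the timestamps passed
  -- over do not concern the node.
  have hnovis : ∀ t, (sh.node v).done < t →
      t ≤ ({ sh.node v with queue := (sh.node v).queue ++ [D], lastTs := D.ts } : Node α).done →
      ¬ (H t).Visits (sh.node v).lo (sh.node v).hi := by
    intro t h1 h2
    rw [hdone] at h2
    split_ifs at h2 with hq
    · rw [Node.done_of_nil hq] at h1
      exact hno t h1 (by omega)
    · omega
  have hroot : D.ts ≤ (sh'.node root).lastTs := by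
    rcases eq_or_ne v root with rfl | hr
    · rw [hself]
    · rw [hne root hr.symm]
      obtain ⟨-, hA, -⟩ := hpar hr
      exact hA.le_lastTs.trans (h.node _ hA.lt).lastTs_le
  have htask : ∀ d t, (sh.node v).Task (H t) d →
      (H t).Visits (sh.node v).lo (sh.node v).hi := fun d t ht =>
    Op.Visits.mono ht (hn.range hi d).1 (hn.range hi d).2
  constructor
  · refine h.update hv hnode hnext rfl rfl rfl hlt.le hdone_le ?_ ?_ ?_ hkeys ?_
    · refine { leaf := ?_, birth_le := ?_, lastTs_le := ?_, range := ?_, sorted := ?_, mem := ?_,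
               complete := ?_, nonroot := ?_ }
      · rw [hself]; exact fun hb => absurd hi hb
      · rw [hself]; exact hn.birth_le.trans hlt.le
      · rw [hself]; exact hroot
      · rw [hself]; exact hn.range
      · rw [hself]
        refine List.pairwise_append.2 ⟨hn.sorted, List.pairwise_singleton _ _, ?_⟩
        intro E hE F hF
        rw [List.mem_singleton] at hF
        rw [hF]
        exact (hn.mem E hE).2.2.2.trans_lt hlt
      · rw [hself]
        intro E hE
        rcases List.mem_append.1 hE with hE | hE
        · obtain ⟨h1, h2, h3, h4⟩ := hn.mem E hE
          exact ⟨h1, h2, h3, h4.trans hlt.le⟩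
        · rw [List.mem_singleton] at hE
          rw [hE]
          exact ⟨hdesc, hvis, hn.birth_le.trans_lt hlt, le_rfl⟩
      · rw [hself]
        intro t h1 h2 h3
        rw [hdone] at h1
        simp only [List.mem_append, List.mem_singleton]
        change t ≤ D.ts at h2
        rcases lt_or_ge (sh.node v).lastTs t with h4 | h4
        · right
          rcases h2.lt_or_eq with h5 | h5
          · exact absurd h3 (hno t h4 h5)
          · rw [h5, ← hdesc]
        · left
          split_ifs at h1 with hq
          · omega
          · exact hn.complete t h1 h4 h3
      · intro hr
        have hm := hn.nonroot hr
        obtain ⟨h1, hA, h3⟩ := hpar hr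
        have hp := hne _ (h.par_ne hv hr)
        refine { par_lt := ?_, par_inner := ?_, par_root := hm.par_root, lo_eq := ?_, hi_eq := ?_,
                 depth_eq := hm.depth_eq, birth_par := hm.birth_par, tsMod_le := ?_,
                 lastTs_le_tsMod := ?_, inner := ?_, late := ?_ }
        · rw [hnext]; exact hm.par_lt
        · rw [hp]; exact hm.par_inner
        · rw [hself, hp]; exact hm.lo_eq
        · rw [hself, hp]; exact hm.hi_eq
        · rw [hself, hp]; exact hm.tsMod_le
        · rw [hself]; exact h1
        · rw [hself]
          intro hb
          have := hm.inner hb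
          exact ⟨this.size, this.mod, this.init, this.bound, this.half⟩
        · rw [hp]; exact fun hx => absurd h3 hx
    · intro _ d hd
      have he := h.edge v hv hi d hd
      have hx := h.child_ne he
      refine { lt := ?_, ne_root := ?_, par_eq := ?_, dir_eq := ?_, upTo := ?_ } <;> rw [hself]
      · rw [hnext]; exact he.lt
      · exact he.ne_root
      · exact he.par_eq
      · exact he.dir_eq
      · intro t h1 h2 h3
        change (sh'.node ((sh.node v).child d)).lastTs < t at h1
        change (H t).Visits (sh'.node ((sh.node v).child d)).lo
          (sh'.node ((sh.node v).child d)).hi at h3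
        change ¬ (sh'.node ((sh.node v).child d)).body.IsInner ∧ _
        rw [hne _ hx] at h1 h3 ⊢
        rcases le_or_gt t (sh.node v).done with h4 | h4
        · exact he.upTo t h1 h4 h3
        · refine absurd (htask d t ?_) (hnovis t h4 h2)
          have := (h.task_iff he.lt he.ne_root (H t)).2 h3
          rwa [he.par_eq, he.dir_eq] at this
    · intro x _ _ _ h4 h5
      exact absurd h4 h5
    · classical
      -- Among the new timestamps in the interval only `D.ts` concerns the range, so the count grows
      -- by one like the counter `visits`.
      have : visitCount H { sh.node v with queue := (sh.node v).queue ++ [D], lastTs := D.ts }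
          (G v).birth = visitCount H (sh.node v) (G v).birth + 1 := by
        unfold visitCount
        rw [← Finset.card_insert_of_notMem (a := D.ts)]
        · congr 1
          ext t
          simp only [Finset.mem_filter, Finset.mem_Ioc, Finset.mem_insert]
          constructor
          · rintro ⟨⟨h1, h2⟩, h3⟩
            rcases lt_or_ge (sh.node v).lastTs t with h4 | h4
            · left
              rcases h2.lt_or_eq with h5 | h5
              · exact absurd h3 (hno t h4 h5)
              · exact h5
            · exact Or.inr ⟨⟨h1, h4⟩, h3⟩
          · rintro (rfl | ⟨⟨h1, h2⟩, h3⟩)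
            · exact ⟨⟨hn.birth_le.trans_lt hlt, le_rfl⟩, hvis⟩
            · exact ⟨⟨h1, h2.trans hlt.le⟩, h3⟩
        · simp only [Finset.mem_filter, Finset.mem_Ioc]
          rintro ⟨⟨-, h2⟩, -⟩
          omega
      omega
  · refine Rely.update hnode hnext rfl rfl rfl hlt.le hdone_le (fun d => le_rfl)
      (fun d hd => absurd rfl hd) ?_ (fun hs => absurd rfl hs) ?_ ?_
    · intro t h1 h2 d
      exact ⟨rfl, fun ht => absurd (htask d t ht) (hnovis t h1 h2)⟩
    · intro _ hr
      obtain ⟨h1, hA, h3⟩ := hpar hr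
      exact ⟨hi, D, hA, h3, h1⟩
    · intro h1
      exact absurd h1 hlt.ne'

/-- Removing the head of a queue, after it has been handed on to the children. -/
theorem MemOK.remove (h : MemOK K H G sh) {v : ℕ} {D : Desc α} {q : List (Desc α)}
    (hq : (sh.node v).queue = D :: q)
    (hnode : sh'.node = Function.update sh.node v { sh.node v with queue := q })
    (hnext : sh'.next = sh.next) (hvisits : sh'.visits = sh.visits) (hkeys : sh'.keys = sh.keys)
    (hrecv : ∀ d, (sh.node v).Task D.op d → (sh.node ((sh.node v).child d)).Recv D) :
    MemOK K H G sh' ∧ Rely K H G sh sh' := by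
  have hA := h.active_of_head hq
  have hv := hA.lt
  have hi := hA.inner
  have hself : sh'.node v = { sh.node v with queue := q } := by
    rw [hnode, Function.update_self]
  have hne : ∀ x, x ≠ v → sh'.node x = sh.node x := fun x hx => by
    rw [hnode, Function.update_of_ne hx]
  have hn := h.node v hv
  have hdone := Node.done_of_cons hq
  have hs := hn.sorted
  rw [hq, List.pairwise_cons] at hs
  have hpos : 1 ≤ D.ts := by have := hA.birth_lt; omega
  have hdone' : D.ts ≤ ({ sh.node v with queue := q } : Node α).done := by
    cases q with
    | nil => exact hA.le_lastTs
    | cons E q =>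
      have := hs.1 E (by simp)
      change D.ts ≤ E.ts - 1
      omega
  have hdone_le : (sh.node v).done ≤ ({ sh.node v with queue := q } : Node α).done := by omega
  -- Popping `D` moves `done` to just before the next entry, or to the tail; completeness and
  -- sortedness leave no operation of the range in between.
  have hnovis : ∀ t, D.ts < t → t ≤ ({ sh.node v with queue := q } : Node α).done →
      ¬ (H t).Visits (sh.node v).lo (sh.node v).hi := by
    intro t h1 h2 h3
    have hle : t ≤ (sh.node v).lastTs := by
      cases q with
      | nil => exact h2
      | cons E q =>
        have := (hn.mem E (by simp [hq])).2.2.2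
        change t ≤ E.ts - 1 at h2
        omega
    have hmem := hn.complete t (by omega) hle h3
    rw [hq, List.mem_cons] at hmem
    rcases hmem with hmem | hmem
    · rw [← hmem, descOf_ts] at h1; omega
    · cases q with
      | nil => simp at hmem
      | cons E q =>
        change t ≤ E.ts - 1 at h2
        have h4 := hs.1 E (by simp)
        rcases List.mem_cons.1 hmem with h5 | h5
        · rw [← h5, descOf_ts] at h2; omega
        · have := (List.pairwise_cons.1 hs.2).1 _ h5
          rw [descOf_ts] at this; omega
  have htask : ∀ d t, (sh.node v).Task (H t) d →
      (H t).Visits (sh.node v).lo (sh.node v).hi := fun d t ht =>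
    Op.Visits.mono ht (hn.range hi d).1 (hn.range hi d).2
  have hop : D.op = H D.ts := by rw [hA.desc]; rfl
  constructor
  · refine h.update hv hnode hnext rfl rfl rfl le_rfl hdone_le ?_ ?_ ?_ ?_ ?_
    · refine { leaf := ?_, birth_le := ?_, lastTs_le := ?_, range := ?_, sorted := ?_, mem := ?_,
               complete := ?_, nonroot := ?_ }
      · rw [hself]; exact fun hb => absurd hi hb
      · rw [hself]; exact hn.birth_le
      · rcases eq_or_ne root v with hr | hr
        · rw [hr]
        · rw [hself, hne root hr]; exact hn.lastTs_le
      · rw [hself]; exact hn.range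
      · rw [hself]; exact hs.2
      · rw [hself]
        intro E hE
        exact hn.mem E (by rw [hq]; exact List.mem_cons_of_mem _ hE)
      · rw [hself]
        intro t h1 h2 h3
        have hmem := hn.complete t (by omega) h2 h3
        rw [hq, List.mem_cons] at hmem
        rcases hmem with hmem | hmem
        · rw [← hmem, descOf_ts] at hdone'; omega
        · exact hmem
      · intro hr
        have hm := hn.nonroot hr
        have hp := hne _ (h.par_ne hv hr)
        refine { par_lt := ?_, par_inner := ?_, par_root := hm.par_root, lo_eq := ?_, hi_eq := ?_,
                 depth_eq := hm.depth_eq, birth_par := hm.birth_par, tsMod_le := ?_,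
                 lastTs_le_tsMod := ?_, inner := ?_, late := ?_ }
        · rw [hnext]; exact hm.par_lt
        · rw [hp]; exact hm.par_inner
        · rw [hself, hp]; exact hm.lo_eq
        · rw [hself, hp]; exact hm.hi_eq
        · rw [hself, hp]; exact hm.tsMod_le
        · rw [hself]; exact hm.lastTs_le_tsMod
        · rw [hself]
          intro hb
          have := hm.inner hb
          exact ⟨this.size, this.mod, this.init, this.bound, this.half⟩
        · rw [hp, hself]; exact hm.late
    · intro _ d hd
      have he := h.edge v hv hi d hd
      have hx := h.child_ne he
      refine { lt := ?_, ne_root := ?_, par_eq := ?_, dir_eq := ?_, upTo := ?_ } <;> rw [hself]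
      · rw [hnext]; exact he.lt
      · exact he.ne_root
      · exact he.par_eq
      · exact he.dir_eq
      · intro t h1 h2 h3
        change (sh'.node ((sh.node v).child d)).lastTs < t at h1
        change (H t).Visits (sh'.node ((sh.node v).child d)).lo
          (sh'.node ((sh.node v).child d)).hi at h3
        change ¬ (sh'.node ((sh.node v).child d)).body.IsInner ∧ _
        rw [hne _ hx] at h1 h3 ⊢
        have h6 := (h.task_iff he.lt he.ne_root (H t)).2 h3
        rw [he.par_eq, he.dir_eq] at h6
        rcases le_or_gt t (sh.node v).done with h4 | h4
        · exact he.upTo t h1 h4 h3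
        · rcases eq_or_ne t D.ts with rfl | h5
          · rw [← hop] at h6
            rcases hrecv d h6 with h7 | h7
            · rw [← hA.desc]; exact h7
            · omega
          · exact absurd (htask d t h6) (hnovis t (by omega) h2)
    · intro x _ _ _ h4 h5
      exact absurd h4 h5
    · rw [hkeys, h.keys]
      rcases eq_or_ne root v with hr | hr
      · rw [hr, hself]
      · rw [hne root hr]
    · rw [hvisits]; rfl
  · refine Rely.update hnode hnext rfl rfl rfl le_rfl hdone_le (fun d => le_rfl)
      (fun d hd => absurd rfl hd) ?_ (fun hs => absurd rfl hs) (fun hs => absurd rfl hs) ?_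
    · intro t h1 h2 d
      refine ⟨rfl, fun ht => ?_⟩
      rcases eq_or_ne t D.ts with rfl | h5
      · rw [← hA.desc]
        rw [← hop] at ht
        exact hrecv d ht
      · exact absurd (htask d t ht) (hnovis t (by omega) h2)
    · intro _ h2
      rw [hq] at h2
      cases h2

/-- Replacing the state of a child by the state after the active operation. -/
theorem MemOK.casState (h : MemOK K H G sh) {c : ℕ} {D : Desc α} (hc : c < sh.next)
    (hr : c ≠ root) (hi : (sh.node c).body.IsInner)
    (hA : Active H G sh D (G c).par) (hchild : (sh.node (G c).par).child (G c).dir = c)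
    (hvis : (H D.ts).Visits (sh.node c).lo (sh.node c).hi)
    (hlt : (sh.node c).st.tsMod < D.ts) (hneeds : ¬ Needs K D (sh.node c))
    (hnode : sh'.node = Function.update sh.node c
      { sh.node c with st := D.newState (sh.node c).st })
    (hnext : sh'.next = sh.next) (hvisits : sh'.visits = sh.visits) (hkeys : sh'.keys = sh.keys) :
    MemOK K H G sh' ∧ Rely K H G sh sh' := by
  have hself : sh'.node c = { sh.node c with st := D.newState (sh.node c).st } := by
    rw [hnode, Function.update_self]
  have hne : ∀ x, x ≠ c → sh'.node x = sh.node x := fun x hx => by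
    rw [hnode, Function.update_of_ne hx]
  have hn := h.node c hc
  have hm := hn.nonroot hr
  have hp := hne _ (h.par_ne hc hr)
  have hin := hm.inner hi
  have he := h.edge _ hA.lt hA.inner _ hm.par_root
  constructor
  · refine h.update hc hnode hnext rfl rfl rfl le_rfl le_rfl ?_ ?_ ?_ ?_ ?_
    · refine { leaf := ?_, birth_le := ?_, lastTs_le := ?_, range := ?_, sorted := ?_, mem := ?_,
               complete := ?_, nonroot := ?_ }
      · rw [hself]; exact fun hb => absurd hi hb
      · rw [hself]; exact hn.birth_le
      · rw [hself, hne root hr.symm]; exact hn.lastTs_le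
      · rw [hself]; exact hn.range
      · rw [hself]; exact hn.sorted
      · rw [hself]; exact hn.mem
      · rw [hself]; exact hn.complete
      · intro _
        refine { par_lt := ?_, par_inner := ?_, par_root := hm.par_root, lo_eq := ?_, hi_eq := ?_,
                 depth_eq := hm.depth_eq, birth_par := hm.birth_par, tsMod_le := ?_,
                 lastTs_le_tsMod := ?_, inner := ?_, late := ?_ }
        · rw [hnext]; exact hm.par_lt
        · rw [hp]; exact hm.par_inner
        · rw [hself, hp]; exact hm.lo_eq
        · rw [hself, hp]; exact hm.hi_eq
        · rw [hself, hp]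
          simpa using hA.le_lastTs
        · rw [hself]
          simpa using hm.lastTs_le_tsMod.trans hlt.le
        · rw [hself]
          intro _
          -- The parent has finished everything before `D`. An earlier operation concerning the
          -- inner node `c` is therefore in its queue, and so not newer than the record.
          have hno : ∀ t', (sh.node c).st.tsMod < t' → t' < D.ts →
              ¬ Modifies H (sh.node c).lo (sh.node c).hi t' := by
            intro t h1 h2 h3
            have h4 := he.upTo t
            rw [hchild] at h4
            have := hA.le_done
            exact (h4 (hm.lastTs_le_tsMod.trans_lt h1) (by omega) h3.2).1 hi
          obtain ⟨h1, h2⟩ := newState_spec hlt (hn.birth_le.trans hm.lastTs_le_tsMod) hvis hno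
            hin.size hin.mod
          rw [← hA.desc] at h1 h2
          refine ⟨?_, ?_, hin.init, ?_, hin.half⟩
          · simpa using h1
          · simpa using h2
          · change (((D.newState (sh.node c).st).modCnt : ℕ) : ℝ) ≤
              max 1 (K * (sh.node c).body.initSz)
            -- With a positive count, the absence of `Needs` is the bound by `K * initSz`; from
            -- count zero the new count is at most `1`.
            by_cases h0 : 0 < (sh.node c).st.modCnt
            · refine le_max_of_le_right (not_lt.1 fun h3 => hneeds ⟨hlt, h0, h3⟩)
            · refine le_max_of_le_left ?_
              have := (newState_modCnt_le (D := D) (s := (sh.node c).st)).2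
              exact_mod_cast (by omega : (D.newState (sh.node c).st).modCnt ≤ 1)
        · rw [hp]; exact fun hx => absurd hchild hx
    · intro _ d hd
      have he := h.edge c hc hi d hd
      have hx := h.child_ne he
      refine { lt := ?_, ne_root := ?_, par_eq := ?_, dir_eq := ?_, upTo := ?_ } <;> rw [hself]
      · rw [hnext]; exact he.lt
      · exact he.ne_root
      · exact he.par_eq
      · exact he.dir_eq
      · have := he.upTo
        rw [← hne _ hx] at this
        exact this
    · intro x _ _ _ h4 h5
      exact absurd h4 h5
    · rw [hkeys, h.keys, hne root hr.symm]
    · rw [hvisits]; rfl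
  · refine Rely.update hnode hnext rfl rfl rfl le_rfl le_rfl (fun d => le_rfl)
      (fun d hd => absurd rfl hd) ?_ ?_ (fun hs => absurd rfl hs) (fun _ h => h)
    · intro t h1 h2
      exact absurd h2 (not_le.2 h1)
    · intro _
      exact ⟨hr, D, hA, hchild, hneeds, by simp⟩

/-- Swinging a child register to a new subtree. -/
theorem MemOK.swing (h : MemOK K H G sh) {v : ℕ} {d : Dir} {nv : ℕ} {D : Desc α}
    (hA : Active H G sh D v) (hd : v = root → d = .left)
    (hnv : nv < sh.next) (hnr : nv ≠ root) (hlt : (sh.node v).child d < nv)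
    (hpar : (G nv).par = v) (hdir : (G nv).dir = d) (hlast : D.ts - 1 ≤ (sh.node nv).lastTs)
    (hold : (¬ (sh.node ((sh.node v).child d)).body.IsInner ∧ D.eff = true ∧
        (sh.node ((sh.node v).child d)).lastTs < D.ts ∧ D.ts ≤ (sh.node nv).lastTs) ∨
      ((sh.node ((sh.node v).child d)).body.IsInner ∧ Needs K D (sh.node ((sh.node v).child d)) ∧
        (sh.node ((sh.node v).child d)).UpTo H (D.ts - 1)))
    (hnode : sh'.node = Function.update sh.node v ((sh.node v).setChild d nv))
    (hnext : sh'.next = sh.next) (hvisits : sh'.visits = sh.visits) (hkeys : sh'.keys = sh.keys) :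
    MemOK K H G sh' ∧ Rely K H G sh sh' := by
  have hv := hA.lt
  have hi := hA.inner
  have hself : sh'.node v = (sh.node v).setChild d nv := by
    rw [hnode, Function.update_self]
  have hne : ∀ x, x ≠ v → sh'.node x = sh.node x := fun x hx => by
    rw [hnode, Function.update_of_ne hx]
  have hn := h.node v hv
  have he := h.edge v hv hi d hd
  have hnvv : nv ≠ v := fun hx => by
    have := h.par_ne hnv hnr
    rw [hpar] at this
    exact this hx.symm
  have hdone : (sh.node v).done = D.ts - 1 := by
    have := hA.done_lt
    have := hA.le_done
    omega
  have hcr : ((sh.node v).setChild d nv).childRange = (sh.node v).childRange :=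
    childRange_congr (by simp) (by simp) (by simp)
  -- The node that is replaced has not received `D`, so its tail is at most `D.ts - 1`, which is
  -- `done` of `v`. This yields `late` for it.
  have hclast : (sh.node ((sh.node v).child d)).lastTs < D.ts := by
    rcases hold with h1 | h1
    · exact h1.2.2.1
    · exact (((h.node _ he.lt).nonroot he.ne_root).lastTs_le_tsMod).trans_lt h1.2.1.1
  constructor
  · refine h.update hv hnode hnext (by simp) (by simp) (by simp) (by simp) (by simp) ?_ ?_ ?_ ?_ ?_
    · refine { leaf := ?_, birth_le := ?_, lastTs_le := ?_, range := ?_, sorted := ?_, mem := ?_,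
               complete := ?_, nonroot := ?_ }
      · rw [hself]; simp only [Node.setChild_body]; exact fun hb => absurd hi hb
      · rw [hself]; simpa using hn.birth_le
      · rcases eq_or_ne root v with hr | hr
        · rw [hr]
        · rw [hself, hne root hr]; simpa using hn.lastTs_le
      · rw [hself, hcr]; simpa using hn.range
      · rw [hself]; simpa using hn.sorted
      · rw [hself]; simpa using hn.mem
      · rw [hself]; simpa using hn.complete
      · intro hr
        have hm := hn.nonroot hr
        have hp := hne _ (h.par_ne hv hr)
        refine { par_lt := ?_, par_inner := ?_, par_root := hm.par_root, lo_eq := ?_, hi_eq := ?_,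
                 depth_eq := hm.depth_eq, birth_par := hm.birth_par, tsMod_le := ?_,
                 lastTs_le_tsMod := ?_, inner := ?_, late := ?_ }
        · rw [hnext]; exact hm.par_lt
        · rw [hp]; exact hm.par_inner
        · rw [hself, hp]; simpa using hm.lo_eq
        · rw [hself, hp]; simpa using hm.hi_eq
        · rw [hself, hp]; simpa using hm.tsMod_le
        · rw [hself]; simpa using hm.lastTs_le_tsMod
        · rw [hself]
          intro hb
          have := hm.inner hi
          refine ⟨?_, ?_, ?_, ?_, ?_⟩
          · simpa using this.size
          · simpa using this.mod
          · simpa using this.init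
          · simpa using this.bound
          · rw [hcr]; simpa using this.half
        · rw [hp, hself]; simpa using hm.late
    · intro _ e hde
      by_cases hed : e = d
      · subst hed
        refine { lt := ?_, ne_root := ?_, par_eq := ?_, dir_eq := ?_, upTo := ?_ } <;>
          rw [hself, Node.child_setChild_self]
        · rw [hnext]; exact hnv
        · exact hnr
        · exact hpar
        · exact hdir
        · rw [hne _ hnvv, Node.setChild_done, hdone]
          intro t h1 h2
          omega
      · have he := h.edge v hv hi e hde
        have hx := h.child_ne he
        refine { lt := ?_, ne_root := ?_, par_eq := ?_, dir_eq := ?_, upTo := ?_ } <;>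
          rw [hself, Node.child_setChild_of_ne _ hed]
        · rw [hnext]; exact he.lt
        · exact he.ne_root
        · exact he.par_eq
        · exact he.dir_eq
        · rw [hne _ hx, Node.setChild_done]
          exact he.upTo
    · intro x _ _ _ h4 h5
      by_cases hed : (G x).dir = d
      · rw [Node.setChild_done, hdone]
        rw [hed] at h4
        rw [h4] at hclast
        omega
      · rw [Node.child_setChild_of_ne _ hed] at h5
        exact absurd h4 h5
    · rw [hkeys, h.keys]
      rcases eq_or_ne root v with hr | hr
      · rw [hr, hself, Node.setChild_lastTs]
      · rw [hne root hr]
    · rw [hvisits]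
      congr 1
      cases d <;> rfl
  · refine Rely.update hnode hnext (by simp) (by simp) (by simp) (by simp) (by simp) ?_ ?_ ?_
      (fun hs => absurd (by simp) hs) (fun hs => absurd (by simp) hs) (fun _ h => by simpa using h)
    · intro e
      by_cases hed : e = d
      · subst hed
        rw [Node.child_setChild_self]
        exact hlt.le
      · rw [Node.child_setChild_of_ne _ hed]
    · intro e hce
      by_cases hed : e = d
      · subst hed
        rw [Node.child_setChild_self, hne _ hnvv]
        exact ⟨D, hA, by simp, hold⟩
      · rw [Node.child_setChild_of_ne _ hed] at hce
        exact absurd rfl hce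
    · intro t h1 h2
      rw [Node.setChild_done] at h2
      omega

end Basic

/-! ### Allocation of balanced subtrees -/

section Alloc

variable {α : Type u}

theorem Shape.nodeCount_pos (s : Shape α) : 1 ≤ s.nodeCount := by
  cases s <;> simp [Shape.nodeCount]

/-- The ghost attributes of a subtree of the given shape that occupies the addresses from `a` on,
below the register `d` of `p`. -/
def Shape.GhostAt (G : ℕ → Ghost) (ts : ℕ) : Shape α → ℕ → ℕ → Dir → ℕ → Prop
  | .inner _ l r, a, p, d, δ => G (a + l.nodeCount + r.nodeCount) = ⟨p, d, δ, ts⟩ ∧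
      l.GhostAt G ts a (a + l.nodeCount + r.nodeCount) .left (δ + 1) ∧
      r.GhostAt G ts (a + l.nodeCount) (a + l.nodeCount + r.nodeCount) .right (δ + 1)
  | _, a, p, d, δ => G a = ⟨p, d, δ, ts⟩

/-- The memory contains a new subtree of the given shape at the addresses from `a` on. -/
def Shape.NodesAt (nd : ℕ → Node α) (ts : ℕ) : Shape α → ℕ → Bound α → Bound α → Prop
  | .empty, a, lo, hi => nd a = ⟨.empty, lo, hi, 0, 0, ⟨0, 0, ts⟩, [], ts⟩
  | .leaf k, a, lo, hi => nd a = ⟨.leaf k, lo, hi, 0, 0, ⟨1, 0, ts⟩, [], ts⟩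
  | .inner k l r, a, lo, hi => nd (a + l.nodeCount + r.nodeCount) =
        ⟨.inner (bd k) (l.keyCount + r.keyCount), lo, hi, a + l.nodeCount - 1,
          a + l.nodeCount + r.nodeCount - 1, ⟨l.keyCount + r.keyCount, 0, ts⟩, [], ts⟩ ∧
      l.NodesAt nd ts a lo (bd k) ∧ r.NodesAt nd ts (a + l.nodeCount) (bd k) hi

theorem Shape.GhostAt.congr {G G' : ℕ → Ghost} {ts : ℕ} : ∀ {s : Shape α} {a p : ℕ} {d : Dir}
    {δ : ℕ}, s.GhostAt G ts a p d δ → (∀ x, a ≤ x → x < a + s.nodeCount → G' x = G x) →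
    s.GhostAt G' ts a p d δ
  | .empty, a, _, _, _, h, hx => (hx a le_rfl (by simp [nodeCount])).trans h
  | .leaf _, a, _, _, _, h, hx => (hx a le_rfl (by simp [nodeCount])).trans h
  | .inner _ l r, a, _, _, _, h, hx => by
    simp only [nodeCount] at hx
    exact ⟨(hx _ (by omega) (by omega)).trans h.1,
      h.2.1.congr fun x h1 h2 => hx x h1 (by omega),
      h.2.2.congr fun x h1 h2 => hx x (by omega) (by omega)⟩

theorem Shape.NodesAt.congr {nd nd' : ℕ → Node α} {ts : ℕ} : ∀ {s : Shape α} {a : ℕ}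
    {lo hi : Bound α}, s.NodesAt nd ts a lo hi →
    (∀ x, a ≤ x → x < a + s.nodeCount → nd' x = nd x) → s.NodesAt nd' ts a lo hi
  | .empty, a, _, _, h, hx => (hx a le_rfl (by simp [nodeCount])).trans h
  | .leaf _, a, _, _, h, hx => (hx a le_rfl (by simp [nodeCount])).trans h
  | .inner _ l r, a, _, _, h, hx => by
    simp only [nodeCount] at hx
    exact ⟨(hx _ (by omega) (by omega)).trans h.1,
      h.2.1.congr fun x h1 h2 => hx x h1 (by omega),
      h.2.2.congr fun x h1 h2 => hx x (by omega) (by omega)⟩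

/-- The addresses of a subtree are known before it is built, so its ghost attributes can be
prescribed in advance. -/
theorem Shape.exists_ghostAt (ts : ℕ) : ∀ (s : Shape α) (G : ℕ → Ghost) (a p : ℕ) (d : Dir)
    (δ : ℕ), ∃ G' : ℕ → Ghost, (∀ x, x < a ∨ a + s.nodeCount ≤ x → G' x = G x) ∧
      s.GhostAt G' ts a p d δ
  | .empty, G, a, p, d, δ => ⟨Function.update G a ⟨p, d, δ, ts⟩, fun x hx => by
      rw [Function.update_of_ne]
      simp only [nodeCount] at hx
      omega, by simp [GhostAt]⟩
  | .leaf _, G, a, p, d, δ => ⟨Function.update G a ⟨p, d, δ, ts⟩, fun x hx => by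
      rw [Function.update_of_ne]
      simp only [nodeCount] at hx
      omega, by simp [GhostAt]⟩
  | .inner k l r, G, a, p, d, δ => by
    obtain ⟨G1, h1, h2⟩ := exists_ghostAt ts l G a (a + l.nodeCount + r.nodeCount) .left (δ + 1)
    obtain ⟨G2, h3, h4⟩ := exists_ghostAt ts r G1 (a + l.nodeCount)
      (a + l.nodeCount + r.nodeCount) .right (δ + 1)
    refine ⟨Function.update G2 (a + l.nodeCount + r.nodeCount) ⟨p, d, δ, ts⟩, ?_, ?_, ?_, ?_⟩
    · intro x hx
      simp only [nodeCount] at hx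
      rw [Function.update_of_ne (by omega), h3 x (by omega), h1 x (by omega)]
    · simp
    · refine h2.congr fun x h5 h6 => ?_
      rw [Function.update_of_ne (by omega), h3 x (by omega)]
    · refine h4.congr fun x h5 h6 => ?_
      rw [Function.update_of_ne (by omega)]

theorem Shape.GhostAt.top {G : ℕ → Ghost} {ts : ℕ} {s : Shape α} {a p : ℕ} {d : Dir}
    {δ : ℕ} (h : s.GhostAt G ts a p d δ) : G (a + s.nodeCount - 1) = ⟨p, d, δ, ts⟩ := by
  cases s with
  | inner k l r =>
    have : a + (inner k l r).nodeCount - 1 = a + l.nodeCount + r.nodeCount := by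
      simp only [nodeCount]; omega
    rw [this, h.1]
  | _ => exact h

theorem Shape.NodesAt.top {nd : ℕ → Node α} {ts : ℕ} {s : Shape α} {a : ℕ}
    {lo hi : Bound α} (h : s.NodesAt nd ts a lo hi) : (nd (a + s.nodeCount - 1)).lastTs = ts ∧
      (nd (a + s.nodeCount - 1)).st.tsMod = ts := by
  cases s with
  | inner k l r =>
    have : a + (inner k l r).nodeCount - 1 = a + l.nodeCount + r.nodeCount := by
      simp only [nodeCount]; omega
    rw [this, h.1]
    exact ⟨rfl, rfl⟩
  | _ =>
    have h' : nd a = _ := h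
    simp [nodeCount, h']

/-- Allocation is in postorder: a subtree fills an interval of addresses starting at `sh.next`, its
root being the last. -/
theorem alloc_spec (ts : ℕ) : ∀ (s : Shape α) (lo hi : Bound α) (sh : Shared α),
    (Shared.alloc ts s lo hi sh).1.next = sh.next + s.nodeCount ∧
    (Shared.alloc ts s lo hi sh).2 = sh.next + s.nodeCount - 1 ∧
    (∀ x, x < sh.next ∨ sh.next + s.nodeCount ≤ x →
      (Shared.alloc ts s lo hi sh).1.node x = sh.node x) ∧
    (Shared.alloc ts s lo hi sh).1.prog = sh.prog ∧
    (Shared.alloc ts s lo hi sh).1.keys = sh.keys ∧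
    (Shared.alloc ts s lo hi sh).1.visits = sh.visits ∧
    s.NodesAt (Shared.alloc ts s lo hi sh).1.node ts sh.next lo hi
  | .empty, lo, hi, sh => by
    refine ⟨rfl, rfl, ?_, rfl, rfl, rfl, ?_⟩
    · intro x hx
      simp only [Shape.nodeCount] at hx
      simp only [Shared.alloc, Shared.new]
      rw [Function.update_of_ne (by omega)]
    · simp [Shape.NodesAt, Shared.alloc, Shared.new]
  | .leaf k, lo, hi, sh => by
    refine ⟨rfl, rfl, ?_, rfl, rfl, rfl, ?_⟩
    · intro x hx
      simp only [Shape.nodeCount] at hx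
      simp only [Shared.alloc, Shared.new]
      rw [Function.update_of_ne (by omega)]
    · simp [Shape.NodesAt, Shared.alloc, Shared.new]
  | .inner k l r, lo, hi, sh => by
    obtain ⟨l1, l2, l3, l4, l5, l6, l7⟩ := alloc_spec ts l lo (bd k) sh
    obtain ⟨r1, r2, r3, r4, r5, r6, r7⟩ :=
      alloc_spec ts r (bd k) hi (Shared.alloc ts l lo (bd k) sh).1
    have hl := l.nodeCount_pos
    have hr := r.nodeCount_pos
    simp only [Shared.alloc, Shared.new, Shape.nodeCount, Shape.NodesAt]
    rw [l1] at r1 r2 r3 r7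
    refine ⟨by omega, by omega, ?_, by rw [r4, l4], by rw [r5, l5], by rw [r6, l6], ?_, ?_, ?_⟩
    · intro x hx
      rw [Function.update_of_ne (by omega), r3 x (by omega), l3 x (by omega)]
    · rw [r1, Function.update_self, l2, r2]
    · refine l7.congr fun x h1 h2 => ?_
      rw [Function.update_of_ne (by omega), r3 x (by omega)]
    · refine r7.congr fun x h1 h2 => ?_
      rw [Function.update_of_ne (by omega)]

/-- A binary tree with `n ≥ 1` leaves has `2n - 1` nodes; the maximum covers the empty list, which
still needs one node. The bound `n` on the length serves only the induction. -/
theorem ideal_count (n : ℕ) : ∀ l : List α, l.length ≤ n →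
    (ideal l).keyCount = l.length ∧ (ideal l).nodeCount + 1 ≤ 2 * max 1 l.length := by
  induction n with
  | zero =>
    intro l hl
    have : l = [] := List.length_eq_zero_iff.1 (by omega)
    subst this
    simp [ideal, Shape.keyCount, Shape.nodeCount]
  | succ n ih =>
    intro l hl
    match l, hl with
    | [], _ => simp [ideal, Shape.keyCount, Shape.nodeCount]
    | [k], _ => simp [ideal, Shape.keyCount, Shape.nodeCount]
    | a :: b :: l, hl =>
      simp only [List.length_cons] at hl
      rw [ideal, Shape.keyCount, Shape.nodeCount]
      obtain ⟨h1, h2⟩ := ih ((a :: b :: l).take ((l.length + 2) / 2))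
        (by simp only [List.length_take, List.length_cons]; omega)
      obtain ⟨h3, h4⟩ := ih ((a :: b :: l).drop ((l.length + 2) / 2))
        (by simp only [List.length_drop, List.length_cons]; omega)
      simp only [List.length_take, List.length_drop, List.length_cons] at h1 h2 h3 h4 ⊢
      omega

variable [LinearOrder α]

/-- The shape is a balanced tree over the keys of `S` in `[lo, hi)`. -/
def Shape.Fits (S : Finset α) : Shape α → Bound α → Bound α → Prop
  | .empty, lo, hi => keysIn S lo hi = ∅
  | .leaf k, lo, hi => keysIn S lo hi = {k}
  | .inner k l r, lo, hi => lo ≤ bd k ∧ bd k ≤ hi ∧ 1 ≤ l.keyCount ∧ 1 ≤ r.keyCount ∧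
      2 * l.keyCount ≤ l.keyCount + r.keyCount + 1 ∧
      2 * r.keyCount ≤ l.keyCount + r.keyCount + 1 ∧
      l.Fits S lo (bd k) ∧ r.Fits S (bd k) hi

theorem Shape.Fits.card {S : Finset α} : ∀ {s : Shape α} {lo hi : Bound α}, s.Fits S lo hi →
    (keysIn S lo hi).card = s.keyCount
  | .empty, lo, hi, h => by
    have h' : keysIn S lo hi = ∅ := h
    simp [h', keyCount]
  | .leaf k, lo, hi, h => by
    have h' : keysIn S lo hi = {k} := h
    simp [h', keyCount]
  | .inner k l r, lo, hi, ⟨h1, h2, _, _, _, _, h3, h4⟩ => by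
    rw [← keysIn_split S h1 h2, h3.card, h4.card, keyCount]

/-- The router is the least key of the right half of a sorted list, so the halves of the list are
the keys below and not below it. Splitting in the middle gives balance up to rounding. -/
theorem ideal_fits (S : Finset α) (n : ℕ) : ∀ (l : List α) (lo hi : Bound α), l.length ≤ n →
    IsList l (keysIn S lo hi) → (ideal l).Fits S lo hi := by
  induction n with
  | zero =>
    intro l lo hi hl h
    have : l = [] := List.length_eq_zero_iff.1 (by omega)
    subst this
    rw [ideal]
    exact Finset.eq_empty_of_forall_notMem fun x hx => by simpa using (h.2 x).2 hx
  | succ n ih =>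
    intro l lo hi hl h
    match l, hl, h with
    | [], _, h =>
      rw [ideal]
      exact Finset.eq_empty_of_forall_notMem fun x hx => by simpa using (h.2 x).2 hx
    | [k], _, h =>
      rw [ideal]
      refine Finset.ext fun x => ?_
      rw [← h.2 x]
      simp
    | a :: b :: l, hl, h =>
      simp only [List.length_cons] at hl
      rw [ideal]
      have e1 := (ideal_count (n + 1) ((a :: b :: l).take ((l.length + 2) / 2))
        (by simp only [List.length_take, List.length_cons]; omega)).1
      have e2 := (ideal_count (n + 1) ((a :: b :: l).drop ((l.length + 2) / 2))
        (by simp only [List.length_drop, List.length_cons]; omega)).1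
      have hlen1 : ((a :: b :: l).take ((l.length + 2) / 2)).length ≤ n := by
        simp only [List.length_take, List.length_cons]; omega
      have hlen2 : ((a :: b :: l).drop ((l.length + 2) / 2)).length ≤ n := by
        simp only [List.length_drop, List.length_cons]; omega
      have hpos : 1 ≤ ((a :: b :: l).drop ((l.length + 2) / 2)).length := by
        simp only [List.length_drop, List.length_cons]; omega
      simp only [List.length_take, List.length_drop, List.length_cons] at e1 e2
      have happ := List.take_append_drop ((l.length + 2) / 2) (a :: b :: l)
      obtain ⟨hs, hm⟩ := h
      rw [← happ] at hs hm
      generalize (a :: b :: l).take ((l.length + 2) / 2) = L at *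
      generalize (a :: b :: l).drop ((l.length + 2) / 2) = R at *
      match R, hpos with
      | k :: R, _ =>
        simp only [List.headD_cons]
        rw [List.pairwise_append, List.pairwise_cons] at hs
        obtain ⟨hs1, ⟨hs2, hs3⟩, hs4⟩ := hs
        have hk := mem_keysIn.1 ((hm k).1 (by simp))
        refine ⟨hk.2.1, hk.2.2.le, by omega, by omega, by omega, by omega, ?_, ?_⟩
        · refine ih L _ _ hlen1 ⟨hs1, fun x => ?_⟩
          constructor
          · intro hx
            have := mem_keysIn.1 ((hm x).1 (List.mem_append_left _ hx))
            exact mem_keysIn.2 ⟨this.1, this.2.1, bd_lt_bd.2 (hs4 x hx k (by simp))⟩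
          · intro hx
            rw [mem_keysIn] at hx
            have := (hm x).2 (mem_keysIn.2 ⟨hx.1, hx.2.1, hx.2.2.trans hk.2.2⟩)
            rcases List.mem_append.1 this with h1 | h1
            · exact h1
            · exfalso
              have hxk := bd_lt_bd.1 hx.2.2
              rcases List.mem_cons.1 h1 with rfl | h1
              · exact lt_irrefl _ hxk
              · exact lt_asymm hxk (hs2 x h1)
        · refine ih (k :: R) _ _ hlen2 ⟨List.pairwise_cons.2 ⟨hs2, hs3⟩, fun x => ?_⟩
          constructor
          · intro hx
            have := mem_keysIn.1 ((hm x).1 (List.mem_append_right _ hx))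
            refine mem_keysIn.2 ⟨this.1, ?_, this.2.2⟩
            rw [bd_le_bd]
            rcases List.mem_cons.1 hx with rfl | hx
            · exact le_rfl
            · exact (hs2 x hx).le
          · intro hx
            rw [mem_keysIn] at hx
            have := (hm x).2 (mem_keysIn.2 ⟨hx.1, hk.2.1.trans hx.2.1, hx.2.2⟩)
            rcases List.mem_append.1 this with h1 | h1
            · exact absurd (bd_lt_bd.2 (hs4 x h1 k (by simp))) (not_lt.2 hx.2.1)
            · exact h1

variable {K : ℝ} {H : ℕ → Op α} {G : ℕ → Ghost} {sh sh' : Shared α}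

theorem NodeOK.of_new {nd : ℕ → Node α} {next x p : ℕ} {d : Dir} {δ ts : ℕ}
    (hG : G x = ⟨p, d, δ, ts⟩) (hq : (nd x).queue = []) (hl : (nd x).lastTs = ts)
    (hm : (nd x).st.tsMod = ts) (hroot : ts ≤ (nd root).lastTs)
    (hp : p < next) (hpi : (nd p).body.IsInner) (hpr : p = root → d = .left)
    (hlo : (nd x).lo = ((nd p).childRange d).1) (hhi : (nd x).hi = ((nd p).childRange d).2)
    (hδ : δ = (G p).depth + 1) (hb : (G p).birth ≤ ts) (hts : ts ≤ (nd p).lastTs)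
    (hleaf : ¬ (nd x).body.IsInner →
      ∀ k, k ∈ (nd x).body.keys ↔ k ∈ keysIn (contents H ts) (nd x).lo (nd x).hi)
    (hrange : (nd x).body.IsInner → ∀ d, (nd x).lo ≤ ((nd x).childRange d).1 ∧
      ((nd x).childRange d).2 ≤ (nd x).hi)
    (hinner : (nd x).body.IsInner → InnerOK K H (nd x) ts) : NodeOK K H G nd next x := by
  have hd := Node.done_of_nil hq
  refine { leaf := ?_, birth_le := ?_, lastTs_le := ?_, range := hrange, sorted := ?_, mem := ?_,
           complete := ?_, nonroot := ?_ }
  · intro hb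
    rw [hG]
    exact ⟨hq, hl, hm, hleaf hb⟩
  · rw [hG, hl]
  · rw [hl]; exact hroot
  · rw [hq]; exact List.Pairwise.nil
  · rw [hq]; simp
  · intro t h1 h2
    omega
  · intro _
    refine { par_lt := ?_, par_inner := ?_, par_root := ?_, lo_eq := ?_, hi_eq := ?_,
             depth_eq := ?_, birth_par := ?_, tsMod_le := ?_,
             lastTs_le_tsMod := ?_, inner := ?_, late := ?_ } <;> try rw [hG]
    · exact hp
    · exact hpi
    · exact hpr
    · exact hlo
    · exact hhi
    · exact hδ
    · exact hb
    · rw [hm]; exact hts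
    · rw [hl, hm]
    · exact hinner
    · intro _ h2
      rw [hl] at h2
      exact absurd h2 (lt_irrefl _)

/-- The invariants of the nodes of a new subtree. -/
theorem Shape.nodes_ok {nd : ℕ → Node α} {next ts : ℕ} (hroot : ts ≤ (nd root).lastTs) :
    ∀ {s : Shape α} {a p : ℕ} {d : Dir} {δ : ℕ} {lo hi : Bound α}, root < a →
    a + s.nodeCount ≤ next → s.GhostAt G ts a p d δ → s.NodesAt nd ts a lo hi →
    s.Fits (contents H ts) lo hi → p < next → (nd p).body.IsInner → (p = root → d = .left) →
    (nd p).childRange d = (lo, hi) → δ = (G p).depth + 1 → (G p).birth ≤ ts →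
    ts ≤ (nd p).lastTs → ∀ x, a ≤ x → x < a + s.nodeCount →
    NodeOK K H G nd next x ∧ (nd x).queue = [] ∧ (nd x).lastTs = (G x).birth ∧
      ((nd x).body.IsInner → ∀ e, EdgeOK H G nd next x e)
  | .empty, a, p, d, δ, lo, hi, ha, hn, hG, hM, hF, hp, hpi, hpr, hcr, hδ, hb, hts, x, h1, h2 => by
    have : x = a := by simp only [nodeCount] at h2; omega
    subst this
    have hM' : nd x = _ := hM
    have hG' : G x = _ := hG
    have hF' : keysIn (contents H ts) lo hi = ∅ := hF
    refine ⟨NodeOK.of_new hG' ?_ ?_ ?_ hroot hp hpi hpr ?_ ?_ hδ hb hts ?_ ?_ ?_, ?_, ?_, ?_⟩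
      <;> rw [hM']
    · rw [hcr]
    · rw [hcr]
    · simp [Body.keys, hF']
    · exact fun h => h.elim
    · exact fun h => h.elim
    · rw [hG']
    · exact fun h => h.elim
  | .leaf k, a, p, d, δ, lo, hi, ha, hn, hG, hM, hF, hp, hpi, hpr, hcr, hδ, hb, hts, x, h1, h2 => by
    have : x = a := by simp only [nodeCount] at h2; omega
    subst this
    have hM' : nd x = _ := hM
    have hG' : G x = _ := hG
    have hF' : keysIn (contents H ts) lo hi = {k} := hF
    refine ⟨NodeOK.of_new hG' ?_ ?_ ?_ hroot hp hpi hpr ?_ ?_ hδ hb hts ?_ ?_ ?_, ?_, ?_, ?_⟩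
      <;> rw [hM']
    · rw [hcr]
    · rw [hcr]
    · simp [Body.keys, hF']
    · exact fun h => h.elim
    · exact fun h => h.elim
    · rw [hG']
    · exact fun h => h.elim
  | .inner k l r, a, p, d, δ, lo, hi, ha, hn, hG, hM, hF, hp, hpi, hpr, hcr, hδ, hb, hts, x, h1,
      h2 => by
    obtain ⟨hG1, hG2, hG3⟩ := hG
    obtain ⟨hM1, hM2, hM3⟩ := hM
    have hcard := hF.card
    obtain ⟨f1, f2, f3, f4, f5, f6, hF2, hF3⟩ := hF
    have hl := l.nodeCount_pos
    have hr := r.nodeCount_pos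
    simp only [nodeCount] at hn h2
    have htop : NodeOK K H G nd next (a + l.nodeCount + r.nodeCount) := by
      refine NodeOK.of_new hG1 ?_ ?_ ?_ hroot hp hpi hpr ?_ ?_ hδ hb hts ?_ ?_ ?_
        <;> rw [hM1]
      · rw [hcr]
      · rw [hcr]
      · exact fun h => (h trivial).elim
      · intro _ d
        cases d
        · exact ⟨le_rfl, f2⟩
        · exact ⟨f1, le_rfl⟩
      · intro _
        refine ⟨hcard.symm, (mods_self _).symm, hcard.symm, ?_, ?_⟩
        · simp
        · intro d
          cases d
          · change 1 ≤ (keysIn _ lo (bd k)).card ∧ 2 * (keysIn _ lo (bd k)).card ≤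
              l.keyCount + r.keyCount + 1
            rw [hF2.card]
            exact ⟨f3, f5⟩
          · change 1 ≤ (keysIn _ (bd k) hi).card ∧ 2 * (keysIn _ (bd k) hi).card ≤
              l.keyCount + r.keyCount + 1
            rw [hF3.card]
            exact ⟨f4, f6⟩
    have hinn : (nd (a + l.nodeCount + r.nodeCount)).body.IsInner := by rw [hM1]; trivial
    have hdep : δ + 1 = (G (a + l.nodeCount + r.nodeCount)).depth + 1 := by rw [hG1]
    have hbir : (G (a + l.nodeCount + r.nodeCount)).birth ≤ ts := by rw [hG1]
    have hlas : ts ≤ (nd (a + l.nodeCount + r.nodeCount)).lastTs := by rw [hM1]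
    rcases lt_or_ge x (a + l.nodeCount) with h3 | h3
    · exact nodes_ok hroot ha (by omega) hG2 hM2 hF2 (by omega) hinn (fun _ => rfl)
        (by rw [hM1]; rfl) hdep hbir hlas x h1 h3
    rcases lt_or_ge x (a + l.nodeCount + r.nodeCount) with h4 | h4
    · exact nodes_ok hroot (by omega) (by omega) hG3 hM3 hF3 (by omega) hinn (fun h => by omega)
        (by rw [hM1]; rfl) hdep hbir hlas x h3 h4
    have : x = a + l.nodeCount + r.nodeCount := by omega
    subst this
    refine ⟨htop, by rw [hM1], by rw [hM1, hG1], fun _ e => ?_⟩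
    have hdone : (nd (a + l.nodeCount + r.nodeCount)).done = ts := by rw [hM1]; rfl
    cases e
    · have hc : (nd (a + l.nodeCount + r.nodeCount)).child .left = a + l.nodeCount - 1 := by
        rw [hM1]; rfl
      refine ⟨?_, ?_, ?_, ?_, ?_⟩ <;> rw [hc]
      · omega
      · omega
      · rw [hG2.top]
      · rw [hG2.top]
      · rw [hdone]
        intro t h5 h6
        rw [hM2.top.1] at h5
        omega
    · have hc : (nd (a + l.nodeCount + r.nodeCount)).child .right =
          a + l.nodeCount + r.nodeCount - 1 := by
        rw [hM1]; rfl
      refine ⟨?_, ?_, ?_, ?_, ?_⟩ <;> rw [hc]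
      · omega
      · omega
      · rw [hG3.top]
      · rw [hG3.top]
      · rw [hdone]
        intro t h5 h6
        rw [hM3.top.1] at h5
        omega

/-- Building a new subtree for the register `d` of `v`. -/
theorem MemOK.alloc (h : MemOK K H G sh) {v : ℕ} {d : Dir} {ts : ℕ} {l : List α}
    (hv : v < sh.next) (hi : (sh.node v).body.IsInner) (hd : v = root → d = .left)
    (hb : (G v).birth ≤ ts) (hts : ts ≤ (sh.node v).lastTs)
    (hl : IsList l (keysIn (contents H ts) ((sh.node v).childRange d).1
      ((sh.node v).childRange d).2))
    (hG : (ideal l).GhostAt G ts sh.next v d ((G v).depth + 1))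
    (hsh' : sh' = (Shared.alloc ts (ideal l) ((sh.node v).childRange d).1
      ((sh.node v).childRange d).2 sh).1) :
    MemOK K H G sh' ∧ ∀ x, sh.next ≤ x → x < sh'.next →
      (sh'.node x).lastTs = (G x).birth := by
  obtain ⟨a1, -, a3, -, a5, a6, a7⟩ := alloc_spec ts (ideal l) ((sh.node v).childRange d).1
    ((sh.node v).childRange d).2 sh
  rw [← hsh'] at a1 a3 a5 a6 a7
  have hroot := a3 root (Or.inl h.root_lt)
  have hpos := (ideal l).nodeCount_pos
  have hnew := Shape.nodes_ok (K := K) (H := H) (G := G) (next := sh'.next) (ts := ts)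
    (by rw [hroot]; exact hts.trans (h.node v hv).lastTs_le) h.root_lt
    (by rw [a1]) hG a7 (ideal_fits _ _ l _ _ le_rfl hl) (by omega)
    (by rw [a3 v (Or.inl hv)]; exact hi) hd (by rw [a3 v (Or.inl hv)]) rfl hb
    (by rw [a3 v (Or.inl hv)]; exact hts)
  have hold : ∀ x < sh.next, sh'.node x = sh.node x := fun x hx => a3 x (Or.inl hx)
  refine ⟨?_, fun x h1 h2 => (hnew x h1 (by omega)).2.2.1⟩
  refine { root_lt := by have := h.root_lt; omega, root_body := by rw [hroot]; exact h.root_body,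
           root_lo := by rw [hroot]; exact h.root_lo, root_hi := by rw [hroot]; exact h.root_hi,
           root_birth := h.root_birth, root_depth := h.root_depth,
           node := ?_, edge := ?_, queue_nil := ?_, keys := ?_, visits := ?_ }
  · intro x hx
    rcases lt_or_ge x sh.next with h1 | h1
    · have hn := h.node x h1
      have hx' := hold x h1
      refine { leaf := ?_, birth_le := ?_, lastTs_le := ?_, range := ?_, sorted := ?_, mem := ?_,
               complete := ?_, nonroot := ?_ }
      · rw [hx']; exact hn.leaf
      · rw [hx']; exact hn.birth_le
      · rw [hx', hroot]; exact hn.lastTs_le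
      · rw [hx']; exact hn.range
      · rw [hx']; exact hn.sorted
      · rw [hx']; exact hn.mem
      · rw [hx']; exact hn.complete
      · intro hr
        have hm := hn.nonroot hr
        have hp := hold _ hm.par_lt
        refine { par_lt := ?_, par_inner := ?_, par_root := hm.par_root, lo_eq := ?_, hi_eq := ?_,
                 depth_eq := hm.depth_eq, birth_par := hm.birth_par, tsMod_le := ?_,
                 lastTs_le_tsMod := ?_, inner := ?_, late := ?_ }
        · have := hm.par_lt; omega
        · rw [hp]; exact hm.par_inner
        · rw [hx', hp]; exact hm.lo_eq
        · rw [hx', hp]; exact hm.hi_eq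
        · rw [hx', hp]; exact hm.tsMod_le
        · rw [hx']; exact hm.lastTs_le_tsMod
        · rw [hx']; exact hm.inner
        · rw [hx', hp]; exact hm.late
    · exact (hnew x h1 (by omega)).1
  · intro x hx hxi e he
    rcases lt_or_ge x sh.next with h1 | h1
    · have hx' := hold x h1
      rw [hx'] at hxi
      have he := h.edge x h1 hxi e he
      have hc := hold _ he.lt
      refine { lt := ?_, ne_root := ?_, par_eq := ?_, dir_eq := ?_, upTo := ?_ } <;> rw [hx']
      · have := he.lt; omega
      · exact he.ne_root
      · exact he.par_eq
      · exact he.dir_eq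
      · rw [hc]; exact he.upTo
    · exact (hnew x h1 (by omega)).2.2.2 hxi e
  · intro x hx
    rw [a3 x (Or.inr (by omega))]
    exact h.queue_nil x (by omega)
  · rw [a5, hroot]; exact h.keys
  · rw [a6, h.visits, a1]
    rw [Finset.sum_range_add]
    -- A new node has `lastTs` equal to its birth, so nothing has been inserted into its queue.
    have h0 : ∑ x ∈ Finset.range (ideal l).nodeCount,
        visitCount H (sh'.node (sh.next + x)) (G (sh.next + x)).birth = 0 := by
      refine Finset.sum_eq_zero fun x hx => ?_
      have := (hnew (sh.next + x) (by omega) (by simpa using hx)).2.2.1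
      simp [visitCount, this]
    rw [h0, add_zero]
    exact Finset.sum_congr rfl fun x hx => by rw [hold x (Finset.mem_range.1 hx)]

end Alloc

/-! ### Assertions about control states, and their stability under interference -/

section Frames

variable {α : Type u}

/-- The active operation `D` of `v` need not be handed on to the child in direction `d` any more. -/
def Compl (sh : Shared α) (D : Desc α) (v : ℕ) (d : Dir) : Prop :=
  (sh.node v).done < D.ts → (sh.node ((sh.node v).child d)).Recv D

/-- `u` is a node below `c` such that the queues of all nodes from `c` to the parent of `u` are
empty. -/
inductive Under (nd : ℕ → Node α) (c : ℕ) : ℕ → Prop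
  | top : Under nd c c
  | down (u : ℕ) (d : Dir) : Under nd c u → (nd u).body.IsInner → (nd u).queue = [] →
      Under nd c ((nd u).child d)

/-- The place belongs to the subtree of `c`, below nodes with empty queues. -/
def PlaceOK (nd : ℕ → Node α) (c : ℕ) : Place → Prop
  | .node u => Under nd c u
  | .edge u _ => Under nd c u ∧ (nd u).body.IsInner ∧ (nd u).queue = []

/-- All nodes of the subtree that are not in the subtree of a place in `todo` have empty queues. -/
inductive Cov (nd : ℕ → Node α) (todo : List Place) : Place → Prop
  | mem (pl : Place) : pl ∈ todo → Cov nd todo pl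
  | edge (u : ℕ) (e : Dir) : Cov nd todo (.node ((nd u).child e)) → Cov nd todo (.edge u e)
  | leaf (u : ℕ) : ¬ (nd u).body.IsInner → Cov nd todo (.node u)
  | inner (u : ℕ) : (nd u).queue = [] → (∀ e, Cov nd todo (.edge u e)) → Cov nd todo (.node u)

/-- Used when draining replaces a pending place by places that together cover it, or drops a leaf.
-/
theorem Cov.trans {nd : ℕ → Node α} {todo todo' : List Place}
    (h : ∀ pl ∈ todo, Cov nd todo' pl) {pl : Place} (hc : Cov nd todo pl) : Cov nd todo' pl := by
  induction hc with
  | mem pl hp => exact h pl hp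
  | edge u e _ ih => exact .edge u e ih
  | leaf u hl => exact .leaf u hl
  | inner u hq _ ih => exact .inner u hq ih

/-- Lower end of the key range of a place. -/
def placeLo (nd : ℕ → Node α) : Place → Bound α
  | .node u => (nd u).lo
  | .edge u e => ((nd u).childRange e).1

/-- Upper end of the key range of a place. -/
def placeHi (nd : ℕ → Node α) : Place → Bound α
  | .node u => (nd u).hi
  | .edge u e => ((nd u).childRange e).2

/-- The places have adjacent key ranges, from `a` to `b`. -/
def Contiguous (nd : ℕ → Node α) : List Place → Bound α → Bound α → Prop
  | [], a, b => a = b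
  | pl :: t, a, b => placeLo nd pl = a ∧ Contiguous nd t (placeHi nd pl) b

/-- The nodes of `Rb` below `v`, with exceptions, are not children of `v` any more. -/
def Fresh (G : ℕ → Ghost) (sh : Shared α) (Rb : Finset ℕ) (v : ℕ) (skip : ℕ → Prop) : Prop :=
  ∀ c ∈ Rb, (G c).par = v → skip c ∨ c < (sh.node v).child (G c).dir

/-- The new subtree `nv` for the register `d` of `v`. -/
structure NewTree (G : ℕ → Ghost) (sh : Shared α) (v : ℕ) (d : Dir) (c nv T : ℕ) : Prop where
  gt : c < nv
  lt : nv < sh.next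
  ne_root : nv ≠ root
  par_eq : (G nv).par = v
  dir_eq : (G nv).dir = d
  le_lastTs : T ≤ (sh.node nv).lastTs

theorem Needs.congr {K : ℝ} {D : Desc α} {n n' : Node α} (h : Needs K D n) (hb : n'.body = n.body)
    (hs : n'.st = n.st) : Needs K D n' := by
  unfold Needs
  rw [hb, hs]
  exact h

variable [LinearOrder α]

/-- The execution of `D` in `v` has to continue in the child `c` that was found in the register
`d`. -/
structure Visit (H : ℕ → Op α) (G : ℕ → Ghost) (sh : Shared α) (D : Desc α) (v : ℕ) (d : Dir)
    (c : ℕ) : Prop where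
  started : Started H G sh D v
  task : (sh.node v).Task D.op d
  lt : c < sh.next
  ne_root : c ≠ root
  par_eq : (G c).par = v
  dir_eq : (G c).dir = d
  le : c ≤ (sh.node v).child d

/-- The inner child `c` to which `D` is handed on. -/
structure Hand (sh : Shared α) (D : Desc α) (v : ℕ) (d : Dir) (c : ℕ) : Prop where
  inner : (sh.node c).body.IsInner
  cur : (sh.node v).done < D.ts → (sh.node v).child d = c
  -- A late helper of an operation already finished in `v` finds it in `c` as well, so its remaining
  -- CAS and push do nothing.
  old : D.ts ≤ (sh.node v).done → D.ts ≤ (sh.node c).lastTs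

/-- The inner child `c` is rebuilt for `D`. -/
structure Rebuild (K : ℝ) (H : ℕ → Op α) (sh : Shared α) (D : Desc α) (v : ℕ) (d : Dir)
    (c : ℕ) : Prop where
  inner : (sh.node c).body.IsInner
  needs : Needs K D (sh.node c)
  upTo : (sh.node c).UpTo H (D.ts - 1)
  -- As long as `c` stays in the register, `D` cannot be finished in `v`, so `D` is active there.
  cur : (sh.node v).child d = c → (sh.node v).done < D.ts

/-- `D` finishes in the leaf or empty node `c`. -/
structure LeafTask (H : ℕ → Op α) (sh : Shared α) (D : Desc α) (v : ℕ) (d : Dir)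
    (c : ℕ) : Prop where
  leaf : ¬ (sh.node c).body.IsInner
  upTo : (sh.node c).UpTo H (D.ts - 1)
  old : D.ts ≤ (sh.node v).done → (sh.node v).child d = c → D.eff = true →
    D.ts ≤ (sh.node c).lastTs
  -- Another helper may already have swung the register to a tree that contains the effect of `D`.
  cur : (sh.node v).done < D.ts → (sh.node v).child d = c ∨
    (sh.node ((sh.node v).child d)).Recv D

/-- `todo` contains the tasks of `D` in `v` that are not complete, with an exception. -/
structure Todo (sh : Shared α) (D : Desc α) (v : ℕ) (todo : List (Dir × Act))
    (skip : Dir → Prop) : Prop where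
  task : ∀ e, (e, Act.visit) ∈ todo → (sh.node v).Task D.op e
  cover : ∀ e, (sh.node v).Task D.op e → (e, Act.visit) ∈ todo ∨ skip e ∨ Compl sh D v e

/-- The state `s` of `c` may be replaced only if it is the right one. -/
def CasOK (sh : Shared α) (D : Desc α) (v c : ℕ) (s : NodeState) : Prop :=
  (sh.node v).done < D.ts → (sh.node c).st.tsMod < D.ts → (sh.node c).st = s

/-- The frames of an execution of `D` in `v`. -/
inductive Seg (K : ℝ) (H : ℕ → Op α) (G : ℕ → Ghost) (sh : Shared α) (Rb : Finset ℕ)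
    (D : Desc α) (v : ℕ) : List (Frame α) → Prop
  | exec (todo : List (Dir × Act)) (acc : ℕ) (ht : Todo sh D v todo fun _ => False)
      (hf : Fresh G sh Rb v fun _ => False) : Seg K H G sh Rb D v [.exec D v todo acc]
  | lookAdd (d : Dir) (todo : List (Dir × Act)) (acc c : ℕ) (ht : Todo sh D v todo fun _ => False)
      (hf : Fresh G sh Rb v fun _ => False) : Seg K H G sh Rb D v [.look D v d .add todo acc c]
  | lookVisit (d : Dir) (todo : List (Dir × Act)) (acc c : ℕ) (ht : Todo sh D v todo fun e => e = d)
      (hf : Fresh G sh Rb v fun _ => False) (hv : Visit H G sh D v d c) (hc : c ∉ Rb)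
      (hi : (sh.node c).body.IsInner → Rebuild K H sh D v d c ∨ Hand sh D v d c)
      (hl : ¬ (sh.node c).body.IsInner → LeafTask H sh D v d c) :
      Seg K H G sh Rb D v [.look D v d .visit todo acc c]
  | pushTraverse (d : Dir) (todo : List (Dir × Act)) (acc c : ℕ) (s : NodeState)
      (ht : Todo sh D v todo fun e => e = d)
      (hf : Fresh G sh Rb v fun _ => False) (hv : Visit H G sh D v d c) (hh : Hand sh D v d c)
      (hn : ¬ Needs K D (sh.node c)) (hs : CasOK sh D v c s) :
      Seg K H G sh Rb D v [.pushTraverse D c, .casState D c s, .pushIf D c, .exec D v todo acc]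
  | casState (d : Dir) (todo : List (Dir × Act)) (acc c : ℕ) (s : NodeState)
      (ht : Todo sh D v todo fun e => e = d)
      (hf : Fresh G sh Rb v fun _ => False) (hv : Visit H G sh D v d c) (hh : Hand sh D v d c)
      (hn : ¬ Needs K D (sh.node c)) (hs : CasOK sh D v c s) :
      Seg K H G sh Rb D v [.casState D c s, .pushIf D c, .exec D v todo acc]
  | pushIf (d : Dir) (todo : List (Dir × Act)) (acc c : ℕ)
      (ht : Todo sh D v todo fun e => e = d)
      (hf : Fresh G sh Rb v fun _ => False) (hv : Visit H G sh D v d c) (hh : Hand sh D v d c)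
      (hm : D.ts ≤ (sh.node c).st.tsMod) :
      Seg K H G sh Rb D v [.pushIf D c, .exec D v todo acc]
  | popIf (ht : Todo sh D v [] fun _ => False)
      (hf : Fresh G sh Rb v fun _ => False) : Seg K H G sh Rb D v [.popIf D v]
  | leafBuild (d : Dir) (todo : List (Dir × Act)) (acc c : ℕ) (keys : List α)
      (ht : Todo sh D v todo fun e => e = d)
      (hf : Fresh G sh Rb v fun _ => False) (hv : Visit H G sh D v d c)
      (hl : LeafTask H sh D v d c) (he : D.eff = true) (hlt : (sh.node c).lastTs < D.ts)
      (hk : IsList keys (keysIn (contents H D.ts) ((sh.node v).childRange d).1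
        ((sh.node v).childRange d).2)) :
      Seg K H G sh Rb D v [.build D v d c D.ts keys, .exec D v todo acc]
  | leafSwing (d : Dir) (todo : List (Dir × Act)) (acc c nv : ℕ)
      (ht : Todo sh D v todo fun e => e = d)
      (hf : Fresh G sh Rb v fun _ => False) (hv : Visit H G sh D v d c)
      (hl : LeafTask H sh D v d c) (he : D.eff = true) (hlt : (sh.node c).lastTs < D.ts)
      (hn : NewTree G sh v d c nv D.ts) :
      Seg K H G sh Rb D v [.swing v d c nv, .exec D v todo acc]
  | drain (d : Dir) (todo : List (Dir × Act)) (acc c : ℕ) (pls : List Place)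
      (ht : Todo sh D v ((d, .visit) :: todo) fun _ => False)
      (hf : Fresh G sh Rb v fun x => x = c) (hv : Visit H G sh D v d c)
      (hr : Rebuild K H sh D v d c) (hp : ∀ pl ∈ pls, PlaceOK sh.node c pl)
      (hc : Cov sh.node pls (.node c)) :
      Seg K H G sh Rb D v [.drain D v d c pls, .exec D v ((d, .visit) :: todo) acc]
  | collect (d : Dir) (todo : List (Dir × Act)) (acc c : ℕ) (pls : List Place) (keys : List α)
      (pos : Bound α) (ht : Todo sh D v ((d, .visit) :: todo) fun _ => False)
      (hf : Fresh G sh Rb v fun x => x = c) (hv : Visit H G sh D v d c)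
      (hr : Rebuild K H sh D v d c) (hp : ∀ pl ∈ pls, PlaceOK sh.node c pl)
      (hc : ∀ pl ∈ pls, Cov sh.node [] pl) (hpos : (sh.node c).lo ≤ pos)
      (hcon : Contiguous sh.node pls pos (sh.node c).hi)
      (hk : IsList keys (keysIn (contents H (D.ts - 1)) (sh.node c).lo pos)) :
      Seg K H G sh Rb D v [.collect D v d c pls keys, .exec D v ((d, .visit) :: todo) acc]
  | build (d : Dir) (todo : List (Dir × Act)) (acc c : ℕ) (keys : List α)
      (ht : Todo sh D v ((d, .visit) :: todo) fun _ => False)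
      (hf : Fresh G sh Rb v fun x => x = c) (hv : Visit H G sh D v d c)
      (hr : Rebuild K H sh D v d c)
      (hk : IsList keys (keysIn (contents H (D.ts - 1)) ((sh.node v).childRange d).1
        ((sh.node v).childRange d).2)) :
      Seg K H G sh Rb D v [.build D v d c (D.ts - 1) keys, .exec D v ((d, .visit) :: todo) acc]
  | swing (d : Dir) (todo : List (Dir × Act)) (acc c nv : ℕ)
      (ht : Todo sh D v ((d, .visit) :: todo) fun _ => False)
      (hf : Fresh G sh Rb v fun x => x = c) (hv : Visit H G sh D v d c)
      (hr : Rebuild K H sh D v d c) (hn : NewTree G sh v d c nv (D.ts - 1)) :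
      Seg K H G sh Rb D v [.swing v d c nv, .exec D v ((d, .visit) :: todo) acc]

/-- The top frame executes operations in the node `u`. -/
def Calls (u : ℕ) : List (Frame α) → Prop
  | .execUntil _ v :: _ => v = u
  | .drain _ _ _ _ (.node v :: _) :: _ => v = u
  | _ => False

/-- The control state of a process; `A` is the list of the pairs of a timestamp and a node such that
the process is executing the operation in the node, and `ini` tells the timestamp of its own
operation, and whether it is visiting the node at the head of its queue of nodes. -/
inductive StackOK (K : ℝ) (H : ℕ → Op α) (G : ℕ → Ghost) (sh : Shared α) (Rb : Finset ℕ) :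
    List (Frame α) → List (ℕ × ℕ) → Option (ℕ × Bool) → Prop
  | nil : StackOK K H G sh Rb [] [] none
  | enqRead (op : Op α) : StackOK K H G sh Rb [.enqRead op] [] none
  | enqCas (op : Op α) (t : ℕ) : StackOK K H G sh Rb [.enqCas op t] [] none
  | traverse (D : Desc α) : StackOK K H G sh Rb [.traverse D] [] (some (D.ts, false))
  | traversePop (D : Desc α) : StackOK K H G sh Rb [.traversePop D] [] (some (D.ts, true))
  | execUntil (D : Desc α) (v : ℕ) :
      StackOK K H G sh Rb [.execUntil D v, .traversePop D] [] (some (D.ts, true))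
  | call (E : Desc α) (u : ℕ) (fs B : List (Frame α)) (A : List (ℕ × ℕ)) (ini : Option (ℕ × Bool))
      (hs : Seg K H G sh Rb E u fs) (hE : Started H G sh E u) (hc : Calls u B)
      (hA : ∀ a ∈ A, (G a.2).depth < (G u).depth) (hB : StackOK K H G sh Rb B A ini) :
      StackOK K H G sh Rb (fs ++ B) ((E.ts, u) :: A) ini

variable {K : ℝ} {H : ℕ → Op α} {G : ℕ → Ghost} {sh sh' : Shared α} {D : Desc α} {v c : ℕ}
  {d : Dir}

theorem Started.active (h : Started H G sh D v) (hd : (sh.node v).done < D.ts) :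
    Active H G sh D v := { h with done_lt := hd }

theorem Rely.childRange (hR : Rely K H G sh sh') (hv : v < sh.next) :
    (sh'.node v).childRange = (sh.node v).childRange :=
  childRange_congr (hR.body v hv) (hR.lo v hv) (hR.hi v hv)

theorem Rely.task (hR : Rely K H G sh sh') (hv : v < sh.next) {op : Op α} :
    (sh'.node v).Task op d ↔ (sh.node v).Task op d := by
  unfold Node.Task
  rw [hR.childRange hv]

theorem Rely.isInner (hR : Rely K H G sh sh') (hv : v < sh.next) :
    (sh'.node v).body.IsInner ↔ (sh.node v).body.IsInner := by
  rw [hR.body v hv]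

theorem Node.UpTo.rely {T : ℕ} (h : (sh.node v).UpTo H T) (hR : Rely K H G sh sh')
    (hv : v < sh.next) : (sh'.node v).UpTo H T := by
  intro t h1 h2 h3
  rw [hR.lo v hv, hR.hi v hv] at h3
  rw [hR.body v hv]
  exact h t ((hR.lastTs_le v hv).trans_lt h1) h2 h3

theorem Node.Recv.rely (h : (sh.node v).Recv D) (hR : Rely K H G sh sh')
    (hv : v < sh.next) : (sh'.node v).Recv D := by
  unfold Node.Recv at h ⊢
  rw [hR.body v hv]
  exact h.imp_right fun h => h.trans (hR.lastTs_le v hv)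

theorem Started.rely (h : Started H G sh D v) (hR : Rely K H G sh sh') :
    Started H G sh' D v where
  desc := h.desc
  visits := by rw [hR.lo v h.lt, hR.hi v h.lt]; exact h.visits
  lt := h.lt.trans_le hR.next_le
  inner := (hR.isInner h.lt).2 h.inner
  birth_lt := h.birth_lt
  le_lastTs := h.le_lastTs.trans (hR.lastTs_le v h.lt)
  le_done := h.le_done.trans (by have := hR.done_le v h.lt; omega)

theorem Started.op_eq (h : Started H G sh D v) : D.op = H D.ts := by rw [h.desc]; rfl

theorem MemOK.lastTs_le_tsMod (h : MemOK K H G sh) (hc : c < sh.next) (hr : c ≠ root) :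
    (sh.node c).lastTs ≤ (sh.node c).st.tsMod := ((h.node c hc).nonroot hr).lastTs_le_tsMod

/-- The register could move only for `D` itself. A swing from a leaf installs a tree that has
received `D`, and a rebuilding of an inner child presupposes a record older than `D`, which
contradicts its receipt. -/
theorem Compl.rely (hc : Compl sh D v d) (hM : MemOK K H G sh) (hR : Rely K H G sh sh')
    (hS : Started H G sh D v) (ht : (sh.node v).Task D.op d) : Compl sh' D v d := by
  intro h1
  have h2 : (sh.node v).done < D.ts := (hR.done_le v hS.lt).trans_lt h1
  have he := hM.edge v hS.lt hS.inner d (hM.task_left ht)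
  have hrec := hc h2
  by_cases hch : (sh'.node v).child d = (sh.node v).child d
  · rw [hch]
    exact hrec.rely hR he.lt
  · obtain ⟨E, hE, -, h3⟩ := hR.swing v hS.lt d hch
    obtain rfl := hM.active_unique hE (hS.active h2)
    rcases h3 with ⟨h3, h4, h5, h6⟩ | ⟨h3, h4, -⟩
    · exact Or.inr h6
    · have := hM.lastTs_le_tsMod he.lt he.ne_root
      have := h4.1
      rcases hrec with h5 | h5
      · exact absurd h3 h5.1
      · omega

theorem Todo.rely {todo : List (Dir × Act)} {skip : Dir → Prop} (ht : Todo sh D v todo skip)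
    (hM : MemOK K H G sh) (hR : Rely K H G sh sh') (hS : Started H G sh D v) :
    Todo sh' D v todo skip where
  task e he := (hR.task hS.lt).2 (ht.task e he)
  cover e he := by
    have he := (hR.task hS.lt).1 he
    exact (ht.cover e he).imp_right fun h => h.imp_right fun h => h.rely hM hR hS he

theorem Fresh.rely {Rb : Finset ℕ} {skip : ℕ → Prop} (hf : Fresh G sh Rb v skip)
    (hR : Rely K H G sh sh') (hv : v < sh.next) : Fresh G sh' Rb v skip := fun c hc hp =>
  (hf c hc hp).imp_right fun h => h.trans_le (hR.child_le v hv _)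

theorem NewTree.rely {nv T : ℕ} (hn : NewTree G sh v d c nv T) (hR : Rely K H G sh sh') :
    NewTree G sh' v d c nv T :=
  { hn with lt := hn.lt.trans_le hR.next_le,
            le_lastTs := hn.le_lastTs.trans (hR.lastTs_le _ hn.lt) }

theorem Visit.rely (hV : Visit H G sh D v d c) (hR : Rely K H G sh sh') :
    Visit H G sh' D v d c where
  started := hV.started.rely hR
  task := (hR.task hV.started.lt).2 hV.task
  lt := hV.lt.trans_le hR.next_le
  ne_root := hV.ne_root
  par_eq := hV.par_eq
  dir_eq := hV.dir_eq
  le := hV.le.trans (hR.child_le v hV.started.lt d)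

/-- A changed state of `c` has a timestamp at least that of any operation started in the parent. -/
theorem Visit.st_change (hV : Visit H G sh D v d c) (hR : Rely K H G sh sh')
    (hne : (sh'.node c).st ≠ (sh.node c).st) : D.ts ≤ (sh'.node c).st.tsMod ∧
    ∃ E, Active H G sh E v ∧ (sh.node v).child d = c ∧ ¬ Needs K E (sh.node c) := by
  obtain ⟨-, E, hE, h1, h2, h3⟩ := hR.cas c hV.lt hne
  rw [hV.par_eq, hV.dir_eq] at h1
  rw [hV.par_eq] at hE
  exact ⟨by rw [h3]; exact hV.started.le_of_active hE, E, hE, h1, h2⟩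

theorem Visit.not_needs (hV : Visit H G sh D v d c) (hR : Rely K H G sh sh')
    (hn : ¬ Needs K D (sh.node c)) : ¬ Needs K D (sh'.node c) := by
  by_cases hst : (sh'.node c).st = (sh.node c).st
  · unfold Needs
    rw [hst, hR.body c hV.lt]
    exact hn
  · have := (hV.st_change hR hst).1
    exact fun h => absurd h.1 (not_lt.2 this)

theorem Visit.le_tsMod (hV : Visit H G sh D v d c) (hR : Rely K H G sh sh')
    (hn : D.ts ≤ (sh.node c).st.tsMod) : D.ts ≤ (sh'.node c).st.tsMod := by
  by_cases hst : (sh'.node c).st = (sh.node c).st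
  · rw [hst]; exact hn
  · exact (hV.st_change hR hst).1

theorem Visit.casOK {s : NodeState} (hV : Visit H G sh D v d c) (hR : Rely K H G sh sh')
    (hn : CasOK sh D v c s) : CasOK sh' D v c s := by
  intro h1 h2
  by_cases hst : (sh'.node c).st = (sh.node c).st
  · rw [hst] at h2 ⊢
    exact hn ((hR.done_le v hV.started.lt).trans_lt h1) h2
  · have := (hV.st_change hR hst).1
    omega

/-- While `c` is rebuilt, its state and its queue tail do not change. -/
theorem Rebuild.frozen (hr : Rebuild K H sh D v d c) (hM : MemOK K H G sh)
    (hR : Rely K H G sh sh') (hV : Visit H G sh D v d c) :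
    (sh'.node c).st = (sh.node c).st ∧ (sh'.node c).lastTs = (sh.node c).lastTs := by
  constructor
  -- A new record of `c` is written only while `c` is in the register, and for the active operation
  -- of `v`, which then is `D`. But a record may change only when no rebuilding is needed.
  · by_contra hst
    obtain ⟨-, E, hE, h1, h2⟩ := hV.st_change hR hst
    obtain rfl := hM.active_unique hE (hV.started.active (hr.cur h1))
    exact h2 hr.needs
  · by_contra hst
    obtain ⟨-, E, hE, h1, h2⟩ := hR.push c hV.lt hst hV.ne_root
    rw [hV.par_eq, hV.dir_eq] at h1
    rw [hV.par_eq] at hE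
    obtain rfl := hM.active_unique hE (hV.started.active (hr.cur h1))
    exact absurd hr.needs.1 (not_lt.2 h2)

theorem Rebuild.rely (hr : Rebuild K H sh D v d c) (hM : MemOK K H G sh)
    (hR : Rely K H G sh sh') (hV : Visit H G sh D v d c) : Rebuild K H sh' D v d c where
  inner := (hR.isInner hV.lt).2 hr.inner
  needs := hr.needs.congr (hR.body c hV.lt) (hr.frozen hM hR hV).1
  upTo := hr.upTo.rely hR hV.lt
  cur h1 := by
    have hv := hV.started.lt
    have h2 : (sh.node v).child d = c := by
      have := hR.child_le v hv d
      have := hV.le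
      omega
    have h3 := hr.cur h2
    -- Popping `D` in `v` requires that `c` has received it, which the record older than `D`
    -- excludes.
    by_contra h4
    have h5 := ((hR.pop v hv D.ts h3 (not_lt.1 h4) d).2
      (by rw [← hV.started.op_eq]; exact hV.task))
    rw [h2, ← hV.started.desc] at h5
    rcases h5 with h5 | h5
    · exact h5.1 hr.inner
    · have := hM.lastTs_le_tsMod hV.lt hV.ne_root
      have := hr.needs.1
      omega

/-- While `D` is active, its inner child can leave the register only through a rebuilding on behalf
of `D`. A helper that still has to decide then finds itself in the case of rebuilding. -/
theorem Hand.rely_or (hh : Hand sh D v d c) (hM : MemOK K H G sh)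
    (hR : Rely K H G sh sh') (hV : Visit H G sh D v d c) :
    Rebuild K H sh' D v d c ∧ Needs K D (sh.node c) ∨ Hand sh' D v d c := by
  have hv := hV.started.lt
  have hi := (hR.isInner hV.lt).2 hh.inner
  rcases le_or_gt D.ts (sh.node v).done with h1 | h1
  · exact Or.inr ⟨hi, fun h2 => absurd (hR.done_le v hv) (by omega), fun _ =>
      (hh.old h1).trans (hR.lastTs_le c hV.lt)⟩
  have hc := hh.cur h1
  rcases le_or_gt D.ts (sh'.node v).done with h2 | h2
  · right
    have h5 := ((hR.pop v hv D.ts h1 h2 d).2 (by rw [← hV.started.op_eq]; exact hV.task))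
    rw [hc] at h5
    refine ⟨hi, fun h3 => absurd h2 (not_le.2 h3), fun _ => ?_⟩
    rcases h5 with h5 | h5
    · exact absurd hh.inner h5.1
    · exact h5.trans (hR.lastTs_le c hV.lt)
  · by_cases h3 : (sh'.node v).child d = c
    · exact Or.inr ⟨hi, fun _ => h3, fun h4 => absurd h2 (not_lt.2 h4)⟩
    · left
      obtain ⟨E, hE, -, h4⟩ := hR.swing v hv d (by rw [hc]; exact h3)
      obtain rfl := hM.active_unique hE (hV.started.active h1)
      rw [hc] at h4
      rcases h4 with h4 | ⟨-, h4, h5⟩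
      · exact absurd hh.inner h4.1
      · have hr : Rebuild K H sh E v d c := ⟨hh.inner, h4, h5, fun _ => h1⟩
        exact ⟨hr.rely hM hR hV, h4⟩

theorem Hand.rely (hh : Hand sh D v d c) (hM : MemOK K H G sh)
    (hR : Rely K H G sh sh') (hV : Visit H G sh D v d c) (hn : ¬ Needs K D (sh.node c)) :
    Hand sh' D v d c :=
  (hh.rely_or hM hR hV).resolve_left fun h => hn h.2

theorem LeafTask.lastTs_eq (hl : LeafTask H sh D v d c)
    (hR : Rely K H G sh sh') (hV : Visit H G sh D v d c) :
    (sh'.node c).lastTs = (sh.node c).lastTs := by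
  by_contra hne
  exact hl.leaf (hR.push c hV.lt hne hV.ne_root).1

theorem LeafTask.rely (hl : LeafTask H sh D v d c) (hM : MemOK K H G sh)
    (hR : Rely K H G sh sh') (hV : Visit H G sh D v d c) : LeafTask H sh' D v d c := by
  have hv := hV.started.lt
  refine ⟨fun h => hl.leaf ((hR.isInner hV.lt).1 h), hl.upTo.rely hR hV.lt, ?_, ?_⟩
  · intro h1 h2 h3
    have h4 : (sh.node v).child d = c := by
      have := hR.child_le v hv d
      have := hV.le
      omega
    rw [hl.lastTs_eq hR hV]
    rcases le_or_gt D.ts (sh.node v).done with h5 | h5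
    · exact hl.old h5 h4 h3
    · have h6 := ((hR.pop v hv D.ts h5 h1 d).2 (by rw [← hV.started.op_eq]; exact hV.task))
      rw [h4, ← hV.started.desc] at h6
      rcases h6 with h6 | h6
      · rw [h3] at h6; cases h6.2
      · exact h6
  · intro h1
    have h2 : (sh.node v).done < D.ts := (hR.done_le v hv).trans_lt h1
    by_cases hch : (sh'.node v).child d = (sh.node v).child d
    · rw [hch]
      refine (hl.cur h2).imp_right fun h3 => h3.rely hR ?_
      exact (hM.edge v hv hV.started.inner d (hM.task_left hV.task)).lt
    · right
      rcases hl.cur h2 with h3 | h3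
      · obtain ⟨E, hE, -, h4⟩ := hR.swing v hv d hch
        obtain rfl := hM.active_unique hE (hV.started.active h2)
        rw [h3] at h4
        rcases h4 with h4 | h4
        · exact Or.inr h4.2.2.2
        · exact absurd h4.1 hl.leaf
      · exact Compl.rely (fun _ => h3) hM hR hV.started hV.task h1

theorem MemOK.edge_of_under (hM : MemOK K H G sh) {u : ℕ} (hu : u < sh.next) (hr : u ≠ root)
    (hi : (sh.node u).body.IsInner) (e : Dir) : EdgeOK H G sh.node sh.next u e :=
  hM.edge u hu hi e fun h => absurd h hr

/-- The nodes of a subtree that is being rebuilt. -/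
theorem Under.facts {u : ℕ} (hu : Under sh.node c u) (hM : MemOK K H G sh)
    (hr : Rebuild K H sh D v d c) (hV : Visit H G sh D v d c) :
    u < sh.next ∧ u ≠ root ∧ (sh.node u).UpTo H (D.ts - 1) ∧ (G c).depth ≤ (G u).depth := by
  induction hu with
  | top => exact ⟨hV.lt, hV.ne_root, hr.upTo, le_rfl⟩
  | down u e _ hi hq ih =>
    obtain ⟨h1, h2, h3, h4⟩ := ih
    have he := hM.edge_of_under h1 h2 hi e
    refine ⟨he.lt, he.ne_root, ?_, ?_⟩
    · intro t h5 h6 h7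
      -- Up to its tail, the drained node `u` has handed on everything. Beyond the tail, no
      -- operation before `D` concerns `u`, hence none concerns its child.
      rcases le_or_gt t (sh.node u).lastTs with h8 | h8
      · rw [← Node.done_of_nil hq] at h8
        exact he.upTo t h5 h8 h7
      · have h9 := hM.range_of_par he.lt he.ne_root
        rw [he.par_eq] at h9
        exact absurd hi (h3 t h8 h6 (h7.mono h9.1 h9.2)).1
    · have := ((hM.node _ he.lt).nonroot he.ne_root).depth_eq
      rw [he.par_eq] at this
      omega

/-- Swings, new records and pushes below a node all need an active operation in it. A drained node
has none, and it gets none since its own queue tail is frozen, by induction from `c` downwards. -/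
theorem Under.rely {u : ℕ} (hu : Under sh.node c u) (hM : MemOK K H G sh)
    (hR : Rely K H G sh sh') (hr : Rebuild K H sh D v d c) (hV : Visit H G sh D v d c) :
    Under sh'.node c u ∧ (sh'.node u).st = (sh.node u).st ∧
      (sh'.node u).lastTs = (sh.node u).lastTs := by
  induction hu with
  | top =>
    have := hr.frozen hM hR hV
    exact ⟨.top, this.1, this.2⟩
  | down u e hu hi hq ih =>
    obtain ⟨h1, h2, h3⟩ := ih
    obtain ⟨h4, h5, -, -⟩ := hu.facts hM hr hV
    have he := hM.edge_of_under h4 h5 hi e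
    have hq' := hR.queue u h4 h3 hq
    have hch : (sh'.node u).child e = (sh.node u).child e := by
      by_contra hne
      obtain ⟨E, hE, -⟩ := hR.swing u h4 e hne
      exact hM.queue_ne_of_active hE hq
    refine ⟨?_, ?_, ?_⟩
    · rw [← hch]
      exact .down u e h1 ((hR.isInner h4).2 hi) hq'
    · by_contra hne
      obtain ⟨-, E, hE, -⟩ := hR.cas _ he.lt hne
      rw [he.par_eq] at hE
      exact hM.queue_ne_of_active hE hq
    · by_contra hne
      obtain ⟨-, E, hE, -⟩ := hR.push _ he.lt hne he.ne_root
      rw [he.par_eq] at hE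
      exact hM.queue_ne_of_active hE hq

theorem Under.queue_rely {u : ℕ} (hu : Under sh.node c u) (hM : MemOK K H G sh)
    (hR : Rely K H G sh sh') (hr : Rebuild K H sh D v d c) (hV : Visit H G sh D v d c)
    (hq : (sh.node u).queue = []) : (sh'.node u).queue = [] ∧
      ∀ e, (sh'.node u).child e = (sh.node u).child e := by
  have hf := (hu.facts hM hr hV).1
  refine ⟨hR.queue u hf (hu.rely hM hR hr hV).2.2 hq, fun e => ?_⟩
  by_contra hne
  obtain ⟨E, hE, -⟩ := hR.swing u hf e hne
  exact hM.queue_ne_of_active hE hq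

theorem PlaceOK.rely {pl : Place} (hp : PlaceOK sh.node c pl) (hM : MemOK K H G sh)
    (hR : Rely K H G sh sh') (hr : Rebuild K H sh D v d c) (hV : Visit H G sh D v d c) :
    PlaceOK sh'.node c pl := by
  cases pl with
  | node u => exact (Under.rely hp hM hR hr hV).1
  | edge u e =>
    obtain ⟨h1, h2, h3⟩ := hp
    exact ⟨(h1.rely hM hR hr hV).1, (hR.isInner (h1.facts hM hr hV).1).2 h2,
      (h1.queue_rely hM hR hr hV h3).1⟩

theorem Cov.rely {pl : Place} {pls : List Place} (hc : Cov sh.node pls pl)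
    (hp : PlaceOK sh.node c pl) (hM : MemOK K H G sh) (hR : Rely K H G sh sh')
    (hr : Rebuild K H sh D v d c) (hV : Visit H G sh D v d c) : Cov sh'.node pls pl := by
  induction hc with
  | mem pl h => exact .mem pl h
  | edge u e _ ih =>
    obtain ⟨h1, h2, h3⟩ := hp
    refine .edge u e ?_
    rw [(h1.queue_rely hM hR hr hV h3).2 e]
    exact ih (.down u e h1 h2 h3)
  | leaf u hl =>
    exact .leaf u fun h => hl ((hR.isInner (Under.facts hp hM hr hV).1).1 h)
  | inner u hq hcov ih =>
    by_cases hi : (sh.node u).body.IsInner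
    · exact .inner u (Under.queue_rely hp hM hR hr hV hq).1 fun e => ih e ⟨hp, hi, hq⟩
    · exact .leaf u fun h => hi ((hR.isInner (Under.facts hp hM hr hV).1).1 h)

theorem PlaceOK.lo_hi_rely {pl : Place} (hp : PlaceOK sh.node c pl) (hM : MemOK K H G sh)
    (hR : Rely K H G sh sh') (hr : Rebuild K H sh D v d c) (hV : Visit H G sh D v d c) :
    placeLo sh'.node pl = placeLo sh.node pl ∧ placeHi sh'.node pl = placeHi sh.node pl := by
  cases pl with
  | node u =>
    have := (Under.facts hp hM hr hV).1
    exact ⟨hR.lo u this, hR.hi u this⟩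
  | edge u e =>
    have := (Under.facts hp.1 hM hr hV).1
    simp only [placeLo, placeHi]
    rw [hR.childRange this]
    exact ⟨rfl, rfl⟩

theorem Contiguous.rely (hM : MemOK K H G sh)
    (hR : Rely K H G sh sh') (hr : Rebuild K H sh D v d c) (hV : Visit H G sh D v d c) :
    ∀ {pls : List Place} {a b : Bound α}, Contiguous sh.node pls a b →
      (∀ pl ∈ pls, PlaceOK sh.node c pl) → Contiguous sh'.node pls a b
  | [], _, _, h, _ => h
  | pl :: t, a, b, h, hp => by
    have h1 := (hp pl (by simp)).lo_hi_rely hM hR hr hV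
    refine ⟨by rw [h1.1]; exact h.1, ?_⟩
    rw [h1.2]
    exact Contiguous.rely hM hR hr hV h.2 fun pl hpl => hp pl (by simp [hpl])

/-- Noninterference: what a process knows about its current execution survives every step allowed by
`Rely`. The only assertion that may change form is that of a pending look at an inner child. -/
theorem Seg.rely {Rb : Finset ℕ} {fs : List (Frame α)} (hs : Seg K H G sh Rb D v fs)
    (hM : MemOK K H G sh) (hR : Rely K H G sh sh') (hS : Started H G sh D v) :
    Seg K H G sh' Rb D v fs := by
  cases hs with
  | exec todo acc ht hf => exact .exec todo acc (ht.rely hM hR hS) (hf.rely hR hS.lt)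
  | lookAdd d todo acc c ht hf => exact .lookAdd d todo acc c (ht.rely hM hR hS) (hf.rely hR hS.lt)
  | lookVisit d todo acc c ht hf hv hc hi hl =>
    refine .lookVisit d todo acc c (ht.rely hM hR hS) (hf.rely hR hS.lt) (hv.rely hR) hc ?_ ?_
    · intro h
      rcases hi ((hR.isInner hv.lt).1 h) with h | h
      · exact Or.inl (h.rely hM hR hv)
      · exact (h.rely_or hM hR hv).imp_left And.left
    · exact fun h => (hl fun h' => h ((hR.isInner hv.lt).2 h')).rely hM hR hv
  | pushTraverse d todo acc c s ht hf hv hh hn hs =>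
    exact .pushTraverse d todo acc c s (ht.rely hM hR hS) (hf.rely hR hS.lt) (hv.rely hR)
      (hh.rely hM hR hv hn) (hv.not_needs hR hn) (hv.casOK hR hs)
  | casState d todo acc c s ht hf hv hh hn hs =>
    exact .casState d todo acc c s (ht.rely hM hR hS) (hf.rely hR hS.lt) (hv.rely hR)
      (hh.rely hM hR hv hn) (hv.not_needs hR hn) (hv.casOK hR hs)
  | pushIf d todo acc c ht hf hv hh hm =>
    exact .pushIf d todo acc c (ht.rely hM hR hS) (hf.rely hR hS.lt) (hv.rely hR)
      (hh.rely hM hR hv fun h => absurd h.1 (not_lt.2 hm)) (hv.le_tsMod hR hm)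
  | popIf ht hf => exact .popIf (ht.rely hM hR hS) (hf.rely hR hS.lt)
  | leafBuild d todo acc c keys ht hf hv hl he hlt hk =>
    refine .leafBuild d todo acc c keys (ht.rely hM hR hS) (hf.rely hR hS.lt) (hv.rely hR)
      (hl.rely hM hR hv) he ?_ ?_
    · rw [hl.lastTs_eq hR hv]; exact hlt
    · rw [hR.childRange hS.lt]; exact hk
  | leafSwing d todo acc c nv ht hf hv hl he hlt hn =>
    refine .leafSwing d todo acc c nv (ht.rely hM hR hS) (hf.rely hR hS.lt) (hv.rely hR)
      (hl.rely hM hR hv) he ?_ (hn.rely hR)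
    rw [hl.lastTs_eq hR hv]; exact hlt
  | drain d todo acc c pls ht hf hv hr hp hc =>
    exact .drain d todo acc c pls (ht.rely hM hR hS) (hf.rely hR hS.lt) (hv.rely hR)
      (hr.rely hM hR hv) (fun pl hpl => (hp pl hpl).rely hM hR hr hv)
      (hc.rely .top hM hR hr hv)
  | collect d todo acc c pls keys pos ht hf hv hr hp hc hpos hcon hk =>
    refine .collect d todo acc c pls keys pos (ht.rely hM hR hS) (hf.rely hR hS.lt) (hv.rely hR)
      (hr.rely hM hR hv) (fun pl hpl => (hp pl hpl).rely hM hR hr hv)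
      (fun pl hpl => (hc pl hpl).rely (hp pl hpl) hM hR hr hv) ?_ ?_ ?_
    · rw [hR.lo c hv.lt]; exact hpos
    · rw [hR.hi c hv.lt]; exact hcon.rely hM hR hr hv hp
    · rw [hR.lo c hv.lt]; exact hk
  | build d todo acc c keys ht hf hv hr hk =>
    refine .build d todo acc c keys (ht.rely hM hR hS) (hf.rely hR hS.lt) (hv.rely hR)
      (hr.rely hM hR hv) ?_
    rw [hR.childRange hS.lt]; exact hk
  | swing d todo acc c nv ht hf hv hr hn =>
    exact .swing d todo acc c nv (ht.rely hM hR hS) (hf.rely hR hS.lt) (hv.rely hR)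
      (hr.rely hM hR hv) (hn.rely hR)

theorem StackOK.rely {Rb : Finset ℕ} {fs : List (Frame α)} {A : List (ℕ × ℕ)}
    {ini : Option (ℕ × Bool)} (hs : StackOK K H G sh Rb fs A ini)
    (hM : MemOK K H G sh) (hR : Rely K H G sh sh') : StackOK K H G sh' Rb fs A ini := by
  induction hs with
  | nil => exact .nil
  | enqRead op => exact .enqRead op
  | enqCas op t => exact .enqCas op t
  | traverse D => exact .traverse D
  | traversePop D => exact .traversePop D
  | execUntil D v => exact .execUntil D v
  | call E u fs B A ini hs hE hc hA _ ih =>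
    exact .call E u fs B A ini (hs.rely hM hR hE) (hE.rely hR) hc hA ih

end Frames

/-! ### Potentials paying for the cost of steps -/

section Potential

variable {α : Type u}

/-- A bound for the number of leaves of the subtree of a node. -/
def Node.weight (n : Node α) : ℕ :=
  match n.body with
  | .inner _ i => i + n.st.modCnt
  | _ => 1

/-- Cost of walking through the subtree of a place. -/
def placePot (nd : ℕ → Node α) : Place → ℕ
  -- If the weights of the children add up to at most `w`, then one step for the node and `4 w₁ - 2`
  -- and `4 w₂ - 2` for its edges cost at most `4 w - 3`; a leaf costs `1`.
  | .node u => 4 * (nd u).weight - 3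
  | .edge u e => 4 * (nd ((nd u).child e)).weight - 3 + 1

/-- Bound for the cost of a frame, other than the costs of executions in the nodes and of
rebuildings that it starts. -/
def Frame.pot (sh : Shared α) : Frame α → ℕ
  | .enqRead _ => 2
  -- If the tail has moved, the CAS fails and has to be followed by another read and CAS. So a
  -- change of the tail raises this potential by `2`.
  | .enqCas _ t => if (sh.node root).lastTs = t then 1 else 3
  | .traverse _ => 3
  | .traversePop _ => 1
  | .execUntil _ _ => 1
  -- The final `3` pays for recording the answer, for its later summation and for the pop. Each task
  -- pays `8`: reading the register, looking at the child, `4` for pushing it to the traversal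
  -- queue, the CAS and the push.
  | .exec _ _ todo _ => 3 + 8 * todo.length
  | .look _ _ _ _ todo _ _ => 10 + 8 * todo.length
  -- One step, and `3` deposited for the later visit of the node by the initiator.
  | .pushTraverse _ _ => 4
  | .casState _ _ _ => 1
  | .pushIf _ _ => 1
  | .popIf _ _ => 1
  -- The surplus over the walk pays for the second walk in `collect` and for building: one walk
  -- starts with `4 w - 3`, and an ideal tree with at most `w` keys has at most `2 w - 1` nodes.
  | .drain _ _ _ c todo => (todo.map (placePot sh.node)).sum + 6 * (sh.node c).weight + 1
  | .collect _ _ _ c todo _ => (todo.map (placePot sh.node)).sum + 2 * (sh.node c).weight + 3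
  | .build _ _ _ _ _ keys => 2 + (ideal keys).nodeCount
  | .swing _ _ _ _ => 1

/-- Potential of the control state of a process. -/
def stackPot (sh : Shared α) (fs : List (Frame α)) : ℕ :=
  (fs.map (Frame.pot sh)).sum

@[simp] theorem stackPot_nil (sh : Shared α) : stackPot sh [] = 0 := rfl

@[simp] theorem stackPot_cons (sh : Shared α) (f : Frame α) (fs : List (Frame α)) :
    stackPot sh (f :: fs) = f.pot sh + stackPot sh fs := by
  simp [stackPot]

@[simp] theorem stackPot_append (sh : Shared α) (fs gs : List (Frame α)) :
    stackPot sh (fs ++ gs) = stackPot sh fs + stackPot sh gs := by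
  simp [stackPot]

/-- Potential of the mutable part of a descriptor. -/
def Progress.pot (p : Progress) : ℕ :=
  -- A node in the traversal queue pays for being taken, for leaving `execUntil` and for being
  -- popped. A partial answer pays for the final summation and is released when the result is set.
  3 * p.traverse.length + if p.result = none then p.processed.length else 0

/-- Potential of the mutable parts of all descriptors. -/
def progPot (sh : Shared α) : ℕ :=
  ∑ t ∈ Finset.range ((sh.node root).lastTs + 1), (sh.prog t).pot

theorem progPot_congr {sh sh' : Shared α} (hp : sh'.prog = sh.prog)
    (hr : (sh'.node root).lastTs = (sh.node root).lastTs) : progPot sh' = progPot sh := by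
  unfold progPot
  rw [hp, hr]

theorem progPot_modify_le (sh : Shared α) (t : ℕ) (f : Progress → Progress) {k : ℕ}
    (hf : (f (sh.prog t)).pot ≤ (sh.prog t).pot + k) :
    progPot (sh.modifyProg t f) ≤ progPot sh + k := by
  unfold progPot Shared.modifyProg
  simp only
  by_cases ht : t ∈ Finset.range ((sh.node root).lastTs + 1)
  · rw [← Finset.add_sum_erase _ _ ht, ← Finset.add_sum_erase _ _ ht, Function.update_self]
    rw [Finset.sum_congr rfl fun x hx => by rw [Function.update_of_ne (Finset.ne_of_mem_erase hx)]]
    omega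
  · rw [Finset.sum_congr rfl fun x hx => by rw [Function.update_of_ne (by rintro rfl; exact ht hx)]]
    omega

theorem progPot_modify_add_le (sh : Shared α) {t : ℕ} (f : Progress → Progress) {k : ℕ}
    (ht : t ≤ (sh.node root).lastTs) (hf : (f (sh.prog t)).pot + k ≤ (sh.prog t).pot) :
    progPot (sh.modifyProg t f) + k ≤ progPot sh := by
  unfold progPot Shared.modifyProg
  simp only
  have ht' : t ∈ Finset.range ((sh.node root).lastTs + 1) := Finset.mem_range.2 (by omega)
  rw [← Finset.add_sum_erase _ _ ht', ← Finset.add_sum_erase _ _ ht', Function.update_self]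
  rw [Finset.sum_congr rfl fun x hx => by rw [Function.update_of_ne (Finset.ne_of_mem_erase hx)]]
  omega

theorem Node.weight_congr {n n' : Node α} (hb : n'.body = n.body) (hs : n'.st = n.st) :
    n'.weight = n.weight := by
  unfold Node.weight
  rw [hb, hs]

theorem Node.weight_leaf {n : Node α} (h : ¬ n.body.IsInner) : n.weight = 1 := by
  unfold Node.weight
  cases hb : n.body with
  | inner r i => rw [hb] at h; exact absurd trivial h
  | _ => rfl

theorem Node.weight_inner {n : Node α} (h : n.body.IsInner) :
    n.weight = n.body.initSz + n.st.modCnt := by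
  unfold Node.weight
  obtain ⟨r, i, hb⟩ := Body.isInner_iff.1 h
  rw [hb]
  rfl

variable [LinearOrder α] {K : ℝ} {H : ℕ → Op α} {G : ℕ → Ghost} {sh sh' : Shared α} {D : Desc α}
  {v c : ℕ} {d : Dir}

theorem MemOK.weight_pos (h : MemOK K H G sh) (hc : c < sh.next) (hr : c ≠ root) :
    1 ≤ (sh.node c).weight := by
  by_cases hi : (sh.node c).body.IsInner
  · rw [Node.weight_inner hi]
    have := (((h.node c hc).nonroot hr).inner hi).half .left
    omega
  · rw [Node.weight_leaf hi]

/-- The weight of a child, in terms of the parent. -/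
theorem MemOK.weight_le (h : MemOK K H G sh) (hc : c < sh.next) (hr : c ≠ root)
    (hp : (G c).par ≠ root) :
    (sh.node c).weight ≤ (keysIn (contents H (G (G c).par).birth) (sh.node c).lo
      (sh.node c).hi).card + mods H (G (G c).par).birth (sh.node (G c).par).st.tsMod
        (sh.node c).lo (sh.node c).hi := by
  have hn := (h.node c hc).nonroot hr
  have hpn := (h.node _ hn.par_lt).nonroot hp
  by_cases hi : (sh.node c).body.IsInner
  · have hin := hn.inner hi
    rw [Node.weight_inner hi, hin.init, hin.mod]
    have h1 := (card_keysIn_le (H := H) (lo := (sh.node c).lo) (hi := (sh.node c).hi)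
      hn.birth_par).1
    have h2 : (G c).birth ≤ (sh.node c).st.tsMod :=
      (h.node c hc).birth_le.trans hn.lastTs_le_tsMod
    have h3 := mods_add (H := H) (lo := (sh.node c).lo) (hi := (sh.node c).hi) hn.birth_par h2
    -- The record of a child is not newer than that of its parent, because an operation enters the
    -- record of the parent before its queue and the record of the child only afterwards.
    have h4 := mods_mono (H := H) (lo := (sh.node c).lo) (hi := (sh.node c).hi)
      (a := (G (G c).par).birth) (hn.tsMod_le.trans hpn.lastTs_le_tsMod)
    omega
  · rw [Node.weight_leaf hi, hn.lo_eq, hn.hi_eq]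
    exact ((hpn.inner hn.par_inner).half _).1.trans (Nat.le_add_right _ _)

/-- Counted from the birth of the parent, keys and modifications both split at the router. Hence
walks through a subtree cost at most a multiple of the weight of its root, whatever rebuildings took
place inside. -/
theorem MemOK.weight_children (h : MemOK K H G sh) (hv : v < sh.next) (hr : v ≠ root)
    (hi : (sh.node v).body.IsInner) :
    (sh.node ((sh.node v).child .left)).weight + (sh.node ((sh.node v).child .right)).weight ≤
      (sh.node v).weight := by
  have e1 := h.edge_of_under hv hr hi .left
  have e2 := h.edge_of_under hv hr hi .right
  have w1 := h.weight_le e1.lt e1.ne_root (by rw [e1.par_eq]; exact hr)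
  have w2 := h.weight_le e2.lt e2.ne_root (by rw [e2.par_eq]; exact hr)
  have l1 := ((h.node _ e1.lt).nonroot e1.ne_root).lo_eq
  have l2 := ((h.node _ e1.lt).nonroot e1.ne_root).hi_eq
  have r1 := ((h.node _ e2.lt).nonroot e2.ne_root).lo_eq
  have r2 := ((h.node _ e2.lt).nonroot e2.ne_root).hi_eq
  rw [e1.par_eq, e1.dir_eq] at l1 l2
  rw [e2.par_eq, e2.dir_eq] at r1 r2
  rw [e1.par_eq, l1, l2] at w1
  rw [e2.par_eq, r1, r2] at w2
  have hin := ((h.node v hv).nonroot hr).inner hi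
  have hrg := (h.node v hv).range hi
  obtain ⟨r, i, hb⟩ := Body.isInner_iff.1 hi
  have c1 : (sh.node v).childRange .left = ((sh.node v).lo, r) := by simp [Node.childRange, hb]
  have c2 : (sh.node v).childRange .right = (r, (sh.node v).hi) := by simp [Node.childRange, hb]
  have b1 : (sh.node v).lo ≤ r := by have := (hrg .right).1; rwa [c2] at this
  have b2 : r ≤ (sh.node v).hi := by have := (hrg .left).2; rwa [c1] at this
  rw [c1] at w1
  rw [c2] at w2
  rw [Node.weight_inner hi, hin.init, hin.mod]
  have k1 := keysIn_split (contents H (G v).birth) b1 b2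
  have k2 := mods_split_le (H := H) (G v).birth (sh.node v).st.tsMod b1 b2
  simp only at w1 w2
  omega

theorem Rebuild.weight_rely (hr : Rebuild K H sh D v d c) (hM : MemOK K H G sh)
    (hR : Rely K H G sh sh') (hV : Visit H G sh D v d c) :
    (sh'.node c).weight = (sh.node c).weight :=
  Node.weight_congr (hR.body c hV.lt) (hr.frozen hM hR hV).1

theorem PlaceOK.pot_rely {pl : Place} (hp : PlaceOK sh.node c pl) (hM : MemOK K H G sh)
    (hR : Rely K H G sh sh') (hr : Rebuild K H sh D v d c) (hV : Visit H G sh D v d c) :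
    placePot sh'.node pl = placePot sh.node pl := by
  have key : ∀ u, Under sh.node c u → (sh'.node u).weight = (sh.node u).weight := fun u hu =>
    Node.weight_congr (hR.body u (hu.facts hM hr hV).1) (hu.rely hM hR hr hV).2.1
  cases pl with
  | node u =>
    simp only [placePot]
    rw [key u hp]
  | edge u e =>
    obtain ⟨h1, h2, h3⟩ := hp
    simp only [placePot]
    rw [(h1.queue_rely hM hR hr hV h3).2 e, key _ (.down u e h1 h2 h3)]

theorem Seg.pot_rely {Rb : Finset ℕ} {fs : List (Frame α)} (hs : Seg K H G sh Rb D v fs)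
    (hM : MemOK K H G sh) (hR : Rely K H G sh sh') : stackPot sh' fs = stackPot sh fs := by
  cases hs with
  | drain d todo acc c pls ht hf hv hr hp hc =>
    simp only [stackPot_cons, stackPot_nil, Frame.pot]
    rw [hr.weight_rely hM hR hv, List.map_congr_left fun pl hpl =>
      (hp pl hpl).pot_rely hM hR hr hv]
  | collect d todo acc c pls keys pos ht hf hv hr hp hc hpos hcon hk =>
    simp only [stackPot_cons, stackPot_nil, Frame.pot]
    rw [hr.weight_rely hM hR hv, List.map_congr_left fun pl hpl =>
      (hp pl hpl).pot_rely hM hR hr hv]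
  | _ => rfl

/-- The only potential that other processes can raise is that of a pending CAS on the root queue, by
`2`, and only when a new timestamp is given. The potentials of walks are constant since rebuilt
subtrees are frozen. -/
theorem StackOK.pot_rely {Rb : Finset ℕ} {fs : List (Frame α)} {A : List (ℕ × ℕ)}
    {ini : Option (ℕ × Bool)} (hs : StackOK K H G sh Rb fs A ini)
    (hM : MemOK K H G sh) (hR : Rely K H G sh sh') :
    stackPot sh' fs ≤
      stackPot sh fs + 2 * ((sh'.node root).lastTs - (sh.node root).lastTs) := by
  induction hs with
  | enqCas op t =>
    simp only [stackPot_cons, stackPot_nil, Frame.pot]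
    have := hR.lastTs_le root hM.root_lt
    split_ifs <;> omega
  | call E u fs B A ini hs hE hc hA _ ih =>
    rw [stackPot_append, stackPot_append, hs.pot_rely hM hR]
    omega
  | _ => exact Nat.le_add_right _ _

theorem MemOK.congr (h : MemOK K H G sh) (hnode : sh'.node = sh.node) (hnext : sh'.next = sh.next)
    (hkeys : sh'.keys = sh.keys) (hvis : sh'.visits = sh.visits) : MemOK K H G sh' where
  root_lt := by rw [hnext]; exact h.root_lt
  root_body := by rw [hnode]; exact h.root_body
  root_lo := by rw [hnode]; exact h.root_lo
  root_hi := by rw [hnode]; exact h.root_hi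
  root_birth := h.root_birth
  root_depth := h.root_depth
  node := by rw [hnode, hnext]; exact h.node
  edge := by rw [hnode, hnext]; exact h.edge
  queue_nil := by rw [hnode, hnext]; exact h.queue_nil
  keys := by rw [hnode, hkeys]; exact h.keys
  visits := by rw [hnode, hnext, hvis]; exact h.visits

end Potential

/-! ### Single steps of the execution of an operation in a node -/

section SegStep

variable {α : Type u}

/-- Operations are not resumed, and queues of nodes to be visited do not run empty. -/
def Progresses (sh sh' : Shared α) : Prop :=
  ∀ t, ((sh.prog t).result = none → (sh'.prog t).result = none) ∧
    ((sh.prog t).traverse ≠ [] → (sh'.prog t).traverse ≠ [])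

theorem Progresses.of_eq {sh sh' : Shared α} (h : sh'.prog = sh.prog) : Progresses sh sh' :=
  fun t => by rw [h]; exact ⟨id, id⟩

theorem swing_root {sh : Shared α} (v : ℕ) (d : Dir) (nv : ℕ) :
    ((sh.modifyNode v fun n => n.setChild d nv).node root).lastTs = (sh.node root).lastTs := by
  simp only [Shared.modifyNode]
  rcases eq_or_ne root v with hr | hr
  · rw [← hr, Function.update_self, Node.setChild_lastTs]
  · rw [Function.update_of_ne hr]

theorem swing_child {sh : Shared α} (v : ℕ) (d : Dir) (nv : ℕ) :
    ((sh.modifyNode v fun n => n.setChild d nv).node v).child d = nv := by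
  simp only [Shared.modifyNode]
  rw [Function.update_self, Node.child_setChild_self]

theorem Fresh.finish {G : ℕ → Ghost} {sh : Shared α} {Rb : Finset ℕ} {v c : ℕ} {d : Dir}
    (hf : Fresh G sh Rb v fun x => x = c) (hd : (G c).dir = d)
    (hlt : c < (sh.node v).child d) : Fresh G sh Rb v fun _ => False := by
  intro x hx hp
  rcases hf x hx hp with h1 | h1
  · subst h1
    rw [hd]
    exact Or.inr hlt
  · exact Or.inr h1

variable [LinearOrder α]

/-- What a step of the execution of `D` in `v` achieves. -/
structure SegResult (K : ℝ) (H : ℕ → Op α) (G : ℕ → Ghost) (sh : Shared α) (Rb : Finset ℕ)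
    (D : Desc α) (v : ℕ) (old : List (Frame α)) (sh' : Shared α) (new : List (Frame α))
    (cost : ℕ) : Prop where
  mem : MemOK K H G sh'
  rely : Rely K H G sh sh'
  prog : Progresses sh sh'
  root_eq : (sh'.node root).lastTs = (sh.node root).lastTs
  -- Either the execution goes on, possibly with a newly started rebuilding that brings a credit of
  -- `10` times the weight, or it ends with `D` finished in `v` and all nodes rebuilt below `v` out
  -- of their registers.
  out : (∃ Rb' : Finset ℕ, (Rb' = Rb ∨ ∃ c d, c ∉ Rb ∧ Rb' = insert c Rb ∧ Visit H G sh' D v d c ∧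
          Rebuild K H sh' D v d c) ∧ Seg K H G sh' Rb' D v new ∧
        cost + stackPot sh' new + progPot sh' + 10 * ∑ c ∈ Rb, (sh'.node c).weight ≤
          stackPot sh old + progPot sh + 10 * ∑ c ∈ Rb', (sh'.node c).weight) ∨
      (new = [] ∧ D.ts ≤ (sh'.node v).done ∧ Fresh G sh' Rb v (fun _ => False) ∧
        cost + progPot sh' ≤ stackPot sh old + progPot sh)

variable {K : ℝ} {H : ℕ → Op α} {G : ℕ → Ghost} {sh sh' : Shared α} {D : Desc α} {v c : ℕ}
  {d : Dir} {Rb : Finset ℕ} {old new : List (Frame α)} {cost : ℕ}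

theorem SegResult.of_seg (hM : MemOK K H G sh') (hR : Rely K H G sh sh')
    (hP : Progresses sh sh') (hroot : (sh'.node root).lastTs = (sh.node root).lastTs)
    (hs : Seg K H G sh' Rb D v new)
    (hc : cost + stackPot sh' new + progPot sh' ≤ stackPot sh old + progPot sh) :
    SegResult K H G sh Rb D v old sh' new cost :=
  ⟨hM, hR, hP, hroot, Or.inl ⟨Rb, Or.inl rfl, hs, by omega⟩⟩

/-- A step that does not change the memory. -/
theorem SegResult.silent (hM : MemOK K H G sh) (hs : Seg K H G sh Rb D v new)
    (hc : cost + stackPot sh new ≤ stackPot sh old) :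
    SegResult K H G sh Rb D v old sh new cost :=
  .of_seg hM (.of_eq rfl fun _ _ => rfl) (.of_eq rfl) rfl hs (by omega)

/-- A step that changes only the mutable part of a descriptor. -/
theorem SegResult.prog_only (hM : MemOK K H G sh) (hS : Started H G sh D v)
    (hs : Seg K H G sh Rb D v new) (t : ℕ) (f : Progress → Progress) (k : ℕ)
    (hf : (f (sh.prog t)).pot ≤ (sh.prog t).pot + k)
    (hres : (f (sh.prog t)).result = (sh.prog t).result)
    (htr : (sh.prog t).traverse ≠ [] → (f (sh.prog t)).traverse ≠ [])
    (hc : cost + stackPot sh new + k ≤ stackPot sh old) :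
    SegResult K H G sh Rb D v old (sh.modifyProg t f) new cost := by
  have hR : Rely K H G sh (sh.modifyProg t f) := .of_eq rfl fun _ _ => rfl
  refine .of_seg (hM.congr rfl rfl rfl rfl) hR ?_ rfl (hs.rely hM hR hS) ?_
  · intro t'
    unfold Shared.modifyProg
    simp only
    rcases eq_or_ne t' t with rfl | h
    · rw [Function.update_self, hres]
      exact ⟨id, htr⟩
    · rw [Function.update_of_ne h]
      exact ⟨id, id⟩
  · have := progPot_modify_le sh t f hf
    rw [hs.pot_rely hM hR]
    omega

theorem Todo.tail {a : Act} {todo : List (Dir × Act)} (h : Todo sh D v ((d, a) :: todo) fun _ => False) :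
    Todo sh D v todo fun e => e = d where
  task e he := h.task e (List.mem_cons_of_mem _ he)
  cover e he := by
    rcases h.cover e he with h1 | h1 | h1
    · rcases List.mem_cons.1 h1 with h2 | h2
      · exact Or.inr (Or.inl (Prod.mk.inj h2).1)
      · exact Or.inl h2
    · exact h1.elim
    · exact Or.inr (Or.inr h1)

theorem Todo.cons {todo : List (Dir × Act)} (h : Todo sh D v todo fun e => e = d)
    (ht : (sh.node v).Task D.op d) : Todo sh D v ((d, .visit) :: todo) fun _ => False where
  task e he := by
    rcases List.mem_cons.1 he with h2 | h2
    · rw [(Prod.mk.inj h2).1]; exact ht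
    · exact h.task e h2
  cover e he := by
    rcases h.cover e he with h1 | h1 | h1
    · exact Or.inl (List.mem_cons_of_mem _ h1)
    · rw [h1]; exact Or.inl (by simp)
    · exact Or.inr (Or.inr h1)

theorem Todo.finish {todo : List (Dir × Act)} (h : Todo sh D v todo fun e => e = d)
    (hc : Compl sh D v d) : Todo sh D v todo fun _ => False where
  task := h.task
  cover e he := by
    rcases h.cover e he with h1 | h1 | h1
    · exact Or.inl h1
    · rw [h1]; exact Or.inr (Or.inr hc)
    · exact Or.inr (Or.inr h1)

theorem seg_exec_nil (hM : MemOK K H G sh) (hS : Started H G sh D v) {acc : ℕ}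
    (ht : Todo sh D v [] fun _ => False) (hf : Fresh G sh Rb v fun _ => False) :
    SegResult K H G sh Rb D v [.exec D v [] acc] (sh.tryInsert D.ts v acc) [.popIf D v] 1 := by
  refine .prog_only hM hS (.popIf ht hf) D.ts _ 1 ?_ ?_ ?_ ?_
  · split_ifs
    · omega
    · unfold Progress.pot
      simp only [List.length_cons]
      split_ifs <;> omega
  · split_ifs <;> rfl
  · split_ifs <;> exact id
  · simp [Frame.pot]

theorem seg_exec_cons (hM : MemOK K H G sh) (hS : Started H G sh D v) {a : Act}
    {todo : List (Dir × Act)} {acc : ℕ}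
    (ht : Todo sh D v ((d, a) :: todo) fun _ => False) (hf : Fresh G sh Rb v fun _ => False) :
    SegResult K H G sh Rb D v [.exec D v ((d, a) :: todo) acc] sh
      [.look D v d a todo acc ((sh.node v).child d)] 1 := by
  refine .silent hM ?_ ?_
  · cases a with
    | add =>
      refine .lookAdd d todo acc _ ⟨fun e he => ht.task e (List.mem_cons_of_mem _ he), ?_⟩ hf
      intro e he
      rcases ht.cover e he with h1 | h1
      · rcases List.mem_cons.1 h1 with h2 | h2
        · exact absurd (Prod.mk.inj h2).2 (by simp)
        · exact Or.inl h2
      · exact Or.inr h1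
    | visit =>
      have htask := ht.task d (by simp)
      have he := hM.edge v hS.lt hS.inner d (hM.task_left htask)
      have hvis : (H D.ts).Visits (sh.node ((sh.node v).child d)).lo
          (sh.node ((sh.node v).child d)).hi := by
        rw [← hM.task_iff he.lt he.ne_root, he.par_eq, he.dir_eq, ← hS.op_eq]
        exact htask
      refine .lookVisit d todo acc _ ht.tail hf
        ⟨hS, htask, he.lt, he.ne_root, he.par_eq, he.dir_eq, le_rfl⟩ ?_ ?_ ?_
      · intro hc
        -- Nodes that this process has rebuilt lie strictly below the content of their register, so
        -- the node just read is not one of them.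
        rcases hf _ hc he.par_eq with h1 | h1
        · exact h1
        · rw [he.dir_eq] at h1
          exact lt_irrefl _ h1
      · intro hi
        refine Or.inr ⟨hi, fun _ => rfl, fun h1 => ?_⟩
        by_contra h2
        exact (he.upTo D.ts (not_le.1 h2) h1 hvis).1 hi
      · intro hi
        refine ⟨hi, ?_, ?_, fun _ => Or.inl rfl⟩
        · intro t h1 h2
          have := hS.le_done
          exact he.upTo t h1 (by omega)
        · intro h1 _ h3
          by_contra h2
          have := (he.upTo D.ts (not_le.1 h2) h1 hvis).2
          rw [← hS.desc, h3] at this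
          cases this
  · simp only [stackPot_cons, stackPot_nil, Frame.pot, List.length_cons]
    omega

theorem step_casState {s : NodeState} : step K sh (.casState D c s) =
    if s.tsMod < D.ts ∧ (sh.node c).st = s then
      (sh.modifyNode c (fun n => { n with st := D.newState s }), [], 1)
    else (sh, [], 1) := by
  rfl

theorem step_swing {nv : ℕ} : step K sh (.swing v d c nv) =
    if (sh.node v).child d = c then (sh.modifyNode v (fun n => n.setChild d nv), [], 1)
    else (sh, [], 1) := by
  rfl

theorem visitChild_inner {todo : List (Dir × Act)} {acc : ℕ}
    (hi : (sh.node c).body.IsInner) [Decidable (Needs K D (sh.node c))] :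
    visitChild K sh D v d todo acc c = if Needs K D (sh.node c) then
      [.drain D v d c [.node c], .exec D v ((d, .visit) :: todo) acc]
    else
      [.pushTraverse D c, .casState D c (sh.node c).st, .pushIf D c, .exec D v todo acc] := by
  obtain ⟨r, i, hb⟩ := Body.isInner_iff.1 hi
  unfold visitChild Needs
  simp only [hb, Body.initSz]

theorem visitChild_leaf {todo : List (Dir × Act)} {acc : ℕ}
    (hi : ¬ (sh.node c).body.IsInner) :
    visitChild K sh D v d todo acc c = if D.eff = true ∧ (sh.node c).st.tsMod < D.ts then
      [.build D v d c D.ts (D.op.applyList (sh.node c).body.keys),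
        .exec D v todo (acc + D.op.answer (sh.node c).body.keys)]
    else
      [.exec D v todo (acc + D.op.answer (sh.node c).body.keys)] := by
  unfold visitChild
  cases hb : (sh.node c).body with
  | inner r i => rw [hb] at hi; exact absurd trivial hi
  | _ => simp only [hb]

/-- A rebuilding found necessary here cannot be a repeated one, because `c ∉ Rb`; it is charged to
the new member of `Rb`. All other outcomes are paid by the look itself. -/
theorem seg_look_visit (hM : MemOK K H G sh) (hS : Started H G sh D v)
    {todo : List (Dir × Act)} {acc : ℕ}
    (ht : Todo sh D v todo fun e => e = d)
    (hf : Fresh G sh Rb v fun _ => False) (hv : Visit H G sh D v d c) (hc : c ∉ Rb)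
    (hi : (sh.node c).body.IsInner → Rebuild K H sh D v d c ∨ Hand sh D v d c)
    (hl : ¬ (sh.node c).body.IsInner → LeafTask H sh D v d c) :
    SegResult K H G sh Rb D v [.look D v d .visit todo acc c] sh
      (visitChild K sh D v d todo acc c) 1 := by
  classical
  by_cases hin : (sh.node c).body.IsInner
  · rw [visitChild_inner hin]
    have hle := hM.lastTs_le_tsMod hv.lt hv.ne_root
    have hw := hM.weight_pos hv.lt hv.ne_root
    split_ifs with hn
    · have hr : Rebuild K H sh D v d c := by
        rcases hi hin with h1 | h1
        · exact h1
        -- Were `D` finished in `v`, then `c` would have received it, and its record would not be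
        -- older than `D`.
        · have h2 : (sh.node v).done < D.ts := by
            by_contra h2
            have := h1.old (not_lt.1 h2)
            have := hn.1
            omega
          have he := hM.edge v hS.lt hS.inner d (hM.task_left hv.task)
          have h3 := he.upTo
          rw [h1.cur h2] at h3
          have := hS.le_done
          exact ⟨hin, hn, fun t h4 h5 => h3 t h4 (by omega), fun _ => h2⟩
      refine ⟨hM, .of_eq rfl fun _ _ => rfl, .of_eq rfl, rfl, Or.inl ⟨insert c Rb, ?_, ?_, ?_⟩⟩
      · exact Or.inr ⟨c, d, hc, rfl, hv, hr⟩
      · refine .drain d todo acc c _ (ht.cons hv.task) ?_ hv hr ?_ (.mem _ (by simp))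
        · intro x hx hpx
          rcases Finset.mem_insert.1 hx with h1 | h1
          · exact Or.inl h1
          · exact (hf x h1 hpx).imp_left False.elim
        · intro pl hpl
          rw [List.mem_singleton] at hpl
          rw [hpl]
          exact Under.top
      · rw [Finset.sum_insert hc]
        simp only [stackPot_cons, stackPot_nil, Frame.pot, List.length_cons, List.map_cons,
          List.map_nil, List.sum_cons, List.sum_nil, placePot]
        omega
    · have hh : Hand sh D v d c := (hi hin).resolve_left fun h => hn h.needs
      refine .silent hM (.pushTraverse d todo acc c _ ht hf hv hh hn fun _ _ => rfl) ?_
      simp only [stackPot_cons, stackPot_nil, Frame.pot]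
      omega
  · rw [visitChild_leaf hin]
    have hlt := hl hin
    have hn := hM.node c hv.lt
    obtain ⟨l1, l2, l3, l4⟩ := hn.leaf hin
    have hm := hn.nonroot hv.ne_root
    have hlo := hm.lo_eq
    have hhi := hm.hi_eq
    rw [hv.par_eq, hv.dir_eq] at hlo hhi
    split_ifs with hb
    · have hlast : (sh.node c).lastTs < D.ts := by omega
      have hM' : Modifies H (sh.node c).lo (sh.node c).hi D.ts := by
        refine ⟨by rw [← hS.desc]; exact hb.1, ?_⟩
        rw [← hM.task_iff hv.lt hv.ne_root, hv.par_eq, hv.dir_eq, ← hS.op_eq]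
        exact hv.task
      have hkeys : keysIn (contents H (D.ts - 1)) (sh.node c).lo (sh.node c).hi =
          keysIn (contents H (G c).birth) (sh.node c).lo (sh.node c).hi := by
        refine keysIn_eq_of_not_modifies (by omega) fun t h1 h2 h3 => ?_
        have := (hlt.upTo t (by omega) h2 h3.2).2
        rw [h3.1] at this
        cases this
      obtain ⟨a1, a2⟩ := applyList_isList (Body.length_keys_le _) hM' fun x => by
        rw [l4, hkeys]
      refine .silent hM (.leafBuild d todo _ c _ ht hf hv hlt hb.1 hlast ?_) ?_
      · rw [← hlo, ← hhi, hS.op_eq]; exact a1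
      -- An updated leaf has at most two keys, so the new tree has at most three nodes, and the
      -- potential of the look suffices.
      · have := (ideal_count _ (D.op.applyList (sh.node c).body.keys) le_rfl).2
        rw [hS.op_eq] at this
        simp only [stackPot_cons, stackPot_nil, Frame.pot]
        rw [hS.op_eq]
        omega
    · refine .silent hM (.exec todo _ (ht.finish fun h1 => ?_) hf) ?_
      · rcases hlt.cur h1 with h2 | h2
        · rw [h2]
          cases he : D.eff with
          | false => exact Or.inl ⟨hin, he⟩
          | true =>
            refine Or.inr ?_
            have : ¬ (sh.node c).st.tsMod < D.ts := fun h => hb ⟨he, h⟩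
            omega
        · exact h2
      · simp only [stackPot_cons, stackPot_nil, Frame.pot]
        omega

theorem seg_pushTraverse (hM : MemOK K H G sh) (hS : Started H G sh D v)
    {todo : List (Dir × Act)} {acc : ℕ} {s : NodeState} (ht : Todo sh D v todo fun e => e = d)
    (hf : Fresh G sh Rb v fun _ => False) (hv : Visit H G sh D v d c) (hh : Hand sh D v d c)
    (hn : ¬ Needs K D (sh.node c)) (hs : CasOK sh D v c s) :
    SegResult K H G sh Rb D v
      [.pushTraverse D c, .casState D c s, .pushIf D c, .exec D v todo acc]
      (sh.modifyProg D.ts (fun p => { p with traverse := p.traverse ++ [c] }))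
      [.casState D c s, .pushIf D c, .exec D v todo acc] 1 := by
  refine .prog_only hM hS (.casState d todo acc c s ht hf hv hh hn hs) D.ts _ 3 ?_ rfl ?_ ?_
  · unfold Progress.pot
    simp only [List.length_append, List.length_singleton]
    split_ifs <;> omega
  · simp
  · simp only [stackPot_cons, stackPot_nil, Frame.pot]
    omega

theorem seg_casState (hM : MemOK K H G sh) (hS : Started H G sh D v)
    {todo : List (Dir × Act)} {acc : ℕ} {s : NodeState} (ht : Todo sh D v todo fun e => e = d)
    (hf : Fresh G sh Rb v fun _ => False) (hv : Visit H G sh D v d c) (hh : Hand sh D v d c)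
    (hn : ¬ Needs K D (sh.node c)) (hs : CasOK sh D v c s) :
    SegResult K H G sh Rb D v [.casState D c s, .pushIf D c, .exec D v todo acc]
      (step K sh (.casState D c s)).1 ((step K sh (.casState D c s)).2.1 ++
        [.pushIf D c, .exec D v todo acc]) (step K sh (.casState D c s)).2.2 := by
  have hle := hM.lastTs_le_tsMod hv.lt hv.ne_root
  rw [step_casState]
  split_ifs with hb
  · obtain ⟨h1, h2⟩ := hb
    -- A CAS that succeeds belongs to an operation still active in `v`: otherwise `c` already has
    -- `D` in its queue and a record at least as new.
    have hact : (sh.node v).done < D.ts := by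
      by_contra h3
      have := hh.old (not_lt.1 h3)
      rw [h2] at hle
      omega
    have hmr := hM.casState (sh' := sh.modifyNode c fun n => { n with st := D.newState s })
      hv.lt hv.ne_root hh.inner (by rw [hv.par_eq]; exact hS.active hact)
      (by rw [hv.par_eq, hv.dir_eq]; exact hh.cur hact)
      (by rw [← hM.task_iff hv.lt hv.ne_root, hv.par_eq, hv.dir_eq, ← hS.op_eq]; exact hv.task)
      (by rw [h2]; exact h1) hn (by rw [h2]; rfl) rfl rfl rfl
    obtain ⟨hM', hR⟩ := hmr
    have hroot : ((sh.modifyNode c fun n => { n with st := D.newState s }).node root).lastTs =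
        (sh.node root).lastTs := by
      simp only [Shared.modifyNode]
      rw [Function.update_of_ne hv.ne_root.symm]
    refine .of_seg hM' hR (.of_eq rfl) hroot
      (.pushIf d todo acc c (ht.rely hM hR hS) (hf.rely hR hS.lt) (hv.rely hR)
        (hh.rely hM hR hv hn) ?_) ?_
    · simp [Shared.modifyNode]
    · have := progPot_congr (sh := sh) (sh' := sh.modifyNode c fun n => { n with st := D.newState s }) rfl hroot
      simp only [List.nil_append, stackPot_cons, stackPot_nil, Frame.pot]
      omega
  · simp only [List.nil_append]
    -- A CAS that fails shows that `D` is already in the record, for by `CasOK` the record of an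
    -- active operation that is not yet applied is still the one read.
    by_cases h3 : D.ts ≤ (sh.node c).st.tsMod
    · refine .silent hM (.pushIf d todo acc c ht hf hv hh h3) ?_
      simp only [stackPot_cons, stackPot_nil, Frame.pot]
      omega
    · exfalso
      have hact : (sh.node v).done < D.ts := by
        by_contra h4
        have := hh.old (not_lt.1 h4)
        omega
      have h5 := hs hact (not_le.1 h3)
      exact hb ⟨by rw [← h5]; exact not_le.1 h3, h5⟩

theorem seg_pushIf (hM : MemOK K H G sh) (hS : Started H G sh D v)
    {todo : List (Dir × Act)} {acc : ℕ} (ht : Todo sh D v todo fun e => e = d)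
    (hf : Fresh G sh Rb v fun _ => False) (hv : Visit H G sh D v d c) (hh : Hand sh D v d c)
    (hm : D.ts ≤ (sh.node c).st.tsMod) :
    SegResult K H G sh Rb D v [.pushIf D c, .exec D v todo acc] (sh.pushIf c D)
      [.exec D v todo acc] 1 := by
  unfold Shared.pushIf
  split_ifs with hlt
  · have hact : (sh.node v).done < D.ts := by
      by_contra h3
      have := hh.old (not_lt.1 h3)
      omega
    have hvis : (H D.ts).Visits (sh.node c).lo (sh.node c).hi := by
      rw [← hM.task_iff hv.lt hv.ne_root, hv.par_eq, hv.dir_eq, ← hS.op_eq]; exact hv.task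
    have hroot : ((sh.push c D).node root).lastTs = (sh.node root).lastTs := by
      simp only [Shared.push, Shared.modifyNode]
      rw [Function.update_of_ne hv.ne_root.symm]
    obtain ⟨hM', hR⟩ := hM.insert (sh' := sh.push c D) hv.lt hh.inner rfl rfl rfl hS.desc hlt hvis
      (fun t h1 h2 h3 => by
        have he := hM.edge v hS.lt hS.inner d (hM.task_left hv.task)
        have h4 := he.upTo
        rw [hh.cur hact] at h4
        have := hS.le_done
        exact (h4 t h1 (by omega) h3).1 hh.inner)
      (fun _ => ⟨hm, by rw [hv.par_eq]; exact hS.active hact,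
        by rw [hv.par_eq, hv.dir_eq]; exact hh.cur hact⟩)
      (by rw [hroot]; exact hM.keys)
    have hlast : ((sh.push c D).node c).lastTs = D.ts := by
      simp [Shared.push, Shared.modifyNode]
    refine .of_seg hM' hR (.of_eq rfl) hroot
      (.exec todo acc ((ht.rely hM hR hS).finish fun h1 => ?_) (hf.rely hR hS.lt)) ?_
    · have hh' := hh.rely hM hR hv fun h => absurd h.1 (not_lt.2 hm)
      rw [hh'.cur h1]
      exact Or.inr hlast.ge
    · have := progPot_congr (sh := sh) (sh' := sh.push c D) rfl hroot
      simp only [stackPot_cons, stackPot_nil, Frame.pot]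
      omega
  · refine .silent hM (.exec todo acc (ht.finish fun h1 => ?_) hf) ?_
    · rw [hh.cur h1]
      exact Or.inr (not_lt.1 hlt)
    · simp only [stackPot_cons, stackPot_nil, Frame.pot]
      omega

theorem seg_popIf (hM : MemOK K H G sh) (hS : Started H G sh D v)
    (ht : Todo sh D v [] fun _ => False) (hf : Fresh G sh Rb v fun _ => False) :
    SegResult K H G sh Rb D v [.popIf D v] (sh.popIf v D) [] 1 := by
  rcases le_or_gt D.ts (sh.node v).done with hd | hd
  · have hsh : sh.popIf v D = sh := by
      unfold Shared.popIf
      cases hq : (sh.node v).queue with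
      | nil => rfl
      | cons E q =>
        have hE := hM.active_of_head hq
        have := hE.done_lt
        simp only
        rw [if_neg (by omega)]
    rw [hsh]
    refine ⟨hM, .of_eq rfl fun _ _ => rfl, .of_eq rfl, rfl, Or.inr ⟨rfl, hd, hf, ?_⟩⟩
    simp only [stackPot_cons, stackPot_nil, Frame.pot]
    omega
  · obtain ⟨q, hq⟩ := hM.head_of_active (hS.active hd)
    have hsh : sh.popIf v D = sh.modifyNode v fun n => { n with queue := q } := by
      unfold Shared.popIf
      rw [hq]
      simp
    rw [hsh]
    obtain ⟨hM', hR⟩ := hM.remove (sh' := sh.modifyNode v fun n => { n with queue := q }) hq rfl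
      rfl rfl rfl fun e he => by
        rcases ht.cover e he with h1 | h1 | h1
        · simp at h1
        · exact h1.elim
        · exact h1 hd
    have hroot : ((sh.modifyNode v fun n => { n with queue := q }).node root).lastTs =
        (sh.node root).lastTs := by
      simp only [Shared.modifyNode]
      rcases eq_or_ne root v with hr | hr
      · rw [← hr, Function.update_self]
      · rw [Function.update_of_ne hr]
    refine ⟨hM', hR, .of_eq rfl, hroot, Or.inr ⟨rfl, ?_, hf.rely hR hS.lt, ?_⟩⟩
    · by_contra h1
      obtain ⟨q', hq'⟩ := hM'.head_of_active ((hS.rely hR).active (not_le.1 h1))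
      simp only [Shared.modifyNode, Function.update_self] at hq'
      have hs := (hM.node v hS.lt).sorted
      rw [hq, hq'] at hs
      exact absurd ((List.pairwise_cons.1 hs).1 D (by simp)) (lt_irrefl _)
    · have := progPot_congr (sh := sh) (sh' := sh.modifyNode v fun n => { n with queue := q }) rfl hroot
      simp only [stackPot_cons, stackPot_nil, Frame.pot]
      omega

/-- Building a subtree. -/
theorem build_spec (hM : MemOK K H G sh) (hv : Visit H G sh D v d c)
    {ts : ℕ} {keys : List α} (h1 : (G v).birth ≤ ts) (h2 : ts ≤ (sh.node v).lastTs)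
    (hk : IsList keys (keysIn (contents H ts) ((sh.node v).childRange d).1
        ((sh.node v).childRange d).2))
    (hG : (ideal keys).GhostAt G ts sh.next v d ((G v).depth + 1)) :
    ∃ sh' nv, step K sh (.build D v d c ts keys) =
        (sh', [.swing v d c nv], 1 + (ideal keys).nodeCount) ∧
      MemOK K H G sh' ∧ Rely K H G sh sh' ∧ Progresses sh sh' ∧ progPot sh' = progPot sh ∧
      (sh'.node root).lastTs = (sh.node root).lastTs ∧ NewTree G sh' v d c nv ts := by
  obtain ⟨a1, a2, a3, a4, a5, a6, a7⟩ := alloc_spec ts (ideal keys) ((sh.node v).childRange d).1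
    ((sh.node v).childRange d).2 sh
  obtain ⟨hM', hnew⟩ := hM.alloc hv.started.lt hv.started.inner (hM.task_left hv.task) h1 h2 hk hG rfl
  have hroot := a3 root (Or.inl hM.root_lt)
  have hpos := (ideal keys).nodeCount_pos
  have hlt := hv.lt
  refine ⟨_, _, rfl, hM', .of_new (by omega) (fun x hx => a3 x (Or.inl hx)) hnew, .of_eq a4,
    progPot_congr a4 (by rw [hroot]), by rw [hroot], ?_⟩
  have := hM.root_lt
  refine ⟨?_, ?_, ?_, ?_, ?_, ?_⟩ <;> rw [a2]
  · omega
  · omega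
  · omega
  · rw [hG.top]
  · rw [hG.top]
  · rw [a7.top.1]

theorem seg_leafBuild (hM : MemOK K H G sh) (hS : Started H G sh D v)
    {todo : List (Dir × Act)} {acc : ℕ} {keys : List α} (ht : Todo sh D v todo fun e => e = d)
    (hf : Fresh G sh Rb v fun _ => False) (hv : Visit H G sh D v d c)
    (hl : LeafTask H sh D v d c) (he : D.eff = true) (hlt : (sh.node c).lastTs < D.ts)
    (hk : IsList keys (keysIn (contents H D.ts) ((sh.node v).childRange d).1
        ((sh.node v).childRange d).2))
    (hG : (ideal keys).GhostAt G D.ts sh.next v d ((G v).depth + 1)) :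
    SegResult K H G sh Rb D v [.build D v d c D.ts keys, .exec D v todo acc]
      (step K sh (.build D v d c D.ts keys)).1 ((step K sh (.build D v d c D.ts keys)).2.1 ++
        [.exec D v todo acc]) (step K sh (.build D v d c D.ts keys)).2.2 := by
  obtain ⟨sh', nv, hst, hM', hR, hP, hpot, hroot, hN⟩ := build_spec hM hv hS.birth_lt.le
    hS.le_lastTs hk hG
  rw [hst]
  refine .of_seg hM' hR hP hroot (.leafSwing d todo acc c nv (ht.rely hM hR hS)
    (hf.rely hR hS.lt) (hv.rely hR) (hl.rely hM hR hv) he ?_ hN) ?_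
  · rw [hl.lastTs_eq hR hv]; exact hlt
  · simp only [List.cons_append, List.nil_append, stackPot_cons, stackPot_nil, Frame.pot]
    omega

theorem seg_build (hM : MemOK K H G sh) (hS : Started H G sh D v)
    {todo : List (Dir × Act)} {acc : ℕ} {keys : List α}
    (ht : Todo sh D v ((d, .visit) :: todo) fun _ => False)
    (hf : Fresh G sh Rb v fun x => x = c) (hv : Visit H G sh D v d c)
    (hr : Rebuild K H sh D v d c)
    (hk : IsList keys (keysIn (contents H (D.ts - 1)) ((sh.node v).childRange d).1
        ((sh.node v).childRange d).2))
    (hG : (ideal keys).GhostAt G (D.ts - 1) sh.next v d ((G v).depth + 1)) :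
    SegResult K H G sh Rb D v
      [.build D v d c (D.ts - 1) keys, .exec D v ((d, .visit) :: todo) acc]
      (step K sh (.build D v d c (D.ts - 1) keys)).1
      ((step K sh (.build D v d c (D.ts - 1) keys)).2.1 ++
        [.exec D v ((d, .visit) :: todo) acc])
      (step K sh (.build D v d c (D.ts - 1) keys)).2.2 := by
  have h1 := hS.birth_lt
  have h2 := hS.le_lastTs
  obtain ⟨sh', nv, hst, hM', hR, hP, hpot, hroot, hN⟩ := build_spec hM hv (by omega)
    (by omega) hk hG
  rw [hst]
  refine .of_seg hM' hR hP hroot (.swing d todo acc c nv (ht.rely hM hR hS)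
    (hf.rely hR hS.lt) (hv.rely hR) (hr.rely hM hR hv) hN) ?_
  simp only [List.cons_append, List.nil_append, stackPot_cons, stackPot_nil, Frame.pot]
  omega

theorem seg_leafSwing (hM : MemOK K H G sh) (hS : Started H G sh D v)
    {todo : List (Dir × Act)} {acc nv : ℕ} (ht : Todo sh D v todo fun e => e = d)
    (hf : Fresh G sh Rb v fun _ => False) (hv : Visit H G sh D v d c)
    (hl : LeafTask H sh D v d c) (he : D.eff = true) (hlt : (sh.node c).lastTs < D.ts)
    (hn : NewTree G sh v d c nv D.ts) :
    SegResult K H G sh Rb D v [.swing v d c nv, .exec D v todo acc]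
      (step K sh (.swing v d c nv)).1 ((step K sh (.swing v d c nv)).2.1 ++
        [.exec D v todo acc]) (step K sh (.swing v d c nv)).2.2 := by
  rw [step_swing]
  split_ifs with hb
  · have hact : (sh.node v).done < D.ts := by
      by_contra h3
      have := hl.old (not_lt.1 h3) hb he
      omega
    obtain ⟨hM', hR⟩ := hM.swing (sh' := sh.modifyNode v fun n => n.setChild d nv)
      (hS.active hact) (hM.task_left hv.task) hn.lt hn.ne_root (by rw [hb]; exact hn.gt) hn.par_eq
      hn.dir_eq (by have := hn.le_lastTs; omega)
      (Or.inl ⟨by rw [hb]; exact hl.leaf, he, by rw [hb]; exact hlt, hn.le_lastTs⟩) rfl rfl rfl rfl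
    have hroot := swing_root (sh := sh) v d nv
    refine .of_seg hM' hR (.of_eq rfl) hroot
      (.exec todo acc ((ht.rely hM hR hS).finish fun h1 => ?_) (hf.rely hR hS.lt)) ?_
    · rw [swing_child]
      exact Or.inr (hn.rely hR).le_lastTs
    · have := progPot_congr (sh := sh) (sh' := sh.modifyNode v fun n => n.setChild d nv) rfl hroot
      simp only [List.nil_append, stackPot_cons, stackPot_nil, Frame.pot]
      omega
  · simp only [List.nil_append]
    refine .silent hM (.exec todo acc (ht.finish fun h1 => ?_) hf) ?_
    · exact (hl.cur h1).resolve_left hb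
    · simp only [stackPot_cons, stackPot_nil, Frame.pot]
      omega

theorem seg_swing (hM : MemOK K H G sh) (hS : Started H G sh D v)
    {todo : List (Dir × Act)} {acc nv : ℕ}
    (ht : Todo sh D v ((d, .visit) :: todo) fun _ => False)
    (hf : Fresh G sh Rb v fun x => x = c) (hv : Visit H G sh D v d c)
    (hr : Rebuild K H sh D v d c)
    (hn : NewTree G sh v d c nv (D.ts - 1)) :
    SegResult K H G sh Rb D v [.swing v d c nv, .exec D v ((d, .visit) :: todo) acc]
      (step K sh (.swing v d c nv)).1 ((step K sh (.swing v d c nv)).2.1 ++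
        [.exec D v ((d, .visit) :: todo) acc]) (step K sh (.swing v d c nv)).2.2 := by
  rw [step_swing]
  split_ifs with hb
  · have hact := hr.cur hb
    obtain ⟨hM', hR⟩ := hM.swing (sh' := sh.modifyNode v fun n => n.setChild d nv)
      (hS.active hact) (hM.task_left hv.task) hn.lt hn.ne_root (by rw [hb]; exact hn.gt) hn.par_eq
      hn.dir_eq hn.le_lastTs
      (Or.inr ⟨by rw [hb]; exact hr.inner, by rw [hb]; exact hr.needs, by rw [hb]; exact hr.upTo⟩)
      rfl rfl rfl rfl
    have hroot := swing_root (sh := sh) v d nv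
    refine .of_seg hM' hR (.of_eq rfl) hroot
      (.exec _ acc (ht.rely hM hR hS) ((hf.rely hR hS.lt).finish hv.dir_eq ?_)) ?_
    · rw [swing_child]
      exact hn.gt
    · have := progPot_congr (sh := sh) (sh' := sh.modifyNode v fun n => n.setChild d nv) rfl hroot
      simp only [List.nil_append, stackPot_cons, stackPot_nil, Frame.pot]
      omega
  -- The CAS fails only if the register has moved beyond `c`, which is all that is needed to record
  -- the rebuilding as over.
  · simp only [List.nil_append]
    refine .silent hM (.exec _ acc ht (hf.finish hv.dir_eq ?_)) ?_
    · exact lt_of_le_of_ne hv.le (Ne.symm hb)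
    · simp only [stackPot_cons, stackPot_nil, Frame.pot]
      omega

end SegStep

/-! ### Draining and collecting a subtree -/

section Subtrees

variable {α : Type u} [LinearOrder α] {K : ℝ} {H : ℕ → Op α} {G : ℕ → Ghost} {sh sh' : Shared α}
  {D : Desc α} {v c u : ℕ} {d : Dir} {Rb : Finset ℕ} {lo mid hi : Bound α}

theorem IsList.nil (S : Finset α) (a : Bound α) : IsList [] (keysIn S a a) := by
  refine ⟨List.Pairwise.nil, fun x => ?_⟩
  simp only [List.not_mem_nil, mem_keysIn, false_iff]
  exact fun h => absurd h.2.2 (not_lt.2 h.2.1)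

theorem IsList.append {S : Finset α} {l₁ l₂ : List α} (h₁ : IsList l₁ (keysIn S lo mid))
    (h₂ : IsList l₂ (keysIn S mid hi)) (h1 : lo ≤ mid) (h2 : mid ≤ hi) :
    IsList (l₁ ++ l₂) (keysIn S lo hi) := by
  refine ⟨List.pairwise_append.2 ⟨h₁.1, h₂.1, fun x hx y hy => ?_⟩, fun x => ?_⟩
  · have hx' := mem_keysIn.1 ((h₁.2 x).1 hx)
    have hy' := mem_keysIn.1 ((h₂.2 y).1 hy)
    exact bd_lt_bd.1 (hx'.2.2.trans_le hy'.2.1)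
  · rw [List.mem_append, h₁.2, h₂.2]
    simp only [mem_keysIn]
    constructor
    · rintro (⟨h3, h4, h5⟩ | ⟨h3, h4, h5⟩)
      · exact ⟨h3, h4, h5.trans_le h2⟩
      · exact ⟨h3, h1.trans h4, h5⟩
    · rintro ⟨h3, h4, h5⟩
      rcases lt_or_ge (bd x) mid with h6 | h6
      · exact Or.inl ⟨h3, h4, h6⟩
      · exact Or.inr ⟨h3, h6, h5⟩

/-- Below an inner node other than the fictive root, each child range contained a key at the birth
of the parent. -/
theorem MemOK.lo_le_hi (h : MemOK K H G sh) (hc : c < sh.next) (hr : c ≠ root) :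
    (sh.node c).lo ≤ (sh.node c).hi := by
  have hn := (h.node c hc).nonroot hr
  by_cases hp : (G c).par = root
  · rw [hn.lo_eq, hn.hi_eq, hp, hn.par_root hp]
    simp [Node.childRange, h.root_body, h.root_lo]
  · have hpn := (h.node _ hn.par_lt).nonroot hp
    obtain ⟨x, hx⟩ := Finset.card_pos.1 ((hpn.inner hn.par_inner).half (G c).dir).1
    have hx := (mem_keysIn.1 hx).2
    rw [hn.lo_eq, hn.hi_eq]
    exact hx.1.trans hx.2.le

/-- The tails of the queues in a subtree that is being rebuilt. -/
theorem Under.lastTs_le (hu : Under sh.node c u) (hM : MemOK K H G sh)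
    (hr : Rebuild K H sh D v d c) (hV : Visit H G sh D v d c) :
    (sh.node u).lastTs ≤ (sh.node c).lastTs := by
  induction hu with
  | top => exact le_rfl
  | down u e hu hi hq ih =>
    obtain ⟨h1, h2, -, -⟩ := hu.facts hM hr hV
    have he := hM.edge_of_under h1 h2 hi e
    have hn := (hM.node _ he.lt).nonroot he.ne_root
    have h3 := hn.tsMod_le
    rw [he.par_eq] at h3
    exact hn.lastTs_le_tsMod.trans (h3.trans ih)

/-- The keys of a leaf of a subtree that is being rebuilt. -/
theorem Under.isList (hu : Under sh.node c u) (hM : MemOK K H G sh)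
    (hr : Rebuild K H sh D v d c) (hV : Visit H G sh D v d c)
    (hl : ¬ (sh.node u).body.IsInner) : IsList (sh.node u).body.keys
      (keysIn (contents H (D.ts - 1)) (sh.node u).lo (sh.node u).hi) := by
  obtain ⟨h1, h2, h3, -⟩ := hu.facts hM hr hV
  have h4 := hu.lastTs_le hM hr hV
  have h5 := hM.lastTs_le_tsMod hV.lt hV.ne_root
  have h6 := hr.needs.1
  obtain ⟨-, l2, -, l4⟩ := (hM.node u h1).leaf hl
  refine ⟨?_, fun x => ?_⟩
  · have := Body.length_keys_le (sh.node u).body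
    match (sh.node u).body.keys, this with
    | [], _ => exact List.Pairwise.nil
    | [a], _ => simp
  · rw [l4, keysIn_eq_of_not_modifies (a := (G u).birth) (b := D.ts - 1) (by omega)]
    intro t h7 h8 h9
    have := (h3 t (by omega) h8 h9.2).2
    rw [h9.1] at this
    cases this

/-- The number of keys of a subtree that has to be rebuilt. -/
theorem Rebuild.card_le (hr : Rebuild K H sh D v d c) (hM : MemOK K H G sh)
    (hV : Visit H G sh D v d c) :
    (keysIn (contents H (D.ts - 1)) (sh.node c).lo (sh.node c).hi).card ≤ (sh.node c).weight := by
  have hn := hM.node c hV.lt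
  have hm := hn.nonroot hV.ne_root
  have hin := hm.inner hr.inner
  have h1 := hr.needs.1
  have h2 := hm.lastTs_le_tsMod
  have h3 := hn.birth_le
  have h4 := (card_keysIn_le (H := H) (lo := (sh.node c).lo) (hi := (sh.node c).hi)
    (a := (G c).birth) (b := D.ts - 1) (by omega)).1
  have h5 := mods_add (H := H) (lo := (sh.node c).lo) (hi := (sh.node c).hi)
    (a := (G c).birth) (b := (sh.node c).st.tsMod) (c := D.ts - 1) (by omega) (by omega)
  have h6 := mods_eq_zero (H := H) (lo := (sh.node c).lo) (hi := (sh.node c).hi)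
    (a := (sh.node c).st.tsMod) (b := D.ts - 1) fun t h7 h8 h9 =>
      (hr.upTo t (by omega) h8 h9.2).1 hr.inner
  rw [Node.weight_inner hr.inner, hin.init, hin.mod]
  omega

theorem PlaceOK.pot_inner (hu : Under sh.node c u) (hM : MemOK K H G sh)
    (hr : Rebuild K H sh D v d c) (hV : Visit H G sh D v d c) (hi : (sh.node u).body.IsInner) :
    1 + placePot sh.node (.edge u .left) + placePot sh.node (.edge u .right) ≤
      placePot sh.node (.node u) := by
  obtain ⟨h1, h2, -, -⟩ := hu.facts hM hr hV
  have e1 := hM.edge_of_under h1 h2 hi .left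
  have e2 := hM.edge_of_under h1 h2 hi .right
  have w1 := hM.weight_pos e1.lt e1.ne_root
  have w2 := hM.weight_pos e2.lt e2.ne_root
  have := hM.weight_children h1 h2 hi
  simp only [placePot]
  omega

theorem seg_lookAdd (hM : MemOK K H G sh) {todo : List (Dir × Act)} {acc : ℕ}
    (ht : Todo sh D v todo fun _ => False) (hf : Fresh G sh Rb v fun _ => False) :
    SegResult K H G sh Rb D v [.look D v d .add todo acc c] sh
      [.exec D v todo (acc + (sh.node c).st.size)] 1 := by
  refine .silent hM (.exec todo _ ht hf) ?_
  simp only [stackPot_cons, stackPot_nil, Frame.pot]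
  omega

theorem step_drain_inner {pls : List Place} (hi : (sh.node u).body.IsInner)
    (hq : (sh.node u).queue = []) : step K sh (.drain D v d c (.node u :: pls)) =
      (sh, [.drain D v d c (.edge u .left :: .edge u .right :: pls)], 1) := by
  obtain ⟨r, i, hb⟩ := Body.isInner_iff.1 hi
  simp only [step, hb, hq]

theorem step_drain_call {pls : List Place} {E : Desc α} {q : List (Desc α)}
    (hi : (sh.node u).body.IsInner)
    (hq : (sh.node u).queue = E :: q) : step K sh (.drain D v d c (.node u :: pls)) =
      (sh, [.exec E u (E.op.tasks (sh.node u)) 0, .drain D v d c (.node u :: pls)], 1) := by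
  obtain ⟨r, i, hb⟩ := Body.isInner_iff.1 hi
  simp only [step, hb, hq]

theorem step_drain_leaf {pls : List Place} (hi : ¬ (sh.node u).body.IsInner) :
    step K sh (.drain D v d c (.node u :: pls)) = (sh, [.drain D v d c pls], 1) := by
  cases hb : (sh.node u).body with
  | inner r i => rw [hb] at hi; exact absurd trivial hi
  | _ => simp only [step, hb]

theorem step_collect_inner {pls : List Place} {keys : List α} (hi : (sh.node u).body.IsInner) :
    step K sh (.collect D v d c (.node u :: pls) keys) =
      (sh, [.collect D v d c (.edge u .left :: .edge u .right :: pls) keys], 1) := by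
  obtain ⟨r, i, hb⟩ := Body.isInner_iff.1 hi
  simp only [step, hb]

theorem step_collect_leaf {pls : List Place} {keys : List α} (hi : ¬ (sh.node u).body.IsInner) :
    step K sh (.collect D v d c (.node u :: pls) keys) =
      (sh, [.collect D v d c pls (keys ++ (sh.node u).body.keys)], 1) := by
  cases hb : (sh.node u).body with
  | inner r i => rw [hb] at hi; exact absurd trivial hi
  | _ => simp only [step, hb]

theorem seg_drain (hM : MemOK K H G sh)
    {todo : List (Dir × Act)} {acc : ℕ} {pls : List Place}
    (ht : Todo sh D v ((d, .visit) :: todo) fun _ => False)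
    (hf : Fresh G sh Rb v fun x => x = c) (hv : Visit H G sh D v d c)
    (hr : Rebuild K H sh D v d c) (hp : ∀ pl ∈ pls, PlaceOK sh.node c pl)
    (hc : Cov sh.node pls (.node c))
    (hq : ∀ u pls', pls = .node u :: pls' → (sh.node u).queue = []) :
    SegResult K H G sh Rb D v [.drain D v d c pls, .exec D v ((d, .visit) :: todo) acc]
      (step K sh (.drain D v d c pls)).1 ((step K sh (.drain D v d c pls)).2.1 ++
        [.exec D v ((d, .visit) :: todo) acc]) (step K sh (.drain D v d c pls)).2.2 := by
  match pls, hp, hc, hq with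
  | [], _, hc, _ =>
    simp only [step, List.cons_append, List.nil_append]
    refine .silent hM (.collect d todo acc c [.node c] [] (sh.node c).lo ht hf hv hr ?_ ?_ le_rfl
      ⟨rfl, rfl⟩ (.nil _ _)) ?_
    · simp only [List.mem_singleton, forall_eq]
      exact Under.top
    · simpa using hc
    · have := hM.weight_pos hv.lt hv.ne_root
      simp only [stackPot_cons, stackPot_nil, Frame.pot, List.map_cons, List.map_nil,
        List.sum_cons, List.sum_nil, placePot]
      omega
  | .edge u e :: pls, hp, hc, _ =>
    simp only [step, List.cons_append, List.nil_append]
    obtain ⟨h1, h2, h3⟩ := hp _ List.mem_cons_self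
    refine .silent hM (.drain d todo acc c _ ht hf hv hr ?_ ?_) ?_
    · intro pl hpl
      rcases List.mem_cons.1 hpl with rfl | hpl
      · exact Under.down u e h1 h2 h3
      · exact hp pl (List.mem_cons_of_mem _ hpl)
    · refine hc.trans fun pl hpl => ?_
      rcases List.mem_cons.1 hpl with rfl | hpl
      · exact .edge u e (.mem _ List.mem_cons_self)
      · exact .mem _ (List.mem_cons_of_mem _ hpl)
    · simp only [stackPot_cons, stackPot_nil, Frame.pot, List.map_cons, List.sum_cons, placePot]
      omega
  | .node u :: pls, hp, hc, hq =>
    have hu : Under sh.node c u := hp _ List.mem_cons_self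
    by_cases hi : (sh.node u).body.IsInner
    · have hq := hq u pls rfl
      rw [step_drain_inner hi hq]
      refine .silent hM (.drain d todo acc c _ ht hf hv hr ?_ ?_) ?_
      · intro pl hpl
        rcases List.mem_cons.1 hpl with rfl | hpl
        · exact ⟨hu, hi, hq⟩
        rcases List.mem_cons.1 hpl with rfl | hpl
        · exact ⟨hu, hi, hq⟩
        · exact hp pl (List.mem_cons_of_mem _ hpl)
      · refine hc.trans fun pl hpl => ?_
        rcases List.mem_cons.1 hpl with rfl | hpl
        · exact .inner u hq fun e => .mem _ (by cases e <;> simp)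
        · exact .mem _ (by simp [hpl])
      · have := PlaceOK.pot_inner hu hM hr hv hi
        simp only [List.cons_append, List.nil_append, stackPot_cons, stackPot_nil, Frame.pot,
          List.map_cons, List.sum_cons]
        omega
    · rw [step_drain_leaf hi]
      refine .silent hM (.drain d todo acc c _ ht hf hv hr
        (fun pl hpl => hp pl (List.mem_cons_of_mem _ hpl)) ?_) ?_
      · refine hc.trans fun pl hpl => ?_
        rcases List.mem_cons.1 hpl with rfl | hpl
        · exact .leaf u hi
        · exact .mem _ hpl
      · have := Node.weight_leaf hi
        simp only [List.cons_append, List.nil_append, stackPot_cons, stackPot_nil, Frame.pot,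
          List.map_cons, List.sum_cons, placePot]
        omega

theorem seg_collect (hM : MemOK K H G sh)
    {todo : List (Dir × Act)} {acc : ℕ} {pls : List Place} {keys : List α} {pos : Bound α}
    (ht : Todo sh D v ((d, .visit) :: todo) fun _ => False)
    (hf : Fresh G sh Rb v fun x => x = c) (hv : Visit H G sh D v d c)
    (hr : Rebuild K H sh D v d c) (hp : ∀ pl ∈ pls, PlaceOK sh.node c pl)
    (hc : ∀ pl ∈ pls, Cov sh.node [] pl) (hpos : (sh.node c).lo ≤ pos)
    (hcon : Contiguous sh.node pls pos (sh.node c).hi)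
    (hk : IsList keys (keysIn (contents H (D.ts - 1)) (sh.node c).lo pos)) :
    SegResult K H G sh Rb D v [.collect D v d c pls keys, .exec D v ((d, .visit) :: todo) acc]
      (step K sh (.collect D v d c pls keys)).1 ((step K sh (.collect D v d c pls keys)).2.1 ++
        [.exec D v ((d, .visit) :: todo) acc]) (step K sh (.collect D v d c pls keys)).2.2 := by
  match pls, hp, hc, hcon with
  | [], _, _, hcon =>
    simp only [step, List.cons_append, List.nil_append]
    have hcon : pos = (sh.node c).hi := hcon
    subst hcon
    have hn := (hM.node c hv.lt).nonroot hv.ne_root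
    have hlo := hn.lo_eq
    have hhi := hn.hi_eq
    rw [hv.par_eq, hv.dir_eq] at hlo hhi
    refine .silent hM (.build d todo acc c keys ht hf hv hr (by rw [← hlo, ← hhi]; exact hk)) ?_
    -- The number of collected keys is at most the weight of `c`, so the potential kept during the
    -- walk pays for the nodes of the new tree.
    have h1 := hr.card_le hM hv
    rw [← hk.length_eq] at h1
    have h2 := hM.weight_pos hv.lt hv.ne_root
    have h3 := (ideal_count _ keys le_rfl).2
    simp only [stackPot_cons, stackPot_nil, Frame.pot, List.map_nil, List.sum_nil]
    omega
  | .edge u e :: pls, hp, hc, hcon =>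
    simp only [step, List.cons_append, List.nil_append]
    obtain ⟨h1, h2, h3⟩ := hp _ List.mem_cons_self
    obtain ⟨h4, h5, -, -⟩ := h1.facts hM hr hv
    have he := hM.edge_of_under h4 h5 h2 e
    have hn := (hM.node _ he.lt).nonroot he.ne_root
    have hlo := hn.lo_eq
    have hhi := hn.hi_eq
    rw [he.par_eq, he.dir_eq] at hlo hhi
    refine .silent hM (.collect d todo acc c _ keys pos ht hf hv hr ?_ ?_ hpos ?_ hk) ?_
    · intro pl hpl
      rcases List.mem_cons.1 hpl with rfl | hpl
      · exact Under.down u e h1 h2 h3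
      · exact hp pl (List.mem_cons_of_mem _ hpl)
    · intro pl hpl
      rcases List.mem_cons.1 hpl with rfl | hpl
      · cases hc _ List.mem_cons_self with
        | mem _ h => cases h
        | edge _ _ h => exact h
      · exact hc pl (List.mem_cons_of_mem _ hpl)
    · refine ⟨hlo.trans hcon.1, ?_⟩
      simp only [placeHi]
      rw [hhi]
      exact hcon.2
    · simp only [stackPot_cons, stackPot_nil, Frame.pot, List.map_cons, List.sum_cons, placePot]
      omega
  | .node u :: pls, hp, hc, hcon =>
    have hu : Under sh.node c u := hp _ List.mem_cons_self
    obtain ⟨h4, h5, -, -⟩ := hu.facts hM hr hv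
    by_cases hi : (sh.node u).body.IsInner
    · rw [step_collect_inner hi]
      obtain ⟨hq, hcov⟩ : (sh.node u).queue = [] ∧ ∀ e, Cov sh.node [] (.edge u e) := by
        cases hc _ List.mem_cons_self with
        | mem _ h => cases h
        | leaf _ h => exact absurd hi h
        | inner _ h1 h2 => exact ⟨h1, h2⟩
      refine .silent hM (.collect d todo acc c _ keys pos ht hf hv hr ?_ ?_ hpos ?_ hk) ?_
      · intro pl hpl
        rcases List.mem_cons.1 hpl with rfl | hpl
        · exact ⟨hu, hi, hq⟩
        rcases List.mem_cons.1 hpl with rfl | hpl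
        · exact ⟨hu, hi, hq⟩
        · exact hp pl (List.mem_cons_of_mem _ hpl)
      · intro pl hpl
        rcases List.mem_cons.1 hpl with rfl | hpl
        · exact hcov _
        rcases List.mem_cons.1 hpl with rfl | hpl
        · exact hcov _
        · exact hc pl (List.mem_cons_of_mem _ hpl)
      · obtain ⟨r, i, hb⟩ := Body.isInner_iff.1 hi
        obtain ⟨h6, h7⟩ := hcon
        simp only [placeLo, placeHi] at h6 h7
        simp only [Contiguous, placeLo, placeHi, Node.childRange, hb]
        exact ⟨h6, trivial, h7⟩
      · have := PlaceOK.pot_inner hu hM hr hv hi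
        simp only [List.cons_append, List.nil_append, stackPot_cons, stackPot_nil, Frame.pot,
          List.map_cons, List.sum_cons]
        omega
    · rw [step_collect_leaf hi]
      have hur := hM.lo_le_hi h4 h5
      have hup : (sh.node u).lo = pos := hcon.1
      subst hup
      refine .silent hM (.collect d todo acc c _ _ (sh.node u).hi ht hf hv hr
        (fun pl hpl => hp pl (List.mem_cons_of_mem _ hpl))
        (fun pl hpl => hc pl (List.mem_cons_of_mem _ hpl)) (hpos.trans hur) hcon.2
        (hk.append (hu.isList hM hr hv hi) hpos hur)) ?_
      have := Node.weight_leaf hi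
      simp only [List.cons_append, List.nil_append, stackPot_cons, stackPot_nil, Frame.pot,
        List.map_cons, List.sum_cons, placePot]
      omega

/-- The ghost attributes of the nodes that a step creates. -/
def FrameGhost (G : ℕ → Ghost) (sh : Shared α) : Frame α → Prop
  | .build _ v d _ ts keys => (ideal keys).GhostAt G ts sh.next v d ((G v).depth + 1)
  | _ => True

/-- One step of an execution. -/
theorem Seg.step {f : Frame α} {fs : List (Frame α)} (hs : Seg K H G sh Rb D v (f :: fs))
    (hM : MemOK K H G sh) (hS : Started H G sh D v) (hG : FrameGhost G sh f)
    (hq : ∀ D' v' d' c' u pls, f = .drain D' v' d' c' (.node u :: pls) → (sh.node u).queue = []) :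
    SegResult K H G sh Rb D v (f :: fs) (step K sh f).1 ((step K sh f).2.1 ++ fs)
      (step K sh f).2.2 := by
  cases hs with
  | exec todo acc ht hf =>
    match todo, ht with
    | [], ht => exact seg_exec_nil hM hS ht hf
    | (d, a) :: todo, ht => exact seg_exec_cons hM hS ht hf
  | lookAdd d todo acc c ht hf => exact seg_lookAdd hM ht hf
  | lookVisit d todo acc c ht hf hv hc hi hl =>
    have := seg_look_visit (acc := acc) hM hS ht hf hv hc hi hl
    simpa only [WaitFreeBST.step, List.append_nil] using this
  | pushTraverse d todo acc c s ht hf hv hh hn hs => exact seg_pushTraverse hM hS ht hf hv hh hn hs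
  | casState d todo acc c s ht hf hv hh hn hs => exact seg_casState hM hS ht hf hv hh hn hs
  | pushIf d todo acc c ht hf hv hh hm => exact seg_pushIf hM hS ht hf hv hh hm
  | popIf ht hf => exact seg_popIf hM hS ht hf
  | leafBuild d todo acc c keys ht hf hv hl he hlt hk =>
    exact seg_leafBuild hM hS ht hf hv hl he hlt hk hG
  | leafSwing d todo acc c nv ht hf hv hl he hlt hn => exact seg_leafSwing hM hS ht hf hv hl he hlt hn
  | drain d todo acc c pls ht hf hv hr hp hc =>
    exact seg_drain hM ht hf hv hr hp hc fun u pls' h => hq _ _ _ _ u pls' (by rw [h])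
  | collect d todo acc c pls keys pos ht hf hv hr hp hc hpos hcon hk =>
    exact seg_collect hM ht hf hv hr hp hc hpos hcon hk
  | build d todo acc c keys ht hf hv hr hk => exact seg_build hM hS ht hf hv hr hk hG
  | swing d todo acc c nv ht hf hv hr hn => exact seg_swing hM hS ht hf hv hr hn

end Subtrees

/-! ### Steps of a process: stacks of nested executions -/

section Processes

variable {α : Type u}

theorem Fresh.insert {G : ℕ → Ghost} {sh : Shared α} {v c : ℕ} {Rb : Finset ℕ} {skip : ℕ → Prop}
    (hf : Fresh G sh Rb v skip)
    (hc : (G c).par ≠ v) : Fresh G sh (insert c Rb) v skip := by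
  intro x hx hp
  rcases Finset.mem_insert.1 hx with rfl | h
  · exact absurd hp hc
  · exact hf x h hp

theorem modifyProg_other {sh : Shared α} {t s : ℕ} {g : Progress → Progress} (h : s ≠ t) :
    (sh.modifyProg t g).prog s = sh.prog s := by
  simp only [Shared.modifyProg]
  rw [Function.update_of_ne h]

theorem modifyProg_self {sh : Shared α} {t : ℕ} {g : Progress → Progress} :
    (sh.modifyProg t g).prog t = g (sh.prog t) := by
  simp [Shared.modifyProg]

variable [LinearOrder α] {K : ℝ} {H : ℕ → Op α} {G : ℕ → Ghost} {sh sh' : Shared α}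
  {D : Desc α} {v c u : ℕ} {d : Dir} {Ex : Finset (ℕ × ℕ)} {Rb : Finset ℕ}
  {f : Frame α} {fs : List (Frame α)} {A : List (ℕ × ℕ)} {ini : Option (ℕ × Bool)}

/-- Invariants of a process that has started to execute the operations in nodes listed in `Ex`, and
to rebuild the subtrees of the nodes in `Rb`. -/
structure ProcOK (K : ℝ) (H : ℕ → Op α) (G : ℕ → Ghost) (sh : Shared α) (Ex : Finset (ℕ × ℕ))
    (Rb : Finset ℕ) (fs : List (Frame α)) (A : List (ℕ × ℕ)) (ini : Option (ℕ × Bool)) :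
    Prop where
  stack : StackOK K H G sh Rb fs A ini
  ex : ∀ x ∈ Ex, Started H G sh (descOf H x.1) x.2 ∧ (x.1 ≤ (sh.node x.2).done ∨ x ∈ A)
  rb : ∀ c ∈ Rb, (∃ D v d, Visit H G sh D v d c ∧ Rebuild K H sh D v d c) ∧
    (c < (sh.node (G c).par).child (G c).dir ∨ ∃ a ∈ A, a.2 = (G c).par)

theorem ProcOK.rely (hp : ProcOK K H G sh Ex Rb fs A ini) (hM : MemOK K H G sh)
    (hR : Rely K H G sh sh') : ProcOK K H G sh' Ex Rb fs A ini where
  stack := hp.stack.rely hM hR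
  ex x hx := by
    obtain ⟨h1, h2⟩ := hp.ex x hx
    exact ⟨h1.rely hR, h2.imp_left fun h => h.trans (hR.done_le _ h1.lt)⟩
  rb c hc := by
    obtain ⟨⟨D, v, d, h1, h2⟩, h3⟩ := hp.rb c hc
    refine ⟨⟨D, v, d, h1.rely hR, h2.rely hM hR h1⟩, h3.imp_left fun h => ?_⟩
    exact h.trans_le (hR.child_le _ (by rw [h1.par_eq]; exact h1.started.lt) _)

/-- The mutable part of the descriptor of the operation of a process. -/
def IniOK (sh : Shared α) (ini : Option (ℕ × Bool)) : Prop :=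
  ∀ t b, ini = some (t, b) → t ≤ (sh.node root).lastTs ∧ (sh.prog t).result = none ∧
    (b = true → (sh.prog t).traverse ≠ [])

theorem IniOK.rely (h : IniOK sh ini) (hM : MemOK K H G sh) (hR : Rely K H G sh sh')
    (hP : ∀ t b, ini = some (t, b) → ((sh.prog t).result = none → (sh'.prog t).result = none) ∧
      ((sh.prog t).traverse ≠ [] → (sh'.prog t).traverse ≠ [])) : IniOK sh' ini := by
  intro t b ht
  obtain ⟨h1, h2, h3⟩ := h t b ht
  obtain ⟨h4, h5⟩ := hP t b ht
  exact ⟨h1.trans (hR.lastTs_le root hM.root_lt), h4 h2, fun hb => h5 (h3 hb)⟩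

theorem Seg.ne_nil {fs : List (Frame α)} (hs : Seg K H G sh Rb D v fs) : fs ≠ [] := by
  cases hs <;> simp

theorem Seg.insert {fs : List (Frame α)} (hs : Seg K H G sh Rb D v fs) (hc : (G c).par ≠ v) :
    Seg K H G sh (insert c Rb) D v fs := by
  cases hs with
  | exec todo acc ht hf => exact .exec todo acc ht (hf.insert hc)
  | lookAdd d todo acc c' ht hf => exact .lookAdd d todo acc c' ht (hf.insert hc)
  | lookVisit d todo acc c' ht hf hv hc' hi hl =>
    refine .lookVisit d todo acc c' ht (hf.insert hc) hv (fun h => ?_) hi hl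
    rcases Finset.mem_insert.1 h with rfl | h
    · exact hc hv.par_eq
    · exact hc' h
  | pushTraverse d todo acc c' s ht hf hv hh hn hs =>
    exact .pushTraverse d todo acc c' s ht (hf.insert hc) hv hh hn hs
  | casState d todo acc c' s ht hf hv hh hn hs =>
    exact .casState d todo acc c' s ht (hf.insert hc) hv hh hn hs
  | pushIf d todo acc c' ht hf hv hh hm => exact .pushIf d todo acc c' ht (hf.insert hc) hv hh hm
  | popIf ht hf => exact .popIf ht (hf.insert hc)
  | leafBuild d todo acc c' keys ht hf hv hl he hlt hk =>
    exact .leafBuild d todo acc c' keys ht (hf.insert hc) hv hl he hlt hk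
  | leafSwing d todo acc c' nv ht hf hv hl he hlt hn =>
    exact .leafSwing d todo acc c' nv ht (hf.insert hc) hv hl he hlt hn
  | drain d todo acc c' pls ht hf hv hr hp hc' =>
    exact .drain d todo acc c' pls ht (hf.insert hc) hv hr hp hc'
  | collect d todo acc c' pls keys pos ht hf hv hr hp hc' hpos hcon hk =>
    exact .collect d todo acc c' pls keys pos ht (hf.insert hc) hv hr hp hc' hpos hcon hk
  | build d todo acc c' keys ht hf hv hr hk =>
    exact .build d todo acc c' keys ht (hf.insert hc) hv hr hk
  | swing d todo acc c' nv ht hf hv hr hn =>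
    exact .swing d todo acc c' nv ht (hf.insert hc) hv hr hn

theorem StackOK.insert (hs : StackOK K H G sh Rb fs A ini) (hc : ∀ a ∈ A, (G c).par ≠ a.2) :
    StackOK K H G sh (insert c Rb) fs A ini := by
  induction hs with
  | nil => exact .nil
  | enqRead op => exact .enqRead op
  | enqCas op t => exact .enqCas op t
  | traverse D => exact .traverse D
  | traversePop D => exact .traversePop D
  | execUntil D v => exact .execUntil D v
  | call E u fs B A ini hs hE hcB hA hB ih =>
    exact .call E u fs B A ini (hs.insert (hc (E.ts, u) (by simp))) hE hcB hA
      (ih fun a ha => hc a (by simp [ha]))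

/-- What a step of a process achieves. -/
structure ProcResult (K : ℝ) (H : ℕ → Op α) (G : ℕ → Ghost) (sh : Shared α)
    (Ex : Finset (ℕ × ℕ)) (Rb : Finset ℕ) (fs : List (Frame α)) (ini : Option (ℕ × Bool))
    (sh' : Shared α) (fs' : List (Frame α)) (cost : ℕ) (Ex' : Finset (ℕ × ℕ)) (Rb' : Finset ℕ)
    (A' : List (ℕ × ℕ)) (ini' : Option (ℕ × Bool)) : Prop where
  mem : MemOK K H G sh'
  rely : Rely K H G sh sh'
  proc : ProcOK K H G sh' Ex' Rb' fs' A' ini'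
  own : IniOK sh' ini'
  other : ∀ t ≤ (sh.node root).lastTs, (∀ b, ini ≠ some (t, b)) →
    (((sh.prog t).result = none → (sh'.prog t).result = none) ∧
      ((sh.prog t).traverse ≠ [] → (sh'.prog t).traverse ≠ [])) ∧ ∀ b, ini' ≠ some (t, b)
  tail : (sh'.node root).lastTs = (sh.node root).lastTs ∨
    ∃ op, fs = [.enqCas op (sh.node root).lastTs]
  -- The credits: `20` for a newly executed pair, `10` per unit of weight of a newly rebuilt node,
  -- `6` for a new timestamp.
  pot : cost + stackPot sh' fs' + progPot sh' + 20 * Ex.card +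
      10 * ∑ c ∈ Rb, (sh'.node c).weight ≤
    stackPot sh fs + progPot sh + 20 * Ex'.card + 10 * ∑ c ∈ Rb', (sh'.node c).weight +
      6 * ((sh'.node root).lastTs - (sh.node root).lastTs)

/-- A step that changes only the frames above the executions in nodes, and descriptors. -/
theorem ProcOK.quiet (hp : ProcOK K H G sh Ex Rb fs [] ini) (hM : MemOK K H G sh)
    {fs' : List (Frame α)} {ini' : Option (ℕ × Bool)} {cost : ℕ}
    (hnode : sh'.node = sh.node) (hnext : sh'.next = sh.next) (hkeys : sh'.keys = sh.keys)
    (hvis : sh'.visits = sh.visits)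
    (hs : StackOK K H G sh Rb fs' [] ini') (hown : IniOK sh' ini')
    (hother : ∀ t ≤ (sh.node root).lastTs, (∀ b, ini ≠ some (t, b)) →
      (((sh.prog t).result = none → (sh'.prog t).result = none) ∧
      ((sh.prog t).traverse ≠ [] → (sh'.prog t).traverse ≠ [])) ∧ ∀ b, ini' ≠ some (t, b))
    (hpot : cost + stackPot sh' fs' + progPot sh' ≤ stackPot sh fs + progPot sh) :
    ProcResult K H G sh Ex Rb fs ini sh' fs' cost Ex Rb [] ini' := by
  have hR : Rely K H G sh sh' := .of_eq hnext fun _ _ => by rw [hnode]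
  have hp' : ProcOK K H G sh Ex Rb fs' [] ini' := ⟨hs, hp.ex, hp.rb⟩
  exact ⟨hM.congr hnode hnext hkeys hvis, hR, hp'.rely hM hR, hown, hother, Or.inl (by rw [hnode]),
    by omega⟩

/-- A process starts to execute the operation at the head of the queue of `u`. -/
theorem ProcOK.call (hp : ProcOK K H G sh Ex Rb fs A ini) (hM : MemOK K H G sh)
    (hini : IniOK sh ini) {E : Desc α} {q : List (Desc α)} (hq : (sh.node u).queue = E :: q)
    (hc : Calls u fs) (hA : ∀ a ∈ A, (G a.2).depth < (G u).depth) :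
    ProcResult K H G sh Ex Rb fs ini sh (.exec E u (E.op.tasks (sh.node u)) 0 :: fs) 1
      (insert (E.ts, u) Ex) Rb ((E.ts, u) :: A) ini := by
  have hact := hM.active_of_head hq
  have hS := hact.toStarted
  have hnotA : ∀ a ∈ A, a.2 ≠ u := by
    rintro a ha rfl
    exact lt_irrefl _ (hA a ha)
  -- A recorded pair is either finished in its node or still on the stack. As `E` is active in `u`
  -- and `u` is not on the stack, the pair is new, so each process pays for a pair only once.
  have hnew : (E.ts, u) ∉ Ex := by
    intro h
    rcases (hp.ex _ h).2 with h1 | h1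
    · have := hact.done_lt
      simp only at h1
      omega
    · exact hnotA _ h1 rfl
  have hvis : E.op.Visits (sh.node u).lo (sh.node u).hi := by rw [hS.op_eq]; exact hS.visits
  have hb := Body.isInner_iff.1 hS.inner
  have hseg : Seg K H G sh Rb E u [.exec E u (E.op.tasks (sh.node u)) 0] := by
    refine .exec _ _ ⟨fun e he => (mem_tasks_visit hb hvis e).1 he,
      fun e he => Or.inl ((mem_tasks_visit hb hvis e).2 he)⟩ fun c hc hpc => ?_
    rcases (hp.rb c hc).2 with h1 | ⟨a, ha, h1⟩
    · rw [hpc] at h1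
      exact Or.inr h1
    · exact absurd (h1.trans hpc) (hnotA a ha)
  refine ⟨hM, .of_eq rfl fun _ _ => rfl, ⟨?_, ?_, ?_⟩, hini, fun t _ h => ⟨⟨id, id⟩, h⟩,
    Or.inl rfl, ?_⟩
  · exact .call E u [_] fs A ini hseg hS hc hA hp.stack
  · intro x hx
    rcases Finset.mem_insert.1 hx with rfl | hx
    · rw [← hS.desc]
      exact ⟨hS, Or.inr (by simp)⟩
    · obtain ⟨h1, h2⟩ := hp.ex x hx
      exact ⟨h1, h2.imp_right fun h => by simp [h]⟩
  · intro c hc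
    obtain ⟨h1, h2⟩ := hp.rb c hc
    exact ⟨h1, h2.imp_right fun ⟨a, ha, h⟩ => ⟨a, by simp [ha], h⟩⟩
  -- With at most two tasks the new frame has potential at most `3 + 8 * 2`; one more for this step
  -- gives the credit `20`.
  · rw [Finset.card_insert_of_notMem hnew]
    have := length_tasks_le E.op (sh.node u)
    simp only [stackPot_cons, Frame.pot]
    omega

/-- A step of the execution of an operation in a node. -/
theorem ProcOK.of_seg {E : Desc α} {old new : List (Frame α)} {cost : ℕ}
    (hp : ProcOK K H G sh Ex Rb (old ++ fs) ((E.ts, u) :: A) ini)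
    (hM : MemOK K H G sh) (hini : IniOK sh ini) (hE : Started H G sh E u) (hc : Calls u fs)
    (hA : ∀ a ∈ A, (G a.2).depth < (G u).depth) (hB : StackOK K H G sh Rb fs A ini)
    (h : SegResult K H G sh Rb E u old sh' new cost) :
    ∃ Rb' A', ProcResult K H G sh Ex Rb (old ++ fs) ini sh' (new ++ fs) cost Ex Rb' A' ini := by
  have hown : IniOK sh' ini := hini.rely hM h.rely fun t _ _ => h.prog t
  have hother : ∀ t ≤ (sh.node root).lastTs, (∀ b, ini ≠ some (t, b)) →
      (((sh.prog t).result = none → (sh'.prog t).result = none) ∧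
      ((sh.prog t).traverse ≠ [] → (sh'.prog t).traverse ≠ [])) ∧ ∀ b, ini ≠ some (t, b) :=
    fun t _ hb => ⟨h.prog t, hb⟩
  have hp' := hp.rely hM h.rely
  have hB' := hB.rely hM h.rely
  have hpot := hB.pot_rely hM h.rely
  rw [h.root_eq] at hpot
  rcases h.out with ⟨Rb', hRb, hseg, hle⟩ | ⟨rfl, hd, hf, hle⟩
  · refine ⟨Rb', (E.ts, u) :: A, h.mem, h.rely, ?_, hown, hother, Or.inl h.root_eq, ?_⟩
    · rcases hRb with rfl | ⟨c, d, hcR, rfl, hv, hr⟩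
      · exact ⟨.call E u new fs A ini hseg (hE.rely h.rely) hc hA hB', hp'.ex, hp'.rb⟩
      · refine ⟨.call E u new fs A ini hseg (hE.rely h.rely) hc hA (hB'.insert fun a ha => ?_),
          hp'.ex, fun x hx => ?_⟩
        · rw [hv.par_eq]
          rintro rfl
          exact lt_irrefl _ (hA a ha)
        · rcases Finset.mem_insert.1 hx with rfl | hx
          · exact ⟨⟨E, u, d, hv, hr⟩, Or.inr ⟨(E.ts, u), by simp, hv.par_eq.symm⟩⟩
          · exact hp'.rb x hx
    · rw [stackPot_append, stackPot_append]
      omega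
  · refine ⟨Rb, A, h.mem, h.rely, ⟨hB', ?_, ?_⟩, hown, hother, Or.inl h.root_eq, ?_⟩
    · intro x hx
      obtain ⟨h1, h2⟩ := hp'.ex x hx
      refine ⟨h1, ?_⟩
      rcases h2 with h2 | h2
      · exact Or.inl h2
      · rcases List.mem_cons.1 h2 with rfl | h2
        · exact Or.inl hd
        · exact Or.inr h2
    · intro c hc
      obtain ⟨h1, h2⟩ := hp'.rb c hc
      refine ⟨h1, ?_⟩
      rcases h2 with h2 | ⟨a, ha, h2⟩
      · exact Or.inl h2
      · rcases List.mem_cons.1 ha with rfl | ha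
        · rw [← h2]
          exact Or.inl ((hf c hc h2.symm).resolve_left id)
        · exact Or.inr ⟨a, ha, h2⟩
    · rw [List.nil_append, stackPot_append]
      omega

theorem ProcOK.enqueue {op : Op α} {t : ℕ} (hp : ProcOK K H G sh Ex Rb [.enqCas op t] [] none)
    (hM : MemOK K H G sh) (ht : (sh.node root).lastTs = t) (hH : H (t + 1) = op) :
    ProcResult K H G sh Ex Rb [.enqCas op t] none (sh.enqueue op (t + 1)).1
      [.traverse (sh.enqueue op (t + 1)).2] 1 Ex Rb [] (some (t + 1, false)) := by
  have hts : (sh.enqueue op (t + 1)).2.ts = t + 1 := rfl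
  have hkeys : contents H (t + 1) = op.apply sh.keys := by
    rw [contents, hH, hM.keys, ht]
  have hdesc : (sh.enqueue op (t + 1)).2 = descOf H (t + 1) := by
    unfold Shared.enqueue descOf
    simp only [Nat.add_sub_cancel]
    rw [hkeys, hH, hM.keys, ht]
  have hnode : (sh.enqueue op (t + 1)).1.node = Function.update sh.node root
      { sh.node root with queue := (sh.node root).queue ++ [(sh.enqueue op (t + 1)).2],
                          lastTs := (sh.enqueue op (t + 1)).2.ts } := rfl
  have hlast : ((sh.enqueue op (t + 1)).1.node root).lastTs = t + 1 := by
    rw [hnode, Function.update_self]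
    rfl
  have hprog : (sh.enqueue op (t + 1)).1.prog =
      Function.update sh.prog (t + 1) ⟨[root], [], none⟩ := rfl
  obtain ⟨hM', hR⟩ := hM.insert (sh' := (sh.enqueue op (t + 1)).1) hM.root_lt hM.root_inner hnode
    rfl rfl hdesc (by rw [ht, hts]; omega)
    (by rw [hM.root_lo, hM.root_hi]; exact visits_univ _)
    (fun s h1 h2 => by rw [ht] at h1; rw [hts] at h2; omega) (fun h => absurd rfl h)
    (by rw [hlast, hkeys]; rfl)
  have hp' := hp.rely hM hR
  have hpp : progPot (sh.enqueue op (t + 1)).1 = progPot sh + 3 := by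
    unfold progPot
    rw [hlast, ht, Finset.sum_range_succ, hprog, Function.update_self]
    congr 1
    refine Finset.sum_congr rfl fun x hx => ?_
    rw [Function.update_of_ne (by have := Finset.mem_range.1 hx; omega)]
  refine ⟨hM', hR, ⟨.traverse _, hp'.ex, hp'.rb⟩, ?_, ?_,
    Or.inr ⟨op, by rw [ht]⟩, ?_⟩
  · intro s b hs
    obtain ⟨rfl, rfl⟩ := Prod.mk.inj (Option.some.inj hs)
    rw [hlast, hprog, Function.update_self]
    exact ⟨le_rfl, rfl, by simp⟩
  · intro s hs _
    rw [hprog, Function.update_of_ne (by omega)]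
    refine ⟨⟨id, id⟩, fun b hb => ?_⟩
    have := (Prod.mk.inj (Option.some.inj hb)).1
    omega
  · rw [hlast, hpp]
    simp only [stackPot_cons, stackPot_nil, Frame.pot]
    rw [if_pos ht]
    omega

/-- One step of a process. -/
theorem ProcOK.step (hp : ProcOK K H G sh Ex Rb (f :: fs) A ini) (hM : MemOK K H G sh)
    (hini : IniOK sh ini) (hG : FrameGhost G sh f)
    (hH : ∀ op t, f = .enqCas op t → (sh.node root).lastTs = t → H (t + 1) = op) :
    ∃ Ex' Rb' A' ini', ProcResult K H G sh Ex Rb (f :: fs) ini (step K sh f).1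
      ((step K sh f).2.1 ++ fs) (step K sh f).2.2 Ex' Rb' A' ini' := by
  have hs := hp.stack
  generalize hl : f :: fs = l at hs hp
  cases hs with
  | nil => cases hl
  | enqRead op =>
    obtain ⟨rfl, rfl⟩ := List.cons.inj hl
    refine ⟨Ex, Rb, [], none, hp.quiet hM rfl rfl rfl rfl (.enqCas op _) hini
      (fun t _ h => ⟨⟨id, id⟩, h⟩) ?_⟩
    simp only [WaitFreeBST.step, List.append_nil, stackPot_cons, stackPot_nil, Frame.pot, if_true]
    omega
  | enqCas op t =>
    obtain ⟨rfl, rfl⟩ := List.cons.inj hl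
    simp only [WaitFreeBST.step]
    by_cases ht : (sh.node root).lastTs = t
    · rw [if_pos ht]
      exact ⟨_, _, _, _, hp.enqueue hM ht (hH op t rfl ht)⟩
    · rw [if_neg ht]
      refine ⟨Ex, Rb, [], none, hp.quiet hM rfl rfl rfl rfl (.enqRead op) hini
        (fun t _ h => ⟨⟨id, id⟩, h⟩) ?_⟩
      simp only [List.append_nil, stackPot_cons, stackPot_nil, Frame.pot]
      rw [if_neg ht]
  | traverse D =>
    obtain ⟨rfl, rfl⟩ := List.cons.inj hl
    obtain ⟨h1, h2, -⟩ := hini _ _ rfl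
    cases htr : (sh.prog D.ts).traverse with
    | nil =>
      simp only [WaitFreeBST.step, htr]
      refine ⟨Ex, Rb, [], none, hp.quiet hM rfl rfl rfl rfl .nil (fun _ _ h => by cases h)
        (fun t _ h => ?_) ?_⟩
      · rw [modifyProg_other fun he => h false (by rw [he])]
        exact ⟨⟨id, id⟩, by simp⟩
      · have := progPot_modify_add_le sh (t := D.ts) (k := (sh.prog D.ts).processed.length)
          (fun p => { p with result := some (D.result (p.processed.map Prod.snd)) }) h1
          (by simp [Progress.pot, htr, h2])
        simp only [List.append_nil, stackPot_cons, stackPot_nil, Frame.pot]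
        omega
    | cons v l =>
      simp only [WaitFreeBST.step, htr]
      refine ⟨Ex, Rb, [], _, hp.quiet hM rfl rfl rfl rfl (.execUntil D v) ?_ (fun t _ h => ?_) ?_⟩
      · intro s b hs
        obtain ⟨rfl, rfl⟩ := Prod.mk.inj (Option.some.inj hs)
        exact ⟨h1, h2, fun _ => by simp [htr]⟩
      · refine ⟨⟨id, id⟩, fun b hb => h false ?_⟩
        rw [(Prod.mk.inj (Option.some.inj hb)).1]
      · simp only [List.append_nil, stackPot_cons, stackPot_nil, Frame.pot]
        omega
  | traversePop D =>
    obtain ⟨rfl, rfl⟩ := List.cons.inj hl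
    obtain ⟨h1, h2, h3⟩ := hini _ _ rfl
    simp only [WaitFreeBST.step]
    refine ⟨Ex, Rb, [], _, hp.quiet hM rfl rfl rfl rfl (.traverse D) ?_ (fun t _ h => ?_) ?_⟩
    · intro s b hs
      obtain ⟨rfl, rfl⟩ := Prod.mk.inj (Option.some.inj hs)
      rw [modifyProg_self]
      exact ⟨h1, h2, fun h => by cases h⟩
    · rw [modifyProg_other fun he => h true (by rw [he])]
      refine ⟨⟨id, id⟩, fun b hb => h true ?_⟩
      rw [(Prod.mk.inj (Option.some.inj hb)).1]
    · have := progPot_modify_add_le sh (t := D.ts) (k := 3)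
        (fun p => { p with traverse := p.traverse.tail }) h1 (by
          have := List.length_pos_of_ne_nil (h3 rfl)
          simp only [Progress.pot, List.length_tail]
          omega)
      simp only [List.append_nil, stackPot_cons, stackPot_nil, Frame.pot]
      omega
  | execUntil D v =>
    obtain ⟨rfl, rfl⟩ := List.cons.inj hl
    have hret : ProcResult K H G sh Ex Rb [.execUntil D v, .traversePop D] (some (D.ts, true)) sh
        [.traversePop D] 1 Ex Rb [] (some (D.ts, true)) := by
      refine hp.quiet hM rfl rfl rfl rfl (.traversePop D) hini (fun t _ h => ⟨⟨id, id⟩, h⟩) ?_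
      simp only [stackPot_cons, stackPot_nil, Frame.pot]
      omega
    cases hq : (sh.node v).queue with
    | nil =>
      simp only [WaitFreeBST.step, hq]
      exact ⟨_, _, _, _, hret⟩
    | cons E q =>
      simp only [WaitFreeBST.step, hq]
      split_ifs with hlt
      · exact ⟨_, _, _, _, hret⟩
      · exact ⟨_, _, _, _, hp.call hM hini hq rfl (by simp)⟩
  | call E u gs B A ini hseg hE hc hA hB =>
    obtain ⟨g, gs', rfl⟩ := List.exists_cons_of_ne_nil hseg.ne_nil
    obtain ⟨rfl, rfl⟩ := List.cons.inj hl
    -- Draining is the only way in which an execution starts another one. The node is then in the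
    -- subtree of the child `c'`, hence deeper than the node being executed.
    by_cases hcall : ∃ D' v' d' c' u' pls, f = .drain D' v' d' c' (.node u' :: pls) ∧
        (sh.node u').queue ≠ []
    · obtain ⟨D', v', d', c', u', pls, rfl, hq⟩ := hcall
      obtain ⟨F, q, hq⟩ := List.exists_cons_of_ne_nil hq
      cases hseg with
      | drain d todo acc c pls ht hf hv hr hpl hcov =>
        have hu : Under sh.node c' u' := hpl _ List.mem_cons_self
        obtain ⟨h1, h2, h3, h4⟩ := hu.facts hM hr hv
        have hi := (hM.node u' h1).inner_of_queue (by rw [hq]; simp)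
        rw [step_drain_call hi hq]
        have hdep := ((hM.node c' hv.lt).nonroot hv.ne_root).depth_eq
        rw [hv.par_eq] at hdep
        refine ⟨_, _, _, _, hp.call hM hini hq rfl fun a ha => ?_⟩
        rcases List.mem_cons.1 ha with rfl | ha
        · simp only
          omega
        · have := hA a ha
          omega
    · have hres := hseg.step hM hE hG fun D' v' d' c' u' pls hf => by
        by_contra hq
        exact hcall ⟨D', v', d', c', u', pls, hf, hq⟩
      obtain ⟨Rb', A', h⟩ := hp.of_seg hM hini hE hc hA hB hres
      refine ⟨Ex, Rb', A', ini, ?_⟩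
      rw [List.append_assoc] at h
      exact h

end Processes

/-! ### Uniqueness of visits along a register, and the initial memory -/

section Initial

variable {α : Type u} [LinearOrder α] {K : ℝ} {H : ℕ → Op α} {G : ℕ → Ghost} {sh sh' : Shared α}

/-- No operation is inserted into the queues of two nodes that were successively in the same child
register. -/
def Unique (H : ℕ → Op α) (G : ℕ → Ghost) (sh : Shared α) : Prop :=
  ∀ c c', c < sh.next → c' < sh.next → c ≠ root → c' ≠ root → (G c').par = (G c).par →
    (G c').dir = (G c).dir → c ≠ c' → ∀ t, (G c).birth < t → t ≤ (sh.node c).lastTs →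
    (G c').birth < t → t ≤ (sh.node c').lastTs → ¬ (sh.node (G c).par).Task (H t) (G c).dir

/-- If `t` is newly pushed to `c`, then `c` is in the register and the parent has not finished `t`.
Another node of the same register is either unlinked and untouched, or replaced, and then by `late`
it received only operations that the parent has finished. -/
theorem Unique.rely (h : Unique H G sh) (hM : MemOK K H G sh) (hR : Rely K H G sh sh') :
    Unique H G sh' := by
  have hold : ∀ c, c < sh'.next → ∀ t, (G c).birth < t → t ≤ (sh'.node c).lastTs → c < sh.next := by
    intro c hc t h1 h2
    by_contra h3
    have := hR.new c (not_lt.1 h3) hc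
    omega
  have key : ∀ c c', c < sh.next → c' < sh.next → c ≠ root → c' ≠ root →
      (G c').par = (G c).par → (G c').dir = (G c).dir → c ≠ c' → ∀ t, (sh.node c).lastTs < t →
      t ≤ (sh'.node c).lastTs → (G c').birth < t → t ≤ (sh'.node c').lastTs →
      (sh.node (G c).par).Task (H t) (G c).dir → False := by
    intro c c' hc hc' hr hr' hpar hdir hne t h1 h2 h3 h4 ht
    have hn := (hM.node c hc).nonroot hr
    have hn' := (hM.node c' hc').nonroot hr'
    obtain ⟨hi, D, hD, hch, -⟩ := hR.push c hc (by omega) hr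
    have he := hM.edge _ hn.par_lt hn.par_inner (G c).dir hn.par_root
    have hup := he.upTo
    rw [hch] at hup
    have h5 : (sh.node (G c).par).done < t := by
      by_contra h5
      exact (hup t h1 (not_lt.1 h5) ((hM.task_iff hc hr _).1 ht)).1 hi
    have h6 : (sh'.node c').lastTs = (sh.node c').lastTs := by
      by_contra h6
      obtain ⟨-, -, -, hch', -⟩ := hR.push c' hc' h6 hr'
      rw [hpar, hdir, hch] at hch'
      exact hne hch'
    have h7 := hn'.late (by rw [hpar, hdir, hch]; exact hne) (by omega)
    rw [hpar] at h7
    omega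
  intro c c' hc hc' hr hr' hpar hdir hne t h1 h2 h3 h4 ht
  have hc := hold c hc t h1 h2
  have hc' := hold c' hc' t h3 h4
  rw [hR.task ((hM.node c hc).nonroot hr).par_lt] at ht
  rcases lt_or_ge (sh.node c).lastTs t with h5 | h5
  · exact key c c' hc hc' hr hr' hpar hdir hne t h5 h2 h3 h4 ht
  rcases lt_or_ge (sh.node c').lastTs t with h6 | h6
  · exact key c' c hc' hc hr' hr hpar.symm hdir.symm hne.symm t h6 h4 h1 h2
      (by rw [hpar, hdir]; exact ht)
  · exact h c c' hc hc' hr hr' hpar hdir hne t h1 h5 h3 h6 ht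

/-- The ghost attributes of the nodes of the initial memory. -/
def initGhost (v : ℕ) : Ghost := ⟨root, .left, v, 0⟩

theorem init_lt {α : Type u} {v : ℕ} (hv : v < (Shared.init (α := α)).next) : v = root ∨ v = 1 := by
  have : v < 2 := hv
  unfold root
  omega

theorem MemOK.init (hG : ∀ v < 2, G v = initGhost v) : MemOK K H G (Shared.init (α := α)) := by
  have g0 : G root = initGhost root := hG 0 (by omega)
  have g1 : G 1 = initGhost 1 := hG 1 (by omega)
  have n0 : (Shared.init (α := α)).node root = ⟨.inner ⊤ 0, ⊥, ⊤, 1, 1, ⟨0, 0, 0⟩, [], 0⟩ := by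
    simp [Shared.init]
  have n1 : (Shared.init (α := α)).node 1 = ⟨.empty, ⊥, ⊤, 0, 0, ⟨0, 0, 0⟩, [], 0⟩ := by
    simp [Shared.init, root]
  have hq : ∀ v, ((Shared.init (α := α)).node v).queue = [] := fun v => by
    simp only [Shared.init]; split_ifs <;> rfl
  have hl : ∀ v, ((Shared.init (α := α)).node v).lastTs = 0 := fun v => by
    simp only [Shared.init]; split_ifs <;> rfl
  have hd : ∀ v, ((Shared.init (α := α)).node v).done = 0 := fun v => by
    rw [Node.done_of_nil (hq v), hl]
  have hbirth : ∀ v, v = root ∨ v = 1 → (G v).birth = 0 := by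
    rintro v (rfl | rfl)
    · rw [g0]; rfl
    · rw [g1]; rfl
  refine { root_lt := by simp [Shared.init, root], root_body := by rw [n0],
           root_lo := by rw [n0], root_hi := by rw [n0], root_birth := by rw [g0]; rfl,
           root_depth := by rw [g0]; rfl, node := ?_, edge := ?_, queue_nil := fun v _ => hq v,
           keys := by rw [n0]; rfl, visits := ?_ }
  · intro v hv
    have hv := init_lt hv
    refine { leaf := ?_, birth_le := by rw [hbirth v hv]; exact Nat.zero_le _,
             lastTs_le := by rw [hl, hl], range := ?_, sorted := by rw [hq]; exact List.Pairwise.nil,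
             mem := by rw [hq]; simp, complete := fun t h1 h2 => by rw [hd] at h1; rw [hl] at h2; omega,
             nonroot := ?_ }
    · intro hi
      rcases hv with rfl | rfl
      · rw [n0] at hi; exact absurd trivial hi
      · rw [n1, g1]
        exact ⟨rfl, rfl, rfl, by simp [Body.keys, initGhost, contents, keysIn]⟩
    · intro hi d
      rcases hv with rfl | rfl
      · rw [n0]; cases d <;> simp [Node.childRange]
      · rw [n1] at hi; exact hi.elim
    · intro hr
      obtain rfl := hv.resolve_left hr
      refine { par_lt := ?_, par_inner := ?_, par_root := ?_, lo_eq := ?_, hi_eq := ?_,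
               depth_eq := ?_, birth_par := ?_, tsMod_le := ?_, lastTs_le_tsMod := ?_,
               inner := ?_, late := ?_ } <;> try rw [g1]
      · simp [Shared.init, root, initGhost]
      · simp only [initGhost]; rw [n0]; trivial
      · exact fun _ => rfl
      · simp only [initGhost]; rw [n0, n1]; rfl
      · simp only [initGhost]; rw [n0, n1]; rfl
      · simp only [initGhost]; rw [g0]; rfl
      · simp only [initGhost]; rw [g0]; rfl
      · rw [n1]; exact Nat.zero_le _
      · rw [n1]
      · rw [n1]; exact fun h => h.elim
      · intro _ h; rw [n1] at h; exact absurd h (by simp [initGhost])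
  · intro u hu hi d hdl
    rcases init_lt hu with rfl | rfl
    · obtain rfl := hdl rfl
      have hc : ((Shared.init (α := α)).node root).child .left = 1 := by rw [n0]; rfl
      refine { lt := ?_, ne_root := ?_, par_eq := ?_, dir_eq := ?_, upTo := ?_ } <;> rw [hc]
      · simp [Shared.init]
      · simp [root]
      · rw [g1]; rfl
      · rw [g1]; rfl
      · intro t h1 h2
        rw [hl] at h1
        rw [hd] at h2
        omega
    · rw [n1] at hi; exact hi.elim
  · refine (Finset.sum_eq_zero fun v hv => ?_).symm
    have hv := init_lt (α := α) (Finset.mem_range.1 hv)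
    simp [visitCount, hl]

theorem Unique.init : Unique H G (Shared.init (α := α)) := by
  intro c c' hc hc' hr hr' _ _ hne
  have h1 := (init_lt hc).resolve_left hr
  have h2 := (init_lt hc').resolve_left hr'
  exact absurd (h1.trans h2.symm) hne

end Initial

/-! ### Invariants of configurations: total potential and waiting operations -/

section Configurations

variable {α : Type u} [LinearOrder α] {P : Type v} [Fintype P] {K : ℝ} {H : ℕ → Op α}
  {G : ℕ → Ghost}

theorem sum_apply_update [DecidableEq P] {β M : Type*} [AddCommMonoid M] (g : P → β) (p : P) (x : β)
    (F : P → β → M) : ∑ q, F q (Function.update g p x q) =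
      F p x + ∑ q ∈ Finset.univ.erase p, F q (g q) := by
  rw [← Finset.add_sum_erase _ _ (Finset.mem_univ p), Function.update_self]
  congr 1
  exact Finset.sum_congr rfl fun q hq => by
    rw [Function.update_of_ne (Finset.ne_of_mem_erase hq)]

/-- The frames of an operation without a timestamp. -/
def Frame.isStart {α : Type u} : Frame α → Bool
  | .enqRead _ => true
  | .enqCas _ _ => true
  | _ => false

/-- A bound for the logarithm of the size of the tree when an operation gets its timestamp, while it
waits for it. -/
noncomputable def waitPot (n k : ℕ) {α : Type u} (fs : List (Frame α)) : ℝ :=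
  if fs.any Frame.isStart then Real.log (k + 1) + 2 + n else 0

theorem waitPot_of_not {n k : ℕ} {α : Type u} {fs : List (Frame α)}
    (h : ¬ fs.any Frame.isStart) : waitPot n k fs = 0 := if_neg h

theorem waitPot_of_start {n k : ℕ} {α : Type u} {fs : List (Frame α)}
    (h : fs.any Frame.isStart) : waitPot n k fs = Real.log (k + 1) + 2 + n := if_pos h

/-- Invariants of a configuration. -/
structure ConfigOK (K : ℝ) (H : ℕ → Op α) (G : ℕ → Ghost) (w : Config α P)
    (Ex : P → Finset (ℕ × ℕ)) (Rb : P → Finset ℕ) (A : P → List (ℕ × ℕ))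
    (ini : P → Option (ℕ × Bool)) : Prop where
  mem : MemOK K H G w.sh
  unique : Unique H G w.sh
  proc : ∀ p, ProcOK K H G w.sh (Ex p) (Rb p) (w.proc p) (A p) (ini p)
  own : ∀ p, IniOK w.sh (ini p)
  distinct : ∀ p q t b b', ini p = some (t, b) → ini q = some (t, b') → p = q
  pot : w.cost + ∑ p, stackPot w.sh (w.proc p) + progPot w.sh ≤
    20 * ∑ p, (Ex p).card + 10 * ∑ p, ∑ c ∈ Rb p, (w.sh.node c).weight +
      8 * (Fintype.card P * (w.sh.node root).lastTs) + 2 * w.startSizes.length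
  sizes : ∑ t ∈ Finset.range (w.sh.node root).lastTs,
      (Real.log ((contents H (t + 1)).card + 1) + 1) +
      ∑ p, waitPot (Fintype.card P) w.sh.keys.card (w.proc p) ≤
    (w.startSizes.map fun N : ℕ => Real.log (N + 1) + 2 + Fintype.card P).sum

theorem StackOK.of_nil {sh : Shared α} {Rb : Finset ℕ} {A : List (ℕ × ℕ)}
    {ini : Option (ℕ × Bool)} (hs : StackOK K H G sh Rb [] A ini) : A = [] ∧ ini = none := by
  generalize hl : [] = l at hs
  cases hs with
  | nil => exact ⟨rfl, rfl⟩
  | call E u fs B A ini hs => 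
    exact absurd (List.append_eq_nil_iff.1 hl.symm).1 hs.ne_nil
  | _ => cases hl

theorem ConfigOK.init (hG : ∀ v < 2, G v = initGhost v) :
    ConfigOK (α := α) (P := P) K H G ⟨Shared.init, fun _ => [], 0, []⟩ (fun _ => ∅) (fun _ => ∅)
      (fun _ => []) (fun _ => none) where
  mem := .init hG
  unique := .init
  proc p := ⟨.nil, by simp, by simp⟩
  own p t b h := by cases h
  distinct p q t b b' h := by cases h
  pot := by simp [progPot, Shared.init, Progress.pot]
  sizes := by simp [Shared.init, waitPot]

theorem ConfigOK.start [DecidableEq P] {w : Config α P} {Ex : P → Finset (ℕ × ℕ)}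
    {Rb : P → Finset ℕ} {A : P → List (ℕ × ℕ)} {ini : P → Option (ℕ × Bool)}
    (h : ConfigOK K H G w Ex Rb A ini) (p : P) (op : Op α) (hp : w.proc p = []) :
    ConfigOK K H G ⟨w.sh, Function.update w.proc p [.enqRead op], w.cost,
      w.sh.keys.card :: w.startSizes⟩ Ex Rb A ini where
  mem := h.mem
  unique := h.unique
  proc q := by
    have hq := h.proc q
    rcases eq_or_ne q p with rfl | hqp
    · simp only [Function.update_self]
      refine ⟨?_, hq.ex, hq.rb⟩
      have hs := hq.stack
      rw [hp] at hs
      obtain ⟨h1, h2⟩ := hs.of_nil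
      rw [h1, h2]
      exact .enqRead op
    · simp only [Function.update_of_ne hqp]
      exact hq
  own := h.own
  distinct := h.distinct
  pot := by
    have h1 := h.pot
    simp only [List.length_cons]
    rw [← Finset.add_sum_erase _ _ (Finset.mem_univ p)] at h1
    rw [sum_apply_update w.proc p _ fun _ fs => stackPot w.sh fs]
    rw [hp] at h1
    simp only [stackPot_cons, stackPot_nil, Frame.pot] at h1 ⊢
    omega
  sizes := by
    have h1 := h.sizes
    simp only [List.map_cons, List.sum_cons]
    rw [← Finset.add_sum_erase _ _ (Finset.mem_univ p)] at h1
    rw [sum_apply_update w.proc p _ fun _ fs => waitPot (Fintype.card P) w.sh.keys.card fs]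
    rw [hp, waitPot_of_not (by simp)] at h1
    rw [waitPot_of_start (by simp [Frame.isStart])]
    linarith

theorem card_apply_le (op : Op α) (S : Finset α) : (op.apply S).card ≤ S.card + 1 := by
  cases op with
  | insert k => exact Finset.card_insert_le _ _
  | remove k => exact (Finset.card_erase_le).trans (Nat.le_succ _)
  | _ => exact Nat.le_succ _

theorem log_add_two_le {a b : ℕ} (h : a ≤ b + 1) :
    Real.log ((a : ℝ) + 1) ≤ Real.log ((b : ℝ) + 1) + 1 := by
  have hb : (0 : ℝ) < (b : ℝ) + 1 := by positivity
  have h1 : Real.log ((a : ℝ) + 1) ≤ Real.log (2 * ((b : ℝ) + 1)) := by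
    refine Real.log_le_log (by positivity) ?_
    have : (a : ℝ) ≤ b + 1 := by exact_mod_cast h
    have : (0 : ℝ) ≤ b := by positivity
    linarith
  rw [Real.log_mul (by norm_num) hb.ne'] at h1
  have := Real.log_two_lt_d9
  linarith

/-- Steps other than insertions of operations into the root queue. -/
theorem step_quiet {sh : Shared α} {f : Frame α}
    (hf : ∀ op t, f = .enqCas op t → (sh.node root).lastTs ≠ t) :
    (step K sh f).1.keys = sh.keys ∧
      ((step K sh f).2.1.any Frame.isStart) = f.isStart := by
  cases f with
  | enqRead op => exact ⟨rfl, rfl⟩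
  | enqCas op t =>
    simp only [step]
    rw [if_neg (hf op t rfl)]
    exact ⟨rfl, rfl⟩
  | traverse D =>
    simp only [step]
    split <;> exact ⟨rfl, rfl⟩
  | traversePop D => exact ⟨rfl, rfl⟩
  | execUntil D v =>
    simp only [step]
    split
    · exact ⟨rfl, rfl⟩
    · split_ifs <;> exact ⟨rfl, rfl⟩
  | exec D v todo acc =>
    match todo with
    | [] => exact ⟨rfl, rfl⟩
    | (d, a) :: todo => exact ⟨rfl, rfl⟩
  | look D v d a todo acc c =>
    cases a with
    | add => exact ⟨rfl, rfl⟩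
    | visit =>
      refine ⟨rfl, ?_⟩
      simp only [step, visitChild]
      split <;> split_ifs <;> rfl
  | pushTraverse D c => exact ⟨rfl, rfl⟩
  | casState D c s => rw [step_casState]; split_ifs <;> exact ⟨rfl, rfl⟩
  | pushIf D c =>
    simp only [step, Shared.pushIf]
    split_ifs <;> exact ⟨rfl, rfl⟩
  | popIf D v =>
    simp only [step, Shared.popIf]
    refine ⟨?_, rfl⟩
    split
    · rfl
    · split_ifs <;> rfl
  | drain D v d c todo =>
    match todo with
    | [] => exact ⟨rfl, rfl⟩
    | .edge u e :: todo => exact ⟨rfl, rfl⟩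
    | .node u :: todo =>
      simp only [step]
      split
      · split <;> exact ⟨rfl, rfl⟩
      · exact ⟨rfl, rfl⟩
  | collect D v d c todo keys =>
    match todo with
    | [] => exact ⟨rfl, rfl⟩
    | .edge u e :: todo => exact ⟨rfl, rfl⟩
    | .node u :: todo =>
      simp only [step]
      split <;> exact ⟨rfl, rfl⟩
  | build D v d c ts keys =>
    simp only [step]
    exact ⟨(alloc_spec ts (ideal keys) _ _ sh).2.2.2.2.1, rfl⟩
  | swing v d c nv => rw [step_swing]; split_ifs <;> exact ⟨rfl, rfl⟩

theorem step_enqCas_lastTs {sh : Shared α} {op : Op α} {t : ℕ} (ht : (sh.node root).lastTs = t) :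
    ((step K sh (.enqCas op t)).1.node root).lastTs = t + 1 := by
  simp only [step]
  rw [if_pos ht]
  simp [Shared.enqueue, Shared.push, Shared.modifyNode, Shared.modifyProg]

theorem ConfigOK.step [DecidableEq P] {w : Config α P} {Ex : P → Finset (ℕ × ℕ)}
    {Rb : P → Finset ℕ} {A : P → List (ℕ × ℕ)} {ini : P → Option (ℕ × Bool)}
    (h : ConfigOK K H G w Ex Rb A ini) {p : P} {f : Frame α} {fs : List (Frame α)}
    (hp : w.proc p = f :: fs) (hG : FrameGhost G w.sh f)
    (hH : ∀ op t, f = .enqCas op t → (w.sh.node root).lastTs = t → H (t + 1) = op) :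
    ∃ Ex' Rb' A' ini', ConfigOK K H G ⟨(step K w.sh f).1,
        Function.update w.proc p ((step K w.sh f).2.1 ++ fs), w.cost + (step K w.sh f).2.2,
        w.startSizes⟩ Ex' Rb' A' ini' := by
  have hproc := h.proc p
  rw [hp] at hproc
  obtain ⟨Ex', Rb', A', ini', hr⟩ := hproc.step h.mem (h.own p) hG hH
  have hR := hr.rely
  refine ⟨Function.update Ex p Ex', Function.update Rb p Rb', Function.update A p A',
    Function.update ini p ini', hr.mem, h.unique.rely h.mem hR, ?_, ?_, ?_, ?_, ?_⟩
  · intro q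
    rcases eq_or_ne q p with rfl | hqp
    · simp only [Function.update_self]
      exact hr.proc
    · simp only [Function.update_of_ne hqp]
      exact (h.proc q).rely h.mem hR
  · intro q
    rcases eq_or_ne q p with rfl | hqp
    · simp only [Function.update_self]
      exact hr.own
    · simp only [Function.update_of_ne hqp]
      refine (h.own q).rely h.mem hR fun t b ht => (hr.other t (h.own q t b ht).1 ?_).1
      intro b' hb'
      exact hqp (h.distinct q p t b b' ht hb')
  · have key : ∀ q, q ≠ p → ∀ t b b', ini q = some (t, b) → ini' ≠ some (t, b') := by
      intro q hqp t b b' ht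
      refine (hr.other t (h.own q t b ht).1 ?_).2 b'
      intro b' hb'
      exact hqp (h.distinct q p t b b' ht hb')
    intro q q' t b b' h1 h2
    rcases eq_or_ne q p with hqp | hqp <;> rcases eq_or_ne q' p with hqp' | hqp'
    · exact hqp.trans hqp'.symm
    · subst hqp
      simp only [Function.update_self, Function.update_of_ne hqp'] at h1 h2
      exact absurd h1 (key q' hqp' t b' b h2)
    · subst hqp'
      simp only [Function.update_self, Function.update_of_ne hqp] at h1 h2
      exact absurd h2 (key q hqp t b b' h1)
    · simp only [Function.update_of_ne hqp, Function.update_of_ne hqp'] at h1 h2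
      exact h.distinct q q' t b b' h1 h2
  · have h1 := h.pot
    have h2 := hr.pot
    have hw : ∀ q, ∑ c ∈ Rb q, ((WaitFreeBST.step K w.sh f).1.node c).weight =
        ∑ c ∈ Rb q, (w.sh.node c).weight := fun q => Finset.sum_congr rfl fun c hc => by
      obtain ⟨⟨D, d, v, h3, h4⟩, -⟩ := (h.proc q).rb c hc
      exact h4.weight_rely h.mem hR h3
    have hlast := hR.lastTs_le root h.mem.root_lt
    obtain ⟨δ, hδ⟩ := Nat.exists_eq_add_of_le hlast
    -- A new timestamp may spoil one pending CAS of every other process.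
    have hs : ∑ q ∈ Finset.univ.erase p,
          stackPot (WaitFreeBST.step K w.sh f).1 (w.proc q) ≤
        ∑ q ∈ Finset.univ.erase p, stackPot w.sh (w.proc q) +
          (Finset.univ.erase p).card * (2 * δ) := by
      rw [← smul_eq_mul, ← Finset.sum_const, ← Finset.sum_add_distrib]
      refine Finset.sum_le_sum fun q _ => ?_
      have := (h.proc q).stack.pot_rely h.mem hR
      omega
    have hcard : Fintype.card P = (Finset.univ.erase p).card + 1 := by
      rw [Finset.card_erase_add_one (Finset.mem_univ p), Finset.card_univ]
    rw [← Finset.add_sum_erase _ _ (Finset.mem_univ p),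
      ← Finset.add_sum_erase _ _ (Finset.mem_univ p),
      ← Finset.add_sum_erase _ _ (Finset.mem_univ p)] at h1
    rw [sum_apply_update w.proc p _ fun _ fs => stackPot (WaitFreeBST.step K w.sh f).1 fs,
      sum_apply_update Ex p Ex' fun _ x => x.card,
      sum_apply_update Rb p Rb' fun _ x => ∑ c ∈ x, ((WaitFreeBST.step K w.sh f).1.node c).weight,
      Finset.sum_congr (s₁ := Finset.univ.erase p) rfl fun q _ => hw q]
    rw [hw] at h2
    rw [hp] at h1
    rw [hδ] at h2 ⊢
    rw [Nat.add_sub_cancel_left] at h2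
    rw [hcard] at h1 ⊢
    have e1 : ((Finset.univ.erase p).card + 1) * ((w.sh.node root).lastTs + δ) =
        ((Finset.univ.erase p).card + 1) * (w.sh.node root).lastTs +
          (Finset.univ.erase p).card * δ + δ := by ring
    have e2 : (Finset.univ.erase p).card * (2 * δ) = 2 * ((Finset.univ.erase p).card * δ) := by ring
    rw [e1]
    rw [e2] at hs
    simp only at h2 ⊢
    omega
  · have h1 := h.sizes
    rcases hr.tail with hlast | ⟨op, hf⟩
    · have hf' : ∀ op t, f = .enqCas op t → (w.sh.node root).lastTs ≠ t := by
        rintro op t rfl ht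
        have h2 := step_enqCas_lastTs (K := K) (op := op) ht
        omega
      obtain ⟨hk, ha⟩ := step_quiet (K := K) hf'
      simp only [hlast, hk]
      rw [← Finset.add_sum_erase _ _ (Finset.mem_univ p)] at h1
      rw [sum_apply_update w.proc p _ fun _ fs => waitPot (Fintype.card P) w.sh.keys.card fs]
      have he : waitPot (Fintype.card P) w.sh.keys.card ((WaitFreeBST.step K w.sh f).2.1 ++ fs) =
          waitPot (Fintype.card P) w.sh.keys.card (w.proc p) := by
        unfold waitPot
        rw [hp, List.any_append, ha, List.any_cons]
      rw [he]
      exact h1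
    · obtain ⟨t, ht⟩ : ∃ t, (w.sh.node root).lastTs = t := ⟨_, rfl⟩
      rw [ht] at hf
      obtain ⟨rfl, rfl⟩ := List.cons.inj hf
      have hst : WaitFreeBST.step K w.sh (.enqCas op t) =
          ((w.sh.enqueue op (t + 1)).1, [.traverse (w.sh.enqueue op (t + 1)).2], 1) := by
        simp only [WaitFreeBST.step]
        rw [if_pos ht]
      rw [hst]
      have hlast : ((w.sh.enqueue op (t + 1)).1.node root).lastTs = t + 1 := by
        simp [Shared.enqueue, Shared.push, Shared.modifyNode, Shared.modifyProg]
      have hkeys : (w.sh.enqueue op (t + 1)).1.keys = contents H (t + 1) := by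
        simp only [Shared.enqueue]
        rw [contents, hH op t rfl ht, h.mem.keys, ht]
      have hc : (contents H (t + 1)).card ≤ w.sh.keys.card + 1 := by
        rw [← hkeys]
        exact card_apply_le op _
      have hlog := log_add_two_le hc
      simp only [hlast, hkeys]
      rw [Finset.sum_range_succ]
      rw [ht] at h1
      -- The operation adds at most one key, so the logarithm in the potential of every other
      -- waiting process rises by at most `1`.
      have hs : ∑ q ∈ Finset.univ.erase p,
            waitPot (Fintype.card P) (contents H (t + 1)).card (w.proc q) ≤
          ∑ q ∈ Finset.univ.erase p, waitPot (Fintype.card P) w.sh.keys.card (w.proc q) +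
            ((Finset.univ.erase p).card : ℝ) := by
        rw [← nsmul_one, ← Finset.sum_const, ← Finset.sum_add_distrib]
        refine Finset.sum_le_sum fun q _ => ?_
        unfold waitPot
        split_ifs
        · linarith
        · norm_num
      have hcard : (Fintype.card P : ℝ) = ((Finset.univ.erase p).card : ℝ) + 1 := by
        exact_mod_cast (Finset.card_erase_add_one (Finset.mem_univ p)).symm
      rw [← Finset.add_sum_erase _ _ (Finset.mem_univ p)] at h1
      rw [sum_apply_update w.proc p _ fun _ fs =>
        waitPot (Fintype.card P) (contents H (t + 1)).card fs]
      rw [hp, waitPot_of_start (by simp [Frame.isStart])] at h1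
      rw [waitPot_of_not (by simp [Frame.isStart])]
      linarith

end Configurations

/-! ### Construction of the history along an execution -/

section Executions

variable {α : Type u} [LinearOrder α] {P : Type v} {K : ℝ}

/-- The degenerate case without processes or without operations; otherwise there is an operation to
fill the timestamps not yet given. -/
theorem Reachable.eq_init [DecidableEq P] {w : Config α P} (hw : Reachable K w)
    (h : P → Op α → False) : w = ⟨Shared.init, fun _ => [], 0, []⟩ := by
  induction hw with
  | init => rfl
  | start w p op => exact (h p op).elim
  | step w p f fs _ hp ih =>
    subst ih
    cases hp

variable [Fintype P]  {H : ℕ → Op α} {G : ℕ → Ghost}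

theorem StackOK.build_lt {sh : Shared α} {Rb : Finset ℕ} {A : List (ℕ × ℕ)}
    {ini : Option (ℕ × Bool)} {D : Desc α} {v c ts : ℕ} {d : Dir} {keys : List α}
    {fs : List (Frame α)} (hs : StackOK K H G sh Rb (.build D v d c ts keys :: fs) A ini) :
    v < sh.next := by
  generalize hl : Frame.build D v d c ts keys :: fs = l at hs
  cases hs with
  | call E u gs B A ini hs hE =>
    cases hs <;> cases hl <;> exact hE.lt
  | _ => cases hl

/-- The history and the attributes of nodes after a step. -/
theorem ConfigOK.exists_extension {w : Config α P} {Ex : P → Finset (ℕ × ℕ)}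
    {Rb : P → Finset ℕ} {A : P → List (ℕ × ℕ)} {ini : P → Option (ℕ × Bool)}
    (h : ConfigOK K H G w Ex Rb A ini) {p : P} {f : Frame α} {fs : List (Frame α)}
    (hp : w.proc p = f :: fs) : ∃ (H₁ : ℕ → Op α) (G₁ : ℕ → Ghost), ∀ (H' : ℕ → Op α) (G' : ℕ → Ghost),
      (∀ t ≤ ((WaitFreeBST.step K w.sh f).1.node root).lastTs, H' t = H₁ t) →
      (∀ v < (WaitFreeBST.step K w.sh f).1.next, G' v = G₁ v) →
      (∀ t ≤ (w.sh.node root).lastTs, H' t = H t) ∧ (∀ v < w.sh.next, G' v = G v) ∧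
      FrameGhost G' w.sh f ∧
      ∀ op t, f = .enqCas op t → (w.sh.node root).lastTs = t → H' (t + 1) = op := by
  have hproc := h.proc p
  rw [hp] at hproc
  by_cases hb : ∃ D v d c ts keys, f = .build D v d c ts keys
  · obtain ⟨D, v, d, c, ts, keys, rfl⟩ := hb
    have hv := hproc.stack.build_lt
    obtain ⟨G₁, h1, h2⟩ := (ideal keys).exists_ghostAt ts G w.sh.next v d ((G v).depth + 1)
    obtain ⟨a1, -, a3, -⟩ := alloc_spec ts (ideal keys) ((w.sh.node v).childRange d).1
      ((w.sh.node v).childRange d).2 w.sh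
    refine ⟨H, G₁, fun H' G' hH hG => ⟨fun t ht => hH t ?_, fun x hx => ?_, ?_, ?_⟩⟩
    · simp only [WaitFreeBST.step]
      rw [a3 root (Or.inl h.mem.root_lt)]
      exact ht
    · rw [hG x (by simp only [WaitFreeBST.step]; omega), h1 x (Or.inl hx)]
    · have hv' : G' v = G v := by
        rw [hG v (by simp only [WaitFreeBST.step]; omega), h1 v (Or.inl hv)]
      simp only [FrameGhost]
      rw [hv']
      exact h2.congr fun x h3 h4 => hG x (by simp only [WaitFreeBST.step]; omega)
    · rintro op t hf
      cases hf
  by_cases he : ∃ op t, f = .enqCas op t ∧ (w.sh.node root).lastTs = t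
  · obtain ⟨op, t, rfl, ht⟩ := he
    have hlast := step_enqCas_lastTs (K := K) (op := op) ht
    have hnext : (WaitFreeBST.step K w.sh (.enqCas op t)).1.next = w.sh.next := by
      simp only [WaitFreeBST.step]
      rw [if_pos ht]
      rfl
    refine ⟨Function.update H (t + 1) op, G, fun H' G' hH hG => ⟨fun s hs => ?_, fun x hx => ?_,
      trivial, ?_⟩⟩
    · rw [hH s (by omega), Function.update_of_ne (by omega)]
    · exact hG x (by rw [hnext]; exact hx)
    · intro op' t' hf _
      cases hf
      rw [hH (t + 1) (by omega), Function.update_self]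
  · have hfg : ∀ G', FrameGhost G' w.sh f := by
      intro G'
      cases f with
      | build D v d c ts keys => exact absurd ⟨D, v, d, c, ts, keys, rfl⟩ hb
      | _ => trivial
    have hfh : ∀ H' : ℕ → Op α, ∀ op t, f = .enqCas op t → (w.sh.node root).lastTs = t →
        H' (t + 1) = op := fun _ op t h1 h2 => absurd ⟨op, t, h1, h2⟩ he
    obtain ⟨Ex', Rb', A', ini', hr⟩ := hproc.step h.mem (h.own p) (hfg G) (hfh H)
    have hR := hr.rely
    refine ⟨H, G, fun H' G' hH hG => ⟨fun t ht => hH t ?_, fun x hx => hG x ?_, hfg G', hfh H'⟩⟩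
    · exact ht.trans (hR.lastTs_le root h.mem.root_lt)
    · exact hx.trans_le hR.next_le

/-- Reachable configurations satisfy the invariants, for some history and attributes of nodes. -/
theorem Reachable.exists_configOK [DecidableEq P] (op₀ : Op α) {w : Config α P} (hw : Reachable K w) :
    ∃ (H₀ : ℕ → Op α) (G₀ : ℕ → Ghost), ∀ H G, (∀ t ≤ (w.sh.node root).lastTs, H t = H₀ t) →
      (∀ v < w.sh.next, G v = G₀ v) → ∃ Ex Rb A ini, ConfigOK K H G w Ex Rb A ini := by
  induction hw with
  | init =>
    exact ⟨fun _ => op₀, initGhost, fun H G _ hG => ⟨_, _, _, _, .init hG⟩⟩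
  | start w p op _ hp ih =>
    obtain ⟨H₀, G₀, h⟩ := ih
    refine ⟨H₀, G₀, fun H G hH hG => ?_⟩
    obtain ⟨Ex, Rb, A, ini, h⟩ := h H G hH hG
    exact ⟨Ex, Rb, A, ini, h.start p op hp⟩
  | step w p f fs _ hp ih =>
    obtain ⟨H₀, G₀, h⟩ := ih
    -- The induction hypothesis covers all histories and attributes that agree on the part used so
    -- far. One instance serves to read off how this step extends them; the hypothesis is then
    -- applied again to the extension.
    obtain ⟨Ex₀, Rb₀, A₀, ini₀, h₀⟩ := h H₀ G₀ (fun _ _ => rfl) fun _ _ => rfl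
    obtain ⟨H₁, G₁, h₁⟩ := h₀.exists_extension hp
    refine ⟨H₁, G₁, fun H G hH hG => ?_⟩
    obtain ⟨h2, h3, h4, h5⟩ := h₁ H G hH hG
    obtain ⟨Ex, Rb, A, ini, hc⟩ := h H G h2 h3
    exact hc.step hp h4 h5

end Executions

/-! ### Nodes visited by one operation, and decrease of weights with the depth -/

section Visits

variable {α : Type u} [LinearOrder α] {K : ℝ} {H : ℕ → Op α} {G : ℕ → Ghost} {sh : Shared α}
  {v p t : ℕ}

/-- The operation with timestamp `t` has been inserted into the queue of `v`. -/
structure Visited (H : ℕ → Op α) (G : ℕ → Ghost) (sh : Shared α) (t v : ℕ) : Prop where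
  lt : v < sh.next
  birth_lt : (G v).birth < t
  le_lastTs : t ≤ (sh.node v).lastTs
  visits : (H t).Visits (sh.node v).lo (sh.node v).hi

theorem Visited.inner (h : Visited H G sh t v) (hM : MemOK K H G sh) :
    (sh.node v).body.IsInner := by
  by_contra hi
  have := ((hM.node v h.lt).leaf hi).2.1
  have := h.birth_lt
  have := h.le_lastTs
  omega

/-- The tail of a node is at most its `tsMod`, which is at most the tail of the parent, while ranges
and births only widen upwards. So the visited nodes are closed under parents, replaced nodes
included. -/
theorem Visited.par (h : Visited H G sh t v) (hM : MemOK K H G sh) (hr : v ≠ root) :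
    Visited H G sh t (G v).par := by
  have hn := (hM.node v h.lt).nonroot hr
  have hrg := hM.range_of_par h.lt hr
  exact ⟨hn.par_lt, hn.birth_par.trans_lt h.birth_lt,
    h.le_lastTs.trans (hn.lastTs_le_tsMod.trans hn.tsMod_le), h.visits.mono hrg.1 hrg.2⟩

theorem Visited.eq (h : Visited H G sh t v) {v' : ℕ} (h' : Visited H G sh t v')
    (hM : MemOK K H G sh) (hU : Unique H G sh) (hr : v ≠ root) (hr' : v' ≠ root)
    (hp : (G v').par = (G v).par) (hd : (G v').dir = (G v).dir) : v = v' := by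
  by_contra hne
  exact hU v v' h.lt h'.lt hr hr' hp hd hne t h.birth_lt h.le_lastTs h'.birth_lt h'.le_lastTs
    ((hM.task_iff h.lt hr _).2 h.visits)

/-- Properties of intervals that hold for the nodes of a path from the root. -/
structure Cut (C : Bound α → Bound α → Prop) : Prop where
  mono : ∀ {lo hi lo' hi'}, C lo hi → lo' ≤ lo → hi ≤ hi' → C lo' hi'
  disjoint : ∀ {lo r hi}, C lo r → ¬ C r hi

theorem cut_key (k : α) : Cut fun lo hi => lo ≤ bd k ∧ bd k < hi where
  mono h h1 h2 := ⟨h1.trans h.1, h.2.trans_le h2⟩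
  disjoint h h' := absurd h.2 (not_lt.2 h'.1)

theorem cut_left (a : α) : Cut fun lo hi => lo < bd a ∧ bd a < hi where
  mono h h1 h2 := ⟨h1.trans_lt h.1, h.2.trans_le h2⟩
  disjoint h h' := absurd h.2 (not_lt.2 h'.1.le)

/-- A range that meets `[a, b]` without lying in it has `a` in its interior or contains `b`. An
operation with one key needs a single point. -/
theorem Op.exists_cuts (op : Op α) : ∃ C₁ C₂ : Bound α → Bound α → Prop, Cut C₁ ∧ Cut C₂ ∧
    ∀ lo hi, op.Visits lo hi → C₁ lo hi ∨ C₂ lo hi := by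
  cases op with
  | count a b =>
    refine ⟨_, _, cut_left a, cut_key b, fun lo hi h => ?_⟩
    obtain ⟨h1, h2⟩ := h
    rw [not_or, not_le, not_lt] at h1
    rw [not_and_or, not_le, not_le] at h2
    exact h2.imp (fun h => ⟨h, h1.1⟩) fun h => ⟨h1.2, h⟩
  | insert k => exact ⟨_, _, cut_key k, cut_key k, fun _ _ h => Or.inl h⟩
  | remove k => exact ⟨_, _, cut_key k, cut_key k, fun _ _ h => Or.inl h⟩
  | contains k => exact ⟨_, _, cut_key k, cut_key k, fun _ _ h => Or.inl h⟩

theorem MemOK.depth_zero (hM : MemOK K H G sh) (hv : v < sh.next) (hd : (G v).depth = 0) :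
    v = root := by
  by_contra hr
  have := ((hM.node v hv).nonroot hr).depth_eq
  omega

theorem Cut.dir_eq {C : Bound α → Bound α → Prop} (hC : Cut C) {n : Node α}
    (hn : n.body.IsInner) {d e : Dir} (h1 : C (n.childRange d).1 (n.childRange d).2)
    (h2 : C (n.childRange e).1 (n.childRange e).2) : d = e := by
  obtain ⟨r, i, hb⟩ := Body.isInner_iff.1 hn
  cases d <;> cases e <;> simp only [Node.childRange, hb] at h1 h2
  · rfl
  · exact absurd h2 (hC.disjoint h1)
  · exact absurd h1 (hC.disjoint h2)
  · rfl

/-- An operation visits at most one node of each depth on a path. -/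
theorem Visited.eq_of_cut {C : Bound α → Bound α → Prop} (hC : Cut C) (hM : MemOK K H G sh)
    (hU : Unique H G sh) (δ : ℕ) : ∀ {v v' : ℕ}, Visited H G sh t v → Visited H G sh t v' →
    (G v).depth = δ → (G v').depth = δ → C (sh.node v).lo (sh.node v).hi →
    C (sh.node v').lo (sh.node v').hi → v = v' := by
  induction δ with
  | zero =>
    intro v v' h h' hd hd' _ _
    rw [hM.depth_zero h.lt hd, hM.depth_zero h'.lt hd']
  | succ δ ih =>
    intro v v' h h' hd hd' hc hc'
    have hr : v ≠ root := by rintro rfl; rw [hM.root_depth] at hd; omega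
    have hr' : v' ≠ root := by rintro rfl; rw [hM.root_depth] at hd'; omega
    have hn := (hM.node v h.lt).nonroot hr
    have hn' := (hM.node v' h'.lt).nonroot hr'
    have e1 := hn.depth_eq
    have e2 := hn'.depth_eq
    have r1 := hM.range_of_par h.lt hr
    have r2 := hM.range_of_par h'.lt hr'
    have hp := ih (h'.par hM hr') (h.par hM hr) (by omega) (by omega) (hC.mono hc' r2.1 r2.2)
      (hC.mono hc r1.1 r1.2)
    rw [hn.lo_eq, hn.hi_eq] at hc
    rw [hn'.lo_eq, hn'.hi_eq, hp] at hc'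
    exact h.eq h' hM hU hr hr' hp (hC.dir_eq hn.par_inner hc' hc)

open scoped Classical in
/-- The nodes that an operation visits. -/
noncomputable def visitSet (H : ℕ → Op α) (G : ℕ → Ghost) (sh : Shared α) (t : ℕ) : Finset ℕ :=
  (Finset.range sh.next).filter (Visited H G sh t)

theorem mem_visitSet : v ∈ visitSet H G sh t ↔ Visited H G sh t v := by
  simp only [visitSet, Finset.mem_filter, Finset.mem_range, and_iff_right_iff_imp]
  exact fun h => h.lt

/-- For each of the two cutting points, the visited nodes whose range it cuts form a path, by
uniqueness along registers. -/
theorem card_visitSet_depth_le (hM : MemOK K H G sh) (hU : Unique H G sh) (t δ : ℕ) :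
    ((visitSet H G sh t).filter fun v => (G v).depth = δ).card ≤ 2 := by
  classical
  obtain ⟨C₁, C₂, h1, h2, h3⟩ := (H t).exists_cuts
  have hsub : ((visitSet H G sh t).filter fun v => (G v).depth = δ) ⊆
      (((visitSet H G sh t).filter fun v => (G v).depth = δ).filter fun v =>
        C₁ (sh.node v).lo (sh.node v).hi) ∪
      (((visitSet H G sh t).filter fun v => (G v).depth = δ).filter fun v =>
        C₂ (sh.node v).lo (sh.node v).hi) := by
    intro v hv
    rw [Finset.mem_union]
    rcases h3 _ _ (mem_visitSet.1 (Finset.mem_filter.1 hv).1).visits with h | h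
    · exact Or.inl (Finset.mem_filter.2 ⟨hv, h⟩)
    · exact Or.inr (Finset.mem_filter.2 ⟨hv, h⟩)
  have key : ∀ C : Bound α → Bound α → Prop, Cut C →
      (((visitSet H G sh t).filter fun v => (G v).depth = δ).filter fun v =>
        C (sh.node v).lo (sh.node v).hi).card ≤ 1 := by
    intro C hC
    rw [Finset.card_le_one]
    intro v hv v' hv'
    rw [Finset.mem_filter, Finset.mem_filter, mem_visitSet] at hv hv'
    exact hv.1.1.eq_of_cut hC hM hU δ hv'.1.1 hv.1.2 hv'.1.2 hv.2 hv'.2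
  have := (Finset.card_le_card hsub).trans (Finset.card_union_le _ _)
  have := key C₁ h1
  have := key C₂ h2
  omega

/-- A bound, at time `t`, for the number of keys in the subtree of a node since its creation. -/
noncomputable def weightAt (H : ℕ → Op α) (G : ℕ → Ghost) (sh : Shared α) (t v : ℕ) : ℕ :=
  (keysIn (contents H (G v).birth) (sh.node v).lo (sh.node v).hi).card +
    mods H (G v).birth t (sh.node v).lo (sh.node v).hi

theorem InnerOK.two_le {n : Node α} {b : ℕ} (h : InnerOK K H n b) (hi : n.body.IsInner)
    (hr : ∀ d, n.lo ≤ (n.childRange d).1 ∧ (n.childRange d).2 ≤ n.hi) : 2 ≤ n.body.initSz := by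
  obtain ⟨r, i, hb⟩ := Body.isInner_iff.1 hi
  have c1 : n.childRange .left = (n.lo, r) := by simp [Node.childRange, hb]
  have c2 : n.childRange .right = (r, n.hi) := by simp [Node.childRange, hb]
  have h1 := (h.half .left).1
  have h2 := (h.half .right).1
  have b1 := (hr .right).1
  have b2 := (hr .left).2
  rw [c1] at h1 b2
  rw [c2] at h2 b1
  have h3 := keysIn_split (contents H b) b1 b2
  have h4 := h.init
  simp only at h1 h2 h3
  omega

/-- The number of modifications of a visited node. -/
theorem Visited.mods_le (h : Visited H G sh t v) (hM : MemOK K H G sh) (hr : v ≠ root) :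
    (mods H (G v).birth t (sh.node v).lo (sh.node v).hi : ℝ) ≤
      max 1 (K * (sh.node v).body.initSz) := by
  have hn := (hM.node v h.lt).nonroot hr
  have hin := hn.inner (h.inner hM)
  refine le_trans ?_ hin.bound
  rw [hin.mod]
  exact_mod_cast mods_mono (h.le_lastTs.trans hn.lastTs_le_tsMod)

/-- An inner node starts with at least two keys, so both terms of the maximum are at most `initSz`;
here `K < 1` enters. -/
theorem Visited.mods_le_initSz (h : Visited H G sh t v) (hM : MemOK K H G sh) (hr : v ≠ root)
    (hK : K < 1) :
    mods H (G v).birth t (sh.node v).lo (sh.node v).hi ≤ (sh.node v).body.initSz := by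
  have hn := hM.node v h.lt
  have h2 := ((hn.nonroot hr).inner (h.inner hM)).two_le (h.inner hM) (hn.range (h.inner hM))
  have h3 := h.mods_le hM hr
  have h4 : (2 : ℝ) ≤ (sh.node v).body.initSz := by exact_mod_cast h2
  have h5 : max 1 (K * (sh.node v).body.initSz) ≤ ((sh.node v).body.initSz : ℝ) :=
    max_le (by linarith) (by nlinarith)
  exact_mod_cast h3.trans h5

theorem Visited.weightAt_pos (h : Visited H G sh t v) (hM : MemOK K H G sh) (hr : v ≠ root) :
    1 ≤ weightAt H G sh t v := by
  have hn := hM.node v h.lt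
  have hin := (hn.nonroot hr).inner (h.inner hM)
  have h2 := hin.two_le (h.inner hM) (hn.range (h.inner hM))
  have h3 := hin.init
  unfold weightAt
  omega

/-- The weights decrease geometrically with the depth. -/
theorem Visited.weightAt_par (h : Visited H G sh t v) (hM : MemOK K H G sh) (hr : v ≠ root)
    (hp : (G v).par ≠ root) (hK : K < 1) :
    8 * weightAt H G sh t v ≤ 7 * weightAt H G sh t (G v).par := by
  have hn := (hM.node v h.lt).nonroot hr
  have hpv := h.par hM hr
  have hpn := hM.node _ hn.par_lt
  have hin := (hpn.nonroot hp).inner hn.par_inner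
  have h2 := hin.two_le hn.par_inner (hpn.range hn.par_inner)
  have h3 := hpv.mods_le_initSz hM hp hK
  have h4 := (hin.half (G v).dir).2
  rw [← hn.lo_eq, ← hn.hi_eq] at h4
  have h5 := hin.init
  have h6 := (card_keysIn_le (H := H) (lo := (sh.node v).lo) (hi := (sh.node v).hi)
    hn.birth_par).1
  have h7 := mods_add (H := H) (lo := (sh.node v).lo) (hi := (sh.node v).hi) hn.birth_par
    h.birth_lt.le
  have hrg := hM.range_of_par h.lt hr
  have h8 := mods_range_mono (H := H) (a := (G (G v).par).birth) (b := t) hrg.1 hrg.2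
  unfold weightAt
  -- With `i` the initial size and `m` the modifications of the parent, this amounts to `8 * ((i +
  -- 1) / 2 + m) ≤ 7 * (i + m)`, that is `4 + m ≤ 3 * i`, true for `m ≤ i` and `2 ≤ i`.
  omega

/-- A child of the fictive root holds all keys, so its initial size `i` exceeds the content at time
`t` by at most the modifications, that is by at most `1 + K * i`. Hence `(1 - K) * i` is bounded by
the content plus one, and the weight is at most `2 * i`. -/
theorem Visited.weightAt_top (h : Visited H G sh t v) (hM : MemOK K H G sh) (hr : v ≠ root)
    (hp : (G v).par = root) (hK0 : 0 < K) (hK : K < 1) :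
    (weightAt H G sh t v : ℝ) ≤ 2 / (1 - K) * ((contents H t).card + 1) := by
  have hn := (hM.node v h.lt).nonroot hr
  have hin := hn.inner (h.inner hM)
  have h1 := h.mods_le hM hr
  have h2 := h.mods_le_initSz hM hr hK
  have hlo : (sh.node v).lo = ⊥ := by
    rw [hn.lo_eq, hp, hn.par_root hp]
    simp [Node.childRange, hM.root_body, hM.root_lo]
  have hhi : (sh.node v).hi = ⊤ := by
    rw [hn.hi_eq, hp, hn.par_root hp]
    simp [Node.childRange, hM.root_body]
  have h3 := (card_keysIn_le (H := H) (lo := (sh.node v).lo) (hi := (sh.node v).hi)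
    h.birth_lt.le).2
  have h4 := hin.init
  have h5 : (keysIn (contents H t) (sh.node v).lo (sh.node v).hi).card = (contents H t).card := by
    rw [hlo, hhi, keysIn_univ]
  rw [h5, ← h4] at h3
  have h6 : weightAt H G sh t v ≤ 2 * (sh.node v).body.initSz := by
    unfold weightAt
    omega
  have h7 : ((sh.node v).body.initSz : ℝ) ≤ (contents H t).card +
      mods H (G v).birth t (sh.node v).lo (sh.node v).hi := by exact_mod_cast h3
  have h8 : (0 : ℝ) ≤ (sh.node v).body.initSz := by positivity
  have h9 : (weightAt H G sh t v : ℝ) ≤ 2 * (sh.node v).body.initSz := by exact_mod_cast h6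
  have h10 : (0 : ℝ) < 1 - K := by linarith
  have h11 : (1 - K) * (sh.node v).body.initSz ≤ (contents H t).card + 1 := by
    have h12 : max 1 (K * (sh.node v).body.initSz) ≤ 1 + K * (sh.node v).body.initSz :=
      max_le (by nlinarith) (by linarith)
    linarith
  rw [div_mul_eq_mul_div, le_div_iff₀ h10]
  nlinarith

end Visits

/-! ### Bounds for the number of visits and for the weight of rebuilt nodes -/

section Bounds

variable {α : Type u} [LinearOrder α] {K : ℝ} {H : ℕ → Op α} {G : ℕ → Ghost} {sh : Shared α}
  {v t : ℕ}

/-- A bound for the depth of the nodes that an operation visits, for trees of size `n`. -/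
noncomputable def depthBound (K : ℝ) (n : ℕ) : ℝ :=
  1 + (Real.log (2 / (1 - K)) + Real.log (n + 1)) / Real.log (8 / 7)

theorem log_ratio_pos : (0 : ℝ) < Real.log (8 / 7) := Real.log_pos (by norm_num)

theorem log_const_nonneg (hK0 : 0 < K) (hK : K < 1) : 0 ≤ Real.log (2 / (1 - K)) := by
  refine Real.log_nonneg ?_
  rw [le_div_iff₀ (by linarith)]
  linarith

theorem log_succ_nonneg (n : ℕ) : 0 ≤ Real.log ((n : ℝ) + 1) :=
  Real.log_nonneg (by have : (0 : ℝ) ≤ n := by positivity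
                      linarith)

theorem depthBound_ge_one (hK0 : 0 < K) (hK : K < 1) (n : ℕ) : 1 ≤ depthBound K n := by
  have h1 := log_const_nonneg hK0 hK
  have h2 := log_succ_nonneg n
  have h3 : 0 ≤ (Real.log (2 / (1 - K)) + Real.log (n + 1)) / Real.log (8 / 7) :=
    div_nonneg (by linarith) log_ratio_pos.le
  unfold depthBound
  linarith

/-- Iterates the factor `7/8` upwards to depth `1`. Since weights of visited nodes are at least `1`,
this bounds the depth logarithmically. -/
theorem Visited.weightAt_le (hM : MemOK K H G sh) (hK0 : 0 < K) (hK : K < 1) (δ : ℕ) :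
    ∀ {v : ℕ}, Visited H G sh t v → (G v).depth = δ + 1 →
      (weightAt H G sh t v : ℝ) * (8 / 7) ^ δ ≤ 2 / (1 - K) * ((contents H t).card + 1) := by
  induction δ with
  | zero =>
    intro v h hd
    have hr : v ≠ root := by rintro rfl; rw [hM.root_depth] at hd; omega
    have hn := (hM.node v h.lt).nonroot hr
    have := hn.depth_eq
    rw [pow_zero, mul_one]
    exact h.weightAt_top hM hr (hM.depth_zero hn.par_lt (by omega)) hK0 hK
  | succ δ ih =>
    intro v h hd
    have hr : v ≠ root := by rintro rfl; rw [hM.root_depth] at hd; omega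
    have hn := (hM.node v h.lt).nonroot hr
    have h1 := hn.depth_eq
    have hp : (G v).par ≠ root := by
      intro hp
      rw [hp, hM.root_depth] at h1
      omega
    have h2 : 8 * (weightAt H G sh t v : ℝ) ≤ 7 * weightAt H G sh t (G v).par := by
      exact_mod_cast h.weightAt_par hM hr hp hK
    have h3 := ih (h.par hM hr) (by omega)
    have h4 : (0 : ℝ) ≤ (8 / 7) ^ δ := by positivity
    rw [pow_succ]
    nlinarith

theorem Visited.depth_le (h : Visited H G sh t v) (hM : MemOK K H G sh) (hK0 : 0 < K)
    (hK : K < 1) : ((G v).depth : ℝ) ≤ depthBound K (contents H t).card := by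
  cases hd : (G v).depth with
  | zero =>
    have := depthBound_ge_one hK0 hK (contents H t).card
    rw [Nat.cast_zero]
    linarith
  | succ δ =>
    have hr : v ≠ root := by rintro rfl; rw [hM.root_depth] at hd; omega
    have h1 := h.weightAt_le hM hK0 hK δ hd
    have h2 : (1 : ℝ) ≤ weightAt H G sh t v := by exact_mod_cast h.weightAt_pos hM hr
    have h3 : (0 : ℝ) < (8 / 7) ^ δ := by positivity
    have h4 : ((8 / 7 : ℝ)) ^ δ ≤ 2 / (1 - K) * ((contents H t).card + 1) := by nlinarith
    have h5 := Real.log_le_log h3 h4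
    have h6 : (0 : ℝ) < 1 - K := by linarith
    rw [Real.log_pow, Real.log_mul (by positivity) (by positivity), ← le_div_iff₀ log_ratio_pos]
      at h5
    unfold depthBound
    push_cast
    linarith

/-- At most two nodes for each depth from `0`, the fictive root, up to the bound. -/
theorem card_visitSet_le (hM : MemOK K H G sh) (hU : Unique H G sh) (hK0 : 0 < K) (hK : K < 1)
    (t : ℕ) : ((visitSet H G sh t).card : ℝ) ≤ 2 * (depthBound K (contents H t).card + 1) := by
  have h0 := depthBound_ge_one hK0 hK (contents H t).card
  have h1 := Finset.card_le_mul_card_image_of_maps_to (s := visitSet H G sh t)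
    (t := Finset.range (⌊depthBound K (contents H t).card⌋₊ + 1)) (f := fun v => (G v).depth)
    (fun v hv => by
      have := (mem_visitSet.1 hv).depth_le hM hK0 hK
      rw [Finset.mem_range, Nat.lt_succ_iff]
      exact Nat.le_floor this) 2 fun δ _ => card_visitSet_depth_le hM hU t δ
  rw [Finset.card_range] at h1
  have h2 : ((visitSet H G sh t).card : ℝ) ≤
      2 * ((⌊depthBound K (contents H t).card⌋₊ : ℝ) + 1) := by exact_mod_cast h1
  have h3 := Nat.floor_le (show 0 ≤ depthBound K (contents H t).card by linarith)
  linarith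

/-- Double counting of the visits. -/
theorem MemOK.visits_eq (hM : MemOK K H G sh) :
    sh.visits = ∑ t ∈ Finset.range (sh.node root).lastTs, (visitSet H G sh (t + 1)).card := by
  classical
  have h1 : ∀ v ∈ Finset.range sh.next, visitCount H (sh.node v) (G v).birth =
      ∑ t ∈ Finset.range (sh.node root).lastTs, if Visited H G sh (t + 1) v then 1 else 0 := by
    intro v hv
    have hlt := Finset.mem_range.1 hv
    have hle := (hM.node v hlt).lastTs_le
    rw [← Finset.card_filter]
    unfold visitCount
    refine Finset.card_bij' (fun t _ => t - 1) (fun t _ => t + 1) ?_ ?_ ?_ ?_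
    · intro t ht
      rw [Finset.mem_filter, Finset.mem_Ioc] at ht
      rw [Finset.mem_filter, Finset.mem_range, Nat.sub_add_cancel (by omega)]
      exact ⟨by omega, hlt, ht.1.1, ht.1.2, ht.2⟩
    · intro t ht
      rw [Finset.mem_filter, Finset.mem_range] at ht
      rw [Finset.mem_filter, Finset.mem_Ioc]
      exact ⟨⟨ht.2.birth_lt, ht.2.le_lastTs⟩, ht.2.visits⟩
    · intro t ht
      rw [Finset.mem_filter, Finset.mem_Ioc] at ht
      exact Nat.sub_add_cancel (by omega)
    · intro t _
      simp
  rw [hM.visits, Finset.sum_congr rfl h1, Finset.sum_comm]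
  refine Finset.sum_congr rfl fun t _ => ?_
  rw [← Finset.card_filter]
  congr 1

/-- Every operation with a timestamp has been in the root queue, so the costs per timestamp are
absorbed by the visits. -/
theorem MemOK.lastTs_le_visits (hM : MemOK K H G sh) : (sh.node root).lastTs ≤ sh.visits := by
  classical
  rw [hM.visits]
  refine le_trans (Eq.le ?_) (Finset.single_le_sum (f := fun v => visitCount H (sh.node v) (G v).birth)
    (fun _ _ => Nat.zero_le _) (Finset.mem_range.2 hM.root_lt))
  simp only [visitCount]
  rw [Finset.filter_true_of_mem fun t _ => by
    rw [hM.root_lo, hM.root_hi]; exact visits_univ _, hM.root_birth, Nat.card_Ioc, Nat.sub_zero]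

section Processes

variable {Ex : Finset (ℕ × ℕ)} {Rb : Finset ℕ} {fs : List (Frame α)} {A : List (ℕ × ℕ)}
  {ini : Option (ℕ × Bool)}

theorem ProcOK.card_ex_le (hp : ProcOK K H G sh Ex Rb fs A ini) (hM : MemOK K H G sh) :
    Ex.card ≤ sh.visits := by
  classical
  rw [hM.visits]
  unfold visitCount
  rw [← Finset.card_sigma]
  refine Finset.card_le_card_of_injOn (fun x => ⟨x.2, x.1⟩) (fun x hx => ?_) ?_
  · have h := (hp.ex x hx).1
    simp only [Finset.coe_sigma, Set.mem_sigma_iff, Finset.coe_range, Set.mem_Iio, Finset.mem_coe,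
      Finset.mem_filter, Finset.mem_Ioc]
    exact ⟨h.lt, ⟨h.birth_lt, h.le_lastTs⟩, h.visits⟩
  · intro x _ y _ hxy
    simp only [Sigma.mk.injEq, heq_eq_eq] at hxy
    exact Prod.ext hxy.2 hxy.1

/-- The amortization of rebuilding. The need to rebuild gives `K * initSz < modCnt + 1 ≤ 2 *
modCnt`, the last step because `modCnt` is positive, and each counted modification has been in the
queue of the node. -/
theorem Rebuild.weight_le {D : Desc α} {v c : ℕ} {d : Dir} (hr : Rebuild K H sh D v d c)
    (hM : MemOK K H G sh) (hV : Visit H G sh D v d c) (hK0 : 0 < K) :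
    ((sh.node c).weight : ℝ) ≤ (2 / K + 1) * visitCount H (sh.node c) (G c).birth := by
  classical
  have hn := hM.node c hV.lt
  have hm := hn.nonroot hV.ne_root
  have hin := hm.inner hr.inner
  obtain ⟨h1, h2, h3⟩ := hr.needs
  have h4 : (sh.node c).st.modCnt ≤ visitCount H (sh.node c) (G c).birth := by
    rw [hin.mod]
    refine Finset.card_le_card fun t ht => ?_
    rw [Finset.mem_filter, Finset.mem_Ioc] at ht
    rw [Finset.mem_filter, Finset.mem_Ioc]
    refine ⟨⟨ht.1.1, ?_⟩, ht.2.2⟩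
    -- A modification in the record but beyond the tail of the queue would contradict that `c` has
    -- received all operations before `D`.
    by_contra h5
    exact (hr.upTo t (not_le.1 h5) (by omega) ht.2.2).1 hr.inner
  have h5 : ((D.newState (sh.node c).st).modCnt : ℝ) ≤ 2 * (sh.node c).st.modCnt := by
    have := newState_modCnt_le (D := D) (s := (sh.node c).st)
    exact_mod_cast (by omega : (D.newState (sh.node c).st).modCnt ≤ 2 * (sh.node c).st.modCnt)
  have h6 : ((sh.node c).st.modCnt : ℝ) ≤ visitCount H (sh.node c) (G c).birth := by
    exact_mod_cast h4
  have h7 : ((sh.node c).body.initSz : ℝ) ≤ 2 / K * (sh.node c).st.modCnt := by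
    rw [div_mul_eq_mul_div, le_div_iff₀ hK0]
    linarith
  have h8 : 0 ≤ 2 / K := by positivity
  rw [Node.weight_inner hr.inner]
  push_cast
  nlinarith

/-- Visits of different nodes are different, and `Rb` contains each node once. So all rebuildings of
one process together are paid by the visits. -/
theorem ProcOK.weight_rb_le (hp : ProcOK K H G sh Ex Rb fs A ini) (hM : MemOK K H G sh)
    (hK0 : 0 < K) : ((∑ c ∈ Rb, (sh.node c).weight : ℕ) : ℝ) ≤ (2 / K + 1) * sh.visits := by
  have h0 : 0 ≤ 2 / K + 1 := by positivity
  rw [Nat.cast_sum, hM.visits, Nat.cast_sum, Finset.mul_sum]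
  refine le_trans (Finset.sum_le_sum fun c hc => ?_)
    (Finset.sum_le_sum_of_subset_of_nonneg (s := Rb) (fun c hc => ?_) fun c _ _ => ?_)
  · obtain ⟨⟨D, v, d, h1, h2⟩, -⟩ := hp.rb c hc
    exact h2.weight_le hM h1 hK0
  · obtain ⟨⟨D, v, d, h1, h2⟩, -⟩ := hp.rb c hc
    exact Finset.mem_range.2 h1.lt
  · positivity

end Processes

/-- The constant for the number of visits. -/
noncomputable def visitConst (K : ℝ) : ℝ :=
  4 + 2 * ((Real.log (2 / (1 - K)) + 1) / Real.log (8 / 7))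

theorem visitConst_ge (hK0 : 0 < K) (hK : K < 1) : 4 ≤ visitConst K := by
  have := log_const_nonneg hK0 hK
  have : 0 ≤ (Real.log (2 / (1 - K)) + 1) / Real.log (8 / 7) :=
    div_nonneg (by linarith) log_ratio_pos.le
  unfold visitConst
  linarith

theorem two_mul_depthBound_le (hK0 : 0 < K) (hK : K < 1) (n : ℕ) :
    2 * (depthBound K n + 1) ≤ visitConst K * (Real.log (n + 1) + 1) := by
  have h1 := log_const_nonneg hK0 hK
  have h2 := log_succ_nonneg n
  have h3 := log_ratio_pos
  have h4 : (Real.log (2 / (1 - K)) + Real.log (n + 1)) / Real.log (8 / 7) ≤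
      (Real.log (2 / (1 - K)) + 1) / Real.log (8 / 7) * (Real.log (n + 1) + 1) := by
    rw [div_mul_eq_mul_div]
    refine div_le_div_of_nonneg_right ?_ h3.le
    nlinarith
  unfold depthBound visitConst
  nlinarith

theorem log_succ_le (n : ℕ) : Real.log ((n : ℝ) + 1) ≤ Real.log n + 1 := by
  cases n with
  -- Here `Real.log 0 = 0` is used.
  | zero => simp
  | succ n =>
    have := log_add_two_le (le_refl (n + 1))
    push_cast at this ⊢
    exact this

theorem MemOK.visits_le (hM : MemOK K H G sh) (hU : Unique H G sh) (hK0 : 0 < K) (hK : K < 1) :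
    (sh.visits : ℝ) ≤ visitConst K * ∑ t ∈ Finset.range (sh.node root).lastTs,
      (Real.log ((contents H (t + 1)).card + 1) + 1) := by
  rw [hM.visits_eq, Nat.cast_sum, Finset.mul_sum]
  exact Finset.sum_le_sum fun t _ =>
    (card_visitSet_le hM hU hK0 hK (t + 1)).trans (two_mul_depthBound_le hK0 hK _)

end Bounds

/-! ### Total number of visits and total cost -/

section Theorem

variable {α : Type u} [LinearOrder α] {P : Type v} [Fintype P] {K : ℝ} {H : ℕ → Op α}
  {G : ℕ → Ghost} {w : Config α P} {Ex : P → Finset (ℕ × ℕ)} {Rb : P → Finset ℕ}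
  {A : P → List (ℕ × ℕ)} {ini : P → Option (ℕ × Bool)}

/-- The number of nodes that the operations visit. -/
theorem ConfigOK.visits_le [Nonempty P] (h : ConfigOK K H G w Ex Rb A ini) (hK0 : 0 < K)
    (hK : K < 1) : (w.sh.visits : ℝ) ≤ 4 * visitConst K *
      (w.startSizes.map fun N : ℕ => Real.log N + (Fintype.card P : ℝ)).sum := by
  have h1 := h.mem.visits_le h.unique hK0 hK
  have h2 := h.sizes
  have h3 := visitConst_ge hK0 hK
  have hP : (1 : ℝ) ≤ Fintype.card P := by exact_mod_cast Fintype.card_pos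
  have h4 : 0 ≤ ∑ p, waitPot (Fintype.card P) w.sh.keys.card (w.proc p) := by
    refine Finset.sum_nonneg fun p _ => ?_
    unfold waitPot
    split_ifs
    · have := log_succ_nonneg w.sh.keys.card
      positivity
    · exact le_rfl
  -- Since `|P| ≥ 1` and `log N ≥ 0`, the summand is at most `log N + 3 + |P| ≤ 4 * (log N + |P|)`.
  have h5 : (w.startSizes.map fun N : ℕ => Real.log (N + 1) + 2 + (Fintype.card P : ℝ)).sum ≤
      4 * (w.startSizes.map fun N : ℕ => Real.log N + (Fintype.card P : ℝ)).sum := by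
    rw [← List.sum_map_mul_left]
    refine List.sum_le_sum fun N _ => ?_
    have h6 := log_succ_le N
    have h7 := Real.log_natCast_nonneg N
    linarith
  have h6 : (0 : ℝ) ≤ visitConst K := by linarith
  nlinarith

/-- The total cost, in terms of the number of visited nodes. -/
theorem ConfigOK.cost_le [Nonempty P] (h : ConfigOK K H G w Ex Rb A ini) (hK0 : 0 < K) :
    (w.cost : ℝ) ≤ (40 + 20 / K) * Fintype.card P * ((w.startSizes.length : ℝ) + w.sh.visits) := by
  have hP : (1 : ℝ) ≤ Fintype.card P := by exact_mod_cast Fintype.card_pos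
  have h1 : (w.cost : ℝ) ≤ 20 * ∑ p, ((Ex p).card : ℝ) +
      10 * ∑ p, ((∑ c ∈ Rb p, (w.sh.node c).weight : ℕ) : ℝ) +
      8 * (Fintype.card P * (w.sh.node root).lastTs) + 2 * w.startSizes.length := by
    have := h.pot
    exact_mod_cast (by omega : w.cost ≤ _)
  have h2 : ∑ p, ((Ex p).card : ℝ) ≤ Fintype.card P * w.sh.visits := by
    rw [← Finset.card_univ, ← nsmul_eq_mul]
    exact Finset.sum_le_card_nsmul _ _ _ fun p _ => by exact_mod_cast (h.proc p).card_ex_le h.mem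
  have h3 : ∑ p, ((∑ c ∈ Rb p, (w.sh.node c).weight : ℕ) : ℝ) ≤
      Fintype.card P * ((2 / K + 1) * w.sh.visits) := by
    rw [← Finset.card_univ, ← nsmul_eq_mul]
    exact Finset.sum_le_card_nsmul _ _ _ fun p _ => (h.proc p).weight_rb_le h.mem hK0
  have h4 : ((w.sh.node root).lastTs : ℝ) ≤ w.sh.visits := by
    exact_mod_cast h.mem.lastTs_le_visits
  have h5 : (0 : ℝ) ≤ w.startSizes.length := by positivity
  have h6 : (0 : ℝ) ≤ w.sh.visits := by positivity
  have h7 : (0 : ℝ) < 20 / K := by positivity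
  have h8 : 10 * (2 / K + 1) = 20 / K + 10 := by ring
  have h9 : (Fintype.card P : ℝ) * (w.sh.node root).lastTs ≤ Fintype.card P * w.sh.visits :=
    mul_le_mul_of_nonneg_left h4 (by linarith)
  have h10 : (2 : ℝ) * w.startSizes.length ≤
      (40 + 20 / K) * Fintype.card P * w.startSizes.length := by
    refine mul_le_mul_of_nonneg_right ?_ h5
    nlinarith
  have h11 : (0 : ℝ) ≤ Fintype.card P * w.sh.visits := by positivity
  nlinarith

end Theorem

end WaitFreeBST

theorem theorem3 (K : ℝ) (hK0 : 0 < K) (hK1 : K < 1) :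
    ∃ C : ℝ, ∀ (α : Type u) [LinearOrder α] (P : Type v) [Fintype P] [DecidableEq P]
      (w : WaitFreeBST.Config α P), WaitFreeBST.Reachable K w →
      -- amortized cost of the operations
      (w.cost : ℝ) ≤ (w.startSizes.map fun N : ℕ =>
          C * ((Real.log N + Fintype.card P) * Fintype.card P)).sum ∧
      -- amortized number of nodes traversed
      (w.sh.visits : ℝ) ≤ (w.startSizes.map fun N : ℕ =>
          C * (Real.log N + Fintype.card P)).sum ∧
      -- amortized cost per operation and traversed node, rebuilding included
      (w.cost : ℝ) ≤ C * Fintype.card P * ((w.startSizes.length : ℝ) + w.sh.visits) := by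
  -- The first factor comes from `ConfigOK.cost_le`; the second bounds `m + V` by a multiple of the
  -- sum of `log N + |P|`, of which `m` itself takes the share `1`.
  refine ⟨(40 + 20 / K) * (1 + 4 * WaitFreeBST.visitConst K),
    fun α _ P _ _ w hw => ?_⟩
  have hc := WaitFreeBST.visitConst_ge hK0 hK1
  have hk : (0 : ℝ) < 20 / K := by positivity
  -- Without processes or without operations nothing ever happens, and all sums are empty.
  by_cases he : P → WaitFreeBST.Op α → False
  · rw [hw.eq_init he]
    simp [WaitFreeBST.Shared.init]
  push Not at he
  obtain ⟨p, op, -⟩ := he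
  have : Nonempty P := ⟨p⟩
  obtain ⟨H, G, h⟩ := hw.exists_configOK op
  obtain ⟨Ex, Rb, A, ini, h⟩ := h H G (fun _ _ => rfl) fun _ _ => rfl
  have h1 := h.cost_le hK0
  have h2 := h.visits_le hK0 hK1
  have hP : (1 : ℝ) ≤ Fintype.card P := by exact_mod_cast Fintype.card_pos
  have h3 : (w.startSizes.length : ℝ) ≤
      (w.startSizes.map fun N : ℕ => Real.log N + (Fintype.card P : ℝ)).sum := by
    rw [← mul_one (w.startSizes.length : ℝ), ← nsmul_eq_mul, ← List.sum_replicate,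
      ← List.map_const']
    refine List.sum_le_sum fun N _ => ?_
    have := Real.log_natCast_nonneg N
    linarith
  have h4 : (0 : ℝ) ≤ w.startSizes.length := by positivity
  have h5 : (0 : ℝ) ≤ w.sh.visits := by positivity
  have h6 : (40 + 20 / K) ≤ (40 + 20 / K) * (1 + 4 * WaitFreeBST.visitConst K) :=
    le_mul_of_one_le_right (by linarith) (by linarith)
  have h7 : 4 * WaitFreeBST.visitConst K ≤
      (40 + 20 / K) * (1 + 4 * WaitFreeBST.visitConst K) := by nlinarith
  refine ⟨?_, ?_, ?_⟩
  · have h8 : (w.startSizes.map fun N : ℕ => (40 + 20 / K) * (1 + 4 * WaitFreeBST.visitConst K) *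
        ((Real.log N + Fintype.card P) * Fintype.card P)).sum =
        (40 + 20 / K) * Fintype.card P * ((1 + 4 * WaitFreeBST.visitConst K) *
          (w.startSizes.map fun N : ℕ => Real.log N + (Fintype.card P : ℝ)).sum) := by
      rw [← List.sum_map_mul_left, ← List.sum_map_mul_left]
      congr 1
      refine List.map_congr_left fun N _ => ?_
      ring
    rw [h8]
    refine h1.trans (mul_le_mul_of_nonneg_left ?_ (by positivity))
    linarith
  · rw [List.sum_map_mul_left]
    exact h2.trans (mul_le_mul_of_nonneg_right h7 (h4.trans h3))
  · refine h1.trans (mul_le_mul_of_nonneg_right ?_ (by positivity))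
    exact mul_le_mul_of_nonneg_right h6 (by positivity)
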